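/- Let $p>1$, $0<r<p$, $\beta\in\mathbb R$ and $f(s)=s^p+s^r(\log s)^\beta$ for $s>2$. Put $F(s)=\int_s^\infty \frac{du}{f(u)}$ (a convergent integral), $q_f=\lim_{u\to\infty}\frac{f'(u)^2}{f(u)f''(u)}$ and $\frac1{p_f}+\frac1{q_f}=1$. **(1)** The limit $q_f$ exists and $p_f=p$. For $s>2$, $f'(s)=ps^{p-1}+rs^{r-1}(\log s)^\beta+\beta s^{r-1}(\log s)^{\beta-1}$, and as $s\to\infty$ $$F(s)=\frac1{p-1}\frac1{s^{p-1}}-\frac1{2p-r-1}\frac{(\log s)^\beta}{s^{2p-r-1}}+O\Big(\frac{(\log s)^{\beta-1}}{s^{2p-r-1}}\Big),$$ $$f'(s)F(s)=\frac p{p-1}-\frac{(p-r)(p-r-1)}{(p-1)(2p-r-1)}\frac{(\log s)^\beta}{s^{p-r}}+O\Big(\frac{(\log s)^{\beta-1}}{s^{p-r}}\Big),$$ $$\frac{f(s)F(s)}s=\frac1{p-1}+\frac{p-r}{(p-1)(2p-r-1)}\frac{(\log s)^\beta}{s^{p-r}}+O\Big(\frac{(\log s)^{\beta-1}}{s^{p-r}}\Big).$$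 **(2)** Let $N\ge3$ be an integer and $p>p_c:=\frac N{N-2}$. For all large $\rho$ let $\phi(\rho)=F^{-1}\big(\frac{e^{-2\rho}}{2N-4q_f}\big)>2$ (this is well defined), where $F^{-1}$ is the inverse of $F$ on $(2,\infty)$, and $$I(\rho)=\frac{4f(\phi)F(\phi)}{\phi}\big(f'(\phi)F(\phi)-q_f\big).$$ For positive functions, $g\simeq h$ means $C^{-1}h\le g\le Ch$ for some $C>0$ and all sufficiently large $\rho$. Then $$\frac{(\log\phi(\rho))^\beta}{\phi(\rho)^{p-r}}\simeq\rho^\beta e^{-\frac{2(p-r)}{p-1}\rho},\qquad I(\rho)=O\big(\rho^\beta e^{-\frac{2(p-r)}{p-1}\rho}\big)\quad(\rho\to\infty),$$ and if $r\ne p-1$ then $|I(\rho)|\simeq\rho^\beta e^{-\frac{2(p-r)}{p-1}\rho}$, with $I>0$ for large $\rho$ if $r>p-1$ and $I<0$ for large $\rho$ if $r<p-1$. **(3)** Let in addition $p<p_S:=\frac{N+2}{N-2}$. Put $p_*=1+\frac4{N-4+2\sqrt{N-1}}$, $a=\frac4{p-1}-N+2$, $b=2N-4q_f$, $m=\frac2{p-1}$,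 $D=(N-2-2m)^2-8(N-2-m)=a^2-4b$, $\lambda_{1}=\frac{a-\sqrt D}2$ and $\lambda_2=\frac{a+\sqrt D}2$ (for $p<p_*$), $\lambda_*=\frac2{p_*-1}-\frac{N-2}2$, $k=\frac{\sqrt{-D}}2$ (for $p>p_*$), and let $\Lambda=\lambda_1$, $\lambda_*$, $\frac a2$ for $p<p_*$, $p=p_*$, $p>p_*$ respectively. Let $r^*=p-\frac{p-1}2\Lambda$, i.e. $\frac{2(p-r^*)}{p-1}=\Lambda$; explicitly $r^*=\frac{p-1}4(N+2+\sqrt D)$ if $p<p_*$ and $r^*=\frac{(p-1)(N+2)}4$ if $p\ge p_*$. Put $$L_1=b\Big[(f'(\phi)F(\phi)-q_f)-\Big(\frac{f(\phi)F(\phi)}\phi-\frac1{p-1}\Big)\Big]+I,\qquad L_2=4\Big(\frac{f(\phi)F(\phi)}\phi-\frac1{p-1}\Big),$$ $$N[\eta]=b\,\frac{F(\phi)}\phi\big(f(\phi(1+\eta))-f(\phi)-f'(\phi)\phi\eta\big).$$ Then there exist $\rho_0,\epsilon>0$, with $\phi$ well defined on $[\rho_0,\infty)$, such that for all $A,B>0$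 with $A+B<\epsilon$ there is $\eta\in C^2((\rho_0,\infty))\cap C^1([\rho_0,\infty))$ with $\eta(\rho_0)=A$, $\eta'(\rho_0)=B$, $\phi(1+\eta)>2$ on $[\rho_0,\infty)$, solving $$\eta''+a\eta'+b\eta+I+L_1\eta+L_2\eta'+N[\eta]=0\quad\text{on }(\rho_0,\infty)$$ together with, for some constants $C_1,C_2$ and all $\rho\ge\rho_0$, its integral form $$\eta(\rho)=C_1\Phi_1(\rho)+C_2\Phi_2(\rho)-\int_{\rho_0}^\rho K(\rho,\tau)\{I+L_1\eta+L_2\eta'+N[\eta]\}(\tau)\,d\tau,$$ where $(\Phi_1,\Phi_2)$ is $(e^{-\lambda_1\rho},e^{-\lambda_2\rho})$ for $p<p_*$, $(e^{-\lambda_*\rho},\rho e^{-\lambda_*\rho})$ for $p=p_*$, $(e^{-\frac a2\rho}\cos k\rho,e^{-\frac a2\rho}\sin k\rho)$ for $p>p_*$, and $K(\rho,\tau)=\frac{\Phi_1(\tau)\Phi_2(\rho)-\Phi_1(\rho)\Phi_2(\tau)}{\Phi_1(\tau)\Phi_2'(\tau)-\Phi_1'(\tau)\Phi_2(\tau)}$;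 and $|\eta(\rho)|+|\eta'(\rho)|=O(T(\rho))$ as $\rho\to\infty$, where $T$ is given by the following table. | | $p_c<p<p_*$ | $p=p_*$ | $p_*<p<p_S$ | |---|---|---|---| | $0<r<r^*$ | $e^{-\lambda_1\rho}$ | $\rho e^{-\lambda_*\rho}$ | $e^{-\frac a2\rho}$ | | $r=r^*$, $\beta>-1$ | $\rho^{\beta+1}e^{-\lambda_1\rho}$ | $\rho^{\beta+2}e^{-\lambda_*\rho}$ | $\rho^{\beta+1}e^{-\frac a2\rho}$ | | $r=r^*$, $\beta=-1$ | $(\log\rho)e^{-\lambda_1\rho}$ | $\rho(\log\rho)e^{-\lambda_*\rho}$ | $e^{-\frac a2\rho}$ | | $r=r^*$, $\beta<-1$ | $e^{-\lambda_1\rho}$ | $\rho e^{-\lambda_*\rho}$ | $e^{-\frac a2\rho}$ | | $r^*<r<p$ | $\rho^\beta e^{-\frac{2(p-r)}{p-1}\rho}$ | $\rho^\beta e^{-\frac{2(p-r)}{p-1}\rho}$ | $\rho^\beta e^{-\frac{2(p-r)}{p-1}\rho}$ | -/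

import Mathlib

open Set Filter Topology Asymptotics MeasureTheory

noncomputable section

namespace SingularElliptic

/-! ### Nonlinearities and their growth exponents -/

/-- `F(s) = ∫_s^∞ du / f(u)`. -/
def bigF (f : ℝ → ℝ) (s : ℝ) : ℝ := ∫ u in Ioi s, 1 / f u

/-- The quotient `f'(u)² / (f(u) f''(u))` whose limit at infinity is `q_f`. -/
def growthQuotient (f : ℝ → ℝ) (u : ℝ) : ℝ :=
  (deriv f u) ^ 2 / (f u * deriv (deriv f) u)

/-- `q_f = lim_{u → ∞} f'(u)² / (f(u) f''(u))`; meaningful when the limit exists. -/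
def qExp (f : ℝ → ℝ) : ℝ := limUnder atTop (growthQuotient f)

/-- `p_f`, the Hölder conjugate `q_f / (q_f - 1)` of `q_f`. -/
def pExp (f : ℝ → ℝ) : ℝ := (qExp f).conjExponent

/-! ### Exponents depending on the dimension `N` -/

/-- `p_c = N / (N - 2)`. -/
def pCrit (N : ℕ) : ℝ := (N : ℝ) / ((N : ℝ) - 2)

/-- `p_S = (N + 2) / (N - 2)`. -/
def pSob (N : ℕ) : ℝ := ((N : ℝ) + 2) / ((N : ℝ) - 2)

/-- `p_* = 1 + 4 / (N - 4 + 2 √(N - 1))`. -/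
def pStar (N : ℕ) : ℝ := 1 + 4 / ((N : ℝ) - 4 + 2 * √((N : ℝ) - 1))

/-- `a = 4 / (p - 1) - N + 2`. -/
def aCoef (N : ℕ) (p : ℝ) : ℝ := 4 / (p - 1) - N + 2

/-- `b = 2 N - 4 q`. -/
def bCoef (N : ℕ) (q : ℝ) : ℝ := 2 * N - 4 * q

/-- The discriminant `(N - 2 - 2m)² - 8 (N - 2 - m)`, `m = 2 / (p - 1)`, of `λ² + a λ + b`. -/
def discr (N : ℕ) (p : ℝ) : ℝ :=
  ((N : ℝ) - 2 - 2 * (2 / (p - 1))) ^ 2 - 8 * ((N : ℝ) - 2 - 2 / (p - 1))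

def lambdaOne (N : ℕ) (p : ℝ) : ℝ := (2 * (2 / (p - 1)) - N + 2 - √(discr N p)) / 2

def lambdaTwo (N : ℕ) (p : ℝ) : ℝ := (2 * (2 / (p - 1)) - N + 2 + √(discr N p)) / 2

/-- `λ_* = 2 / (p_* - 1) - (N - 2) / 2`. -/
def lambdaStar (N : ℕ) : ℝ := 2 / (pStar N - 1) - ((N : ℝ) - 2) / 2

/-- The imaginary part `k` of the complex conjugate roots `-a/2 ± k i`. -/
def freq (N : ℕ) (p : ℝ) : ℝ := √(-(discr N p)) / 2

open Classical in
/-- The decay exponent `Λ`: `λ₁`, `λ_*` or `a / 2` according to the position of `p`. -/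
def bigLambda (N : ℕ) (p : ℝ) : ℝ :=
  if p < pStar N then lambdaOne N p
  else if p = pStar N then lambdaStar N
  else aCoef N p / 2

/-- The threshold exponent `r^*`, that is, the solution of `2 (p - r^*) / (p - 1) = Λ`.
Explicitly, `r^* = (p - 1) (N + 2 + √discr) / 4` if `p < p_*`, and
`r^* = (p - 1) (N + 2) / 4` if `p_* ≤ p`. -/
def rStar (N : ℕ) (p : ℝ) : ℝ := p - (p - 1) / 2 * bigLambda N p

/-! ### The Emden-transformed equation for `η`

Here `f` is a nonlinearity considered on `(s₀, ∞)`. -/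

/-- `φ(ρ) = F⁻¹ (e^{-2ρ} / (2N - 4 q_f))`, where `F⁻¹` is the inverse of `F` on `(s₀, ∞)`. -/
def phi (f : ℝ → ℝ) (s₀ : ℝ) (N : ℕ) (ρ : ℝ) : ℝ :=
  Function.invFunOn (bigF f) (Ioi s₀) (Real.exp (-2 * ρ) / bCoef N (qExp f))

/-- `I(ρ) = 4 f(φ) F(φ) / φ * (f'(φ) F(φ) - q_f)`. -/
def inhom (f : ℝ → ℝ) (s₀ : ℝ) (N : ℕ) (ρ : ℝ) : ℝ :=
  4 * f (phi f s₀ N ρ) * bigF f (phi f s₀ N ρ) / phi f s₀ N ρ *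
    (deriv f (phi f s₀ N ρ) * bigF f (phi f s₀ N ρ) - qExp f)

def coefL1 (f : ℝ → ℝ) (s₀ : ℝ) (N : ℕ) (ρ : ℝ) : ℝ :=
  bCoef N (qExp f) *
      ((deriv f (phi f s₀ N ρ) * bigF f (phi f s₀ N ρ) - qExp f) -
        (f (phi f s₀ N ρ) * bigF f (phi f s₀ N ρ) / phi f s₀ N ρ - 1 / (pExp f - 1))) +
    inhom f s₀ N ρ

def coefL2 (f : ℝ → ℝ) (s₀ : ℝ) (N : ℕ) (ρ : ℝ) : ℝ :=
  4 * (f (phi f s₀ N ρ) * bigF f (phi f s₀ N ρ) / phi f s₀ N ρ - 1 / (pExp f - 1))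

/-- `N[η](ρ) = (2N - 4 q_f) F(φ) / φ * (f(φ (1 + η)) - f(φ) - f'(φ) φ η)`. -/
def nonlin (f : ℝ → ℝ) (s₀ : ℝ) (N : ℕ) (η : ℝ → ℝ) (ρ : ℝ) : ℝ :=
  bCoef N (qExp f) * (bigF f (phi f s₀ N ρ) / phi f s₀ N ρ) *
    (f (phi f s₀ N ρ * (1 + η ρ)) - f (phi f s₀ N ρ) -
      deriv f (phi f s₀ N ρ) * phi f s₀ N ρ * η ρ)

/-- `I + L₁ η + L₂ η' + N[η]`. -/
def forcing (f : ℝ → ℝ) (s₀ : ℝ) (N : ℕ) (η : ℝ → ℝ) (ρ : ℝ) : ℝ :=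
  inhom f s₀ N ρ + coefL1 f s₀ N ρ * η ρ + coefL2 f s₀ N ρ * deriv η ρ + nonlin f s₀ N η ρ

open Classical in
/-- The first fundamental solution of `η'' + a η' + b η = 0`. -/
def fundOne (N : ℕ) (p : ℝ) (ρ : ℝ) : ℝ :=
  if p < pStar N then Real.exp (-lambdaOne N p * ρ)
  else if p = pStar N then Real.exp (-lambdaStar N * ρ)
  else Real.exp (-(aCoef N p / 2) * ρ) * Real.cos (freq N p * ρ)

open Classical in
/-- The second fundamental solution of `η'' + a η' + b η = 0`. -/
def fundTwo (N : ℕ) (p : ℝ) (ρ : ℝ) : ℝ :=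
  if p < pStar N then Real.exp (-lambdaTwo N p * ρ)
  else if p = pStar N then ρ * Real.exp (-lambdaStar N * ρ)
  else Real.exp (-(aCoef N p / 2) * ρ) * Real.sin (freq N p * ρ)

def wronskian (N : ℕ) (p : ℝ) (τ : ℝ) : ℝ :=
  fundOne N p τ * deriv (fundTwo N p) τ - deriv (fundOne N p) τ * fundTwo N p τ

/-- The variation-of-parameters kernel `K(ρ, τ)`. -/
def kernelK (N : ℕ) (p : ℝ) (ρ τ : ℝ) : ℝ :=
  (fundOne N p τ * fundTwo N p ρ - fundOne N p ρ * fundTwo N p τ) / wronskian N p τ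

/-- `η` is a solution on `[ρ₀, ∞)`, with `η(ρ₀) = A` and `η'(ρ₀) = B`: it is of class
`C²((ρ₀, ∞)) ∩ C¹([ρ₀, ∞))`, the argument of `f` stays in its domain `(s₀, ∞)`, and `η` satisfies
the differential equation `η'' + a η' + b η + I + L₁ η + L₂ η' + N[η] = 0` and its integral form. -/
structure IsEtaSolution (f : ℝ → ℝ) (s₀ : ℝ) (N : ℕ) (ρ₀ A B : ℝ) (η : ℝ → ℝ) : Prop where
  contDiff_two : ContDiffOn ℝ 2 η (Ioi ρ₀)
  contDiff_one : ContDiffOn ℝ 1 η (Ici ρ₀)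
  init : η ρ₀ = A
  init_deriv : derivWithin η (Ici ρ₀) ρ₀ = B
  mem_domain : ∀ ρ ≥ ρ₀, s₀ < phi f s₀ N ρ * (1 + η ρ)
  ode : ∀ ρ > ρ₀,
    deriv (deriv η) ρ + aCoef N (pExp f) * deriv η ρ + bCoef N (qExp f) * η ρ +
      forcing f s₀ N η ρ = 0
  integral_eq : ∃ C₁ C₂ : ℝ, ∀ ρ ≥ ρ₀,
    η ρ = C₁ * fundOne N (pExp f) ρ + C₂ * fundTwo N (pExp f) ρ -
      ∫ τ in ρ₀..ρ, kernelK N (pExp f) ρ τ * forcing f s₀ N η τ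

/-! ### The example -/

/-- `f(s) = s^p + s^r (log s)^β`, considered for `s > 2`. -/
def fEx (p r β : ℝ) (s : ℝ) : ℝ := s ^ p + s ^ r * (Real.log s) ^ β

open Classical in
/-- The table of decay rates: rows `r < r^*`, `r = r^*`, `r > r^*`; columns
`p < p_*`, `p = p_*`, `p > p_*`. -/
def decayTable (N : ℕ) (p r β : ℝ) (ρ : ℝ) : ℝ :=
  if r < rStar N p then
    if p < pStar N then Real.exp (-lambdaOne N p * ρ)
    else if p = pStar N then ρ * Real.exp (-lambdaStar N * ρ)
    else Real.exp (-(aCoef N p / 2) * ρ)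
  else if r = rStar N p then
    if p < pStar N then
      if -1 < β then ρ ^ (β + 1) * Real.exp (-lambdaOne N p * ρ)
      else if β = -1 then Real.log ρ * Real.exp (-lambdaOne N p * ρ)
      else Real.exp (-lambdaOne N p * ρ)
    else if p = pStar N then
      if -1 < β then ρ ^ (β + 2) * Real.exp (-lambdaStar N * ρ)
      else if β = -1 then ρ * Real.log ρ * Real.exp (-lambdaStar N * ρ)
      else ρ * Real.exp (-lambdaStar N * ρ)
    else
      if -1 ≤ β then ρ ^ (β + 1) * Real.exp (-(aCoef N p / 2) * ρ)
      else Real.exp (-(aCoef N p / 2) * ρ)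
  else ρ ^ β * Real.exp (-(2 * (p - r) / (p - 1)) * ρ)

end SingularElliptic

end

open SingularElliptic

namespace SingularElliptic

/-! ### The nonlinearity and its derivatives -/

/-! All expansions rest on one small quantity, X = (log s)^β / s^(p-r) (`logDiv`). Since f = s^p (1
+ X), the quantities f', f'' and 1/f are the corresponding powers of s times expressions in X and in
similar terms with smaller powers of log s. To expand F, its conjectured expansion is subtracted,
the difference is differentiated, and `abs_le_of_abs_deriv_le` compares it with an explicit majorant
vanishing at infinity. Products such as f'F then expand by `isBigO_mul_expansion`, because X² is
negligible against X / log s.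

The equation F(φ) = e^{-2ρ}/b gives ρ as an explicit function of s = φ (`emdenTime`). One finds ρ =
((p-1)/2) log s (1 + O(1/log s)), while e^{-γρ} with γ = 2(p-r)/(p-1) is s^{-(p-r)} times a factor
converging at rate 1/log s. So X becomes a positive constant times ρ^β e^{-γρ}, with relative error
1/ρ (`logDiv_sub_expWeight_isBigO`). The product formula for I then yields a leading coefficient
proportional to r-(p-1), hence its size and sign (`inhom_sub_isBigO`).

For existence, the equation is written as a Volterra equation for the pair (η, η') by variation of
parameters, and solved by contraction in a space weighted by w (`exists_volterra_solution`). The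
coefficients L₁, L₂ decay exponentially, and on the set |η| ≤ R w the remainder N is Lipschitz with
constant O(w) (`taylorRem_lipschitz`). Starting late enough therefore makes the map a contraction.
The nonlinearity is truncated at R w beforehand, and the resulting bound shows that the truncation
never acts (`exists_etaSolution`).

The table is thus reduced to exhibiting a weight w of the tabulated size satisfying
`IsAdmissibleWeight`. With the kernel bound (1 + ρ-τ)^j e^{-Λ(ρ-τ)}, this is a comparison of γ with
Λ. For γ < Λ the source dictates the decay (`isAdmissibleWeight_of_lt`), for γ > Λ the linear
equation does, and for γ = Λ the integral of τ^β produces the extra factor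
(`isAdmissibleWeight_of_monotone`). The exceptional cell is β = -1 with complex roots, where the
integral of a sine or cosine against 1/τ stays bounded and no logarithm appears (`source_complex`).
It requires the two-term expansion of I. -/

/-- The first derivative of `fEx p r β` on `(1, ∞)`. -/
noncomputable def dfEx (p r β : ℝ) (s : ℝ) : ℝ :=
  p * s ^ (p - 1) + r * s ^ (r - 1) * (Real.log s) ^ β +
    β * s ^ (r - 1) * (Real.log s) ^ (β - 1)

/-- The second derivative of `fEx p r β` on `(1, ∞)`. -/
noncomputable def ddfEx (p r β : ℝ) (s : ℝ) : ℝ :=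
  p * (p - 1) * s ^ (p - 2) + r * (r - 1) * (s ^ (r - 2) * (Real.log s) ^ β) +
    (2 * r - 1) * β * (s ^ (r - 2) * (Real.log s) ^ (β - 1)) +
    β * (β - 1) * (s ^ (r - 2) * (Real.log s) ^ (β - 2))

lemma hasDerivAt_rpow_mul_log_rpow (c d : ℝ) {s : ℝ} (hs : 1 < s) :
    HasDerivAt (fun s => s ^ c * (Real.log s) ^ d)
      (c * (s ^ (c - 1) * (Real.log s) ^ d) + d * (s ^ (c - 1) * (Real.log s) ^ (d - 1))) s := by
  have h0 : 0 < s := by linarith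
  have hl : 0 < Real.log s := Real.log_pos hs
  have h1 : HasDerivAt (fun s : ℝ => s ^ c) (c * s ^ (c - 1)) s :=
    Real.hasDerivAt_rpow_const (Or.inl h0.ne')
  have h2 : HasDerivAt (fun s : ℝ => (Real.log s) ^ d)
      (s⁻¹ * d * (Real.log s) ^ (d - 1)) s :=
    (Real.hasDerivAt_log h0.ne').rpow_const (Or.inl hl.ne')
  refine (h1.mul h2).congr_deriv ?_
  rw [Real.rpow_sub_one h0.ne' c]
  ring

lemma fEx_pos {p r β s : ℝ} (hs : 1 < s) : 0 < fEx p r β s := by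
  have h0 : 0 < s := by linarith
  have hl : 0 < Real.log s := Real.log_pos hs
  unfold fEx
  positivity

lemma rpow_le_fEx {p r β s : ℝ} (hs : 1 < s) : s ^ p ≤ fEx p r β s := by
  have h0 : 0 < s := by linarith
  have hl : 0 < Real.log s := Real.log_pos hs
  unfold fEx
  have : 0 < s ^ r * Real.log s ^ β := by positivity
  linarith

lemma hasDerivAt_fEx (p r β : ℝ) {s : ℝ} (hs : 1 < s) :
    HasDerivAt (fEx p r β) (dfEx p r β s) s := by
  have h1 : HasDerivAt (fun s : ℝ => s ^ p) (p * s ^ (p - 1)) s :=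
    Real.hasDerivAt_rpow_const (Or.inl (by linarith))
  refine (h1.add (hasDerivAt_rpow_mul_log_rpow r β hs)).congr_deriv ?_
  unfold dfEx
  ring

lemma deriv_fEx (p r β : ℝ) {s : ℝ} (hs : 1 < s) : deriv (fEx p r β) s = dfEx p r β s :=
  (hasDerivAt_fEx p r β hs).deriv

lemma hasDerivAt_dfEx (p r β : ℝ) {s : ℝ} (hs : 1 < s) :
    HasDerivAt (dfEx p r β) (ddfEx p r β s) s := by
  have h1 : HasDerivAt (fun s : ℝ => s ^ (p - 1)) ((p - 1) * s ^ (p - 1 - 1)) s :=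
    Real.hasDerivAt_rpow_const (Or.inl (by linarith))
  have h := ((h1.const_mul p).add
    ((hasDerivAt_rpow_mul_log_rpow (r - 1) β hs).const_mul r)).add
      ((hasDerivAt_rpow_mul_log_rpow (r - 1) (β - 1) hs).const_mul β)
  have e1 : p - 1 - 1 = p - 2 := by ring
  have e2 : r - 1 - 1 = r - 2 := by ring
  have e3 : β - 1 - 1 = β - 2 := by ring
  rw [e1, e2, e3] at h
  have e : dfEx p r β = ((fun y : ℝ => p * y ^ (p - 1)) +
      fun y => r * (y ^ (r - 1) * Real.log y ^ β)) +
      fun y => β * (y ^ (r - 1) * Real.log y ^ (β - 1)) := by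
    funext y
    simp only [dfEx, Pi.add_apply]
    ring
  rw [e]
  refine h.congr_deriv ?_
  unfold ddfEx
  ring

lemma deriv_deriv_fEx (p r β : ℝ) {s : ℝ} (hs : 1 < s) :
    deriv (deriv (fEx p r β)) s = ddfEx p r β s := by
  have : deriv (fEx p r β) =ᶠ[𝓝 s] dfEx p r β := by
    filter_upwards [lt_mem_nhds hs] with u hu using deriv_fEx p r β hu
  rw [this.deriv_eq, (hasDerivAt_dfEx p r β hs).deriv]

lemma continuousOn_fEx (p r β : ℝ) : ContinuousOn (fEx p r β) (Ioi 1) :=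
  fun _ hs => (hasDerivAt_fEx p r β hs).continuousAt.continuousWithinAt

lemma continuousOn_dfEx (p r β : ℝ) : ContinuousOn (dfEx p r β) (Ioi 1) :=
  fun _ hs => (hasDerivAt_dfEx p r β hs).continuousAt.continuousWithinAt

/-! ### The function `F` -/

lemma continuousOn_inv_fEx (p r β : ℝ) : ContinuousOn (fun u => 1 / fEx p r β u) (Ioi 1) :=
  continuousOn_const.div (continuousOn_fEx p r β) fun _ hs => (fEx_pos hs).ne'

lemma inv_fEx_le {p r β s : ℝ} (hs : 1 < s) : 1 / fEx p r β s ≤ s ^ (-p) := by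
  have h0 : 0 < s := by linarith
  rw [Real.rpow_neg h0.le, ← one_div]
  exact one_div_le_one_div_of_le (Real.rpow_pos_of_pos h0 p) (rpow_le_fEx hs)

lemma integrableOn_inv_fEx {p r β s : ℝ} (hp : 1 < p) (hs : 1 < s) :
    IntegrableOn (fun u => 1 / fEx p r β u) (Ioi s) := by
  have h := integrableOn_Ioi_rpow_of_lt (show -p < -1 by linarith) (show 0 < s by linarith)
  refine h.mono' ?_ ?_
  · exact ((continuousOn_inv_fEx p r β).mono (Ioi_subset_Ioi hs.le)).aestronglyMeasurable
      measurableSet_Ioi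
  · filter_upwards [ae_restrict_mem measurableSet_Ioi] with u hu
    have hu1 : 1 < u := lt_trans hs hu
    rw [Real.norm_of_nonneg (one_div_pos.2 (fEx_pos hu1)).le]
    exact inv_fEx_le hu1

lemma bigF_fEx_nonneg {p r β s : ℝ} (hs : 1 < s) : 0 ≤ bigF (fEx p r β) s :=
  setIntegral_nonneg measurableSet_Ioi fun _ hu =>
    (one_div_pos.2 (fEx_pos (lt_trans hs hu))).le

lemma bigF_fEx_le {p r β s : ℝ} (hp : 1 < p) (hs : 1 < s) :
    bigF (fEx p r β) s ≤ -s ^ (-p + 1) / (-p + 1) := by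
  have h0 : 0 < s := by linarith
  rw [← integral_Ioi_rpow_of_lt (show -p < -1 by linarith) h0]
  exact setIntegral_mono_on (integrableOn_inv_fEx hp hs)
    (integrableOn_Ioi_rpow_of_lt (by linarith) h0) measurableSet_Ioi
    fun u hu => inv_fEx_le (lt_trans hs hu)

lemma tendsto_bigF_fEx (r β : ℝ) {p : ℝ} (hp : 1 < p) :
    Tendsto (bigF (fEx p r β)) atTop (𝓝 0) := by
  have h1 : Tendsto (fun s : ℝ => -s ^ (-p + 1) / (-p + 1)) atTop (𝓝 0) := by
    have := (tendsto_rpow_neg_atTop (show 0 < p - 1 by linarith)).neg.div_const (-p + 1)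
    simpa only [neg_zero, zero_div, show -(p - 1) = -p + 1 by ring] using this
  refine tendsto_of_tendsto_of_tendsto_of_le_of_le' tendsto_const_nhds h1 ?_ ?_
  · filter_upwards [eventually_gt_atTop 1] with s hs using bigF_fEx_nonneg hs
  · filter_upwards [eventually_gt_atTop 1] with s hs using bigF_fEx_le hp hs

lemma hasDerivAt_bigF_fEx (r β : ℝ) {p s : ℝ} (hp : 1 < p) (hs : 1 < s) :
    HasDerivAt (bigF (fEx p r β)) (-(1 / fEx p r β s)) s := by
  -- With a base point t in (1, s), F(u) = F(t) - ∫_t^u 1/f near s, so the fundamental theorem of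
  -- calculus applies.
  obtain ⟨t, ht, hts⟩ := exists_between hs
  have hc := continuousOn_inv_fEx p r β
  have hE : (fun u => bigF (fEx p r β) t - ∫ v in t..u, 1 / fEx p r β v) =ᶠ[𝓝 s]
      bigF (fEx p r β) := by
    filter_upwards [lt_mem_nhds hts] with u hu
    have h := intervalIntegral.integral_interval_add_Ioi (a := t) (b := u)
      (integrableOn_inv_fEx (r := r) (β := β) hp ht)
      (integrableOn_inv_fEx (r := r) (β := β) hp (lt_trans ht hu))
    simp only [bigF]
    linarith
  refine HasDerivAt.congr_of_eventuallyEq ?_ hE.symm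
  refine HasDerivAt.const_sub _ ?_
  refine intervalIntegral.integral_hasDerivAt_right ?_ ?_ ?_
  · apply ContinuousOn.intervalIntegrable
    refine hc.mono fun v hv => ?_
    rw [uIcc_of_le hts.le] at hv
    exact lt_of_lt_of_le ht hv.1
  · exact hc.stronglyMeasurableAtFilter isOpen_Ioi s hs
  · exact hc.continuousAt (Ioi_mem_nhds hs)

lemma strictAntiOn_bigF_fEx (r β : ℝ) {p : ℝ} (hp : 1 < p) :
    StrictAntiOn (bigF (fEx p r β)) (Ioi 1) := by
  refine strictAntiOn_of_deriv_neg (convex_Ioi 1)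
    (fun s hs => (hasDerivAt_bigF_fEx r β hp hs).continuousAt.continuousWithinAt) fun s hs => ?_
  rw [interior_Ioi] at hs
  rw [(hasDerivAt_bigF_fEx r β hp hs).deriv]
  exact neg_neg_of_pos (one_div_pos.2 (fEx_pos hs))

lemma bigF_fEx_pos {p r β s : ℝ} (hp : 1 < p) (hs : 1 < s) : 0 < bigF (fEx p r β) s :=
  lt_of_le_of_lt (bigF_fEx_nonneg (s := s + 1) (by linarith))
    (strictAntiOn_bigF_fEx r β hp hs (show (1 : ℝ) < s + 1 by linarith) (by linarith))

/-- A function vanishing at infinity is dominated by any function vanishing at infinity that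
decreases faster. -/
lemma abs_le_of_abs_deriv_le {E H E' H' : ℝ → ℝ} {s₀ : ℝ}
    (hE : ∀ s > s₀, HasDerivAt E (E' s) s) (hH : ∀ s > s₀, HasDerivAt H (H' s) s)
    (hle : ∀ s > s₀, |E' s| ≤ -H' s) (hE0 : Tendsto E atTop (𝓝 0))
    (hH0 : Tendsto H atTop (𝓝 0)) : ∀ s > s₀, |E s| ≤ H s := by
  have key : ∀ (G G' : ℝ → ℝ), (∀ s > s₀, HasDerivAt G (G' s) s) → (∀ s > s₀, G' s ≤ 0) →
      Tendsto G atTop (𝓝 0) → ∀ s > s₀, 0 ≤ G s := by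
    intro G G' hG hG' hG0 s hs
    have hanti : AntitoneOn G (Ioi s₀) := by
      refine antitoneOn_of_deriv_nonpos (convex_Ioi s₀)
        (fun s hs => (hG s hs).continuousAt.continuousWithinAt) ?_ ?_
      · intro s hs
        rw [interior_Ioi] at hs
        exact (hG s hs).differentiableAt.differentiableWithinAt
      · intro s hs
        rw [interior_Ioi] at hs
        rw [(hG s hs).deriv]
        exact hG' s hs
    refine le_of_tendsto hG0 ?_
    filter_upwards [eventually_ge_atTop s] with u hu
    exact hanti hs (lt_of_lt_of_le hs hu) hu
  intro s hs
  rw [abs_le]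
  constructor
  · have := key (fun s => H s + E s) _ (fun s hs => (hH s hs).add (hE s hs))
      (fun s hs => by linarith [le_abs_self (E' s), hle s hs]) (by simpa using hH0.add hE0) s hs
    linarith
  · have := key (fun s => H s - E s) _ (fun s hs => (hH s hs).sub (hE s hs))
      (fun s hs => by linarith [neg_abs_le (E' s), hle s hs]) (by simpa using hH0.sub hE0) s hs
    linarith

/-! ### Expansions at infinity -/

/-- The relative size `(log s)^d / s^c` of the lower order terms. -/
noncomputable def logDiv (d c : ℝ) (s : ℝ) : ℝ := (Real.log s) ^ d / s ^ c

lemma logDiv_pos {d c s : ℝ} (hs : 1 < s) : 0 < logDiv d c s := by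
  have h0 : 0 < s := by linarith
  have hl : 0 < Real.log s := Real.log_pos hs
  unfold logDiv
  positivity

lemma tendsto_logDiv (d : ℝ) {c : ℝ} (hc : 0 < c) : Tendsto (logDiv d c) atTop (𝓝 0) :=
  (isLittleO_log_rpow_rpow_atTop d hc).tendsto_div_nhds_zero

lemma isBigO_one_logDiv (d : ℝ) {c : ℝ} (hc : 0 < c) :
    logDiv d c =O[atTop] fun _ => (1 : ℝ) :=
  (tendsto_logDiv d hc).isBigO_one ℝ

lemma logDiv_sub_one {d c s : ℝ} (hs : 1 < s) :
    logDiv (d - 1) c s = logDiv d c s / Real.log s := by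
  have hl : 0 < Real.log s := Real.log_pos hs
  unfold logDiv
  rw [Real.rpow_sub_one hl.ne']
  ring

lemma logDiv_mul {d d' c c' s : ℝ} (hs : 1 < s) :
    logDiv d c s * logDiv d' c' s = logDiv (d + d') (c + c') s := by
  have h0 : 0 < s := by linarith
  have hl : 0 < Real.log s := Real.log_pos hs
  unfold logDiv
  rw [Real.rpow_add hl, Real.rpow_add h0]
  field_simp

/-- A strictly larger power of s beats any power of the logarithm: the quotient is again a `logDiv`
with positive exponent, which tends to zero. -/
lemma isBigO_logDiv_of_lt (d d' : ℝ) {c c' : ℝ} (hc : c' < c) :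
    logDiv d c =O[atTop] logDiv d' c' := by
  have h : logDiv d c =ᶠ[atTop] fun s => logDiv d' c' s * logDiv (d - d') (c - c') s := by
    filter_upwards [eventually_gt_atTop 1] with s hs
    rw [logDiv_mul hs]
    congr 1 <;> ring
  refine h.trans_isBigO ?_
  simpa using (isBigO_refl (logDiv d' c') atTop).mul
    (isBigO_one_logDiv (d - d') (sub_pos.2 hc))

lemma isBigO_logDiv_sub_one (d c : ℝ) : logDiv (d - 1) c =O[atTop] logDiv d c := by
  refine IsBigO.of_bound 1 ?_
  filter_upwards [eventually_gt_atTop 1, Real.tendsto_log_atTop.eventually_ge_atTop 1] with s hs hl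
  rw [Real.norm_of_nonneg (logDiv_pos hs).le, Real.norm_of_nonneg (logDiv_pos hs).le,
    logDiv_sub_one hs, one_mul]
  exact div_le_self (logDiv_pos hs).le hl

/-- Squaring doubles the power of s, which more than pays for the one logarithm asked for. This is
why second order terms disappear into every remainder. -/
lemma logDiv_sq_isBigO (d : ℝ) {c : ℝ} (hc : 0 < c) :
    (fun s => logDiv d c s * logDiv d c s) =O[atTop] logDiv (d - 1) c := by
  have h : (fun s => logDiv d c s * logDiv d c s) =ᶠ[atTop] logDiv (d + d) (c + c) := by
    filter_upwards [eventually_gt_atTop 1] with s hs using logDiv_mul hs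
  exact h.trans_isBigO (isBigO_logDiv_of_lt _ _ (by linarith))

lemma logDiv_eq_mul {d c c' s : ℝ} (hs : 0 < s) :
    logDiv d (c + c') s = logDiv d c s * s ^ (-c') := by
  unfold logDiv
  rw [Real.rpow_add hs, Real.rpow_neg hs.le]
  field_simp

lemma fEx_eq {p r β s : ℝ} (hs : 0 < s) :
    fEx p r β s = s ^ p * (1 + logDiv β (p - r) s) := by
  unfold fEx logDiv
  rw [Real.rpow_sub hs]
  have := Real.rpow_pos_of_pos hs p
  have := Real.rpow_pos_of_pos hs r
  field_simp

lemma dfEx_eq {p r β s : ℝ} (hs : 0 < s) :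
    dfEx p r β s = s ^ (p - 1) * (p + r * logDiv β (p - r) s +
      β * logDiv (β - 1) (p - r) s) := by
  unfold dfEx logDiv
  rw [show r - 1 = (p - 1) - (p - r) by ring, Real.rpow_sub hs (p - 1)]
  have := Real.rpow_pos_of_pos hs (p - 1)
  have := Real.rpow_pos_of_pos hs (p - r)
  field_simp

lemma ddfEx_eq {p r β s : ℝ} (hs : 0 < s) :
    ddfEx p r β s = s ^ (p - 2) * (p * (p - 1) + r * (r - 1) * logDiv β (p - r) s +
      (2 * r - 1) * β * logDiv (β - 1) (p - r) s +
      β * (β - 1) * logDiv (β - 2) (p - r) s) := by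
  unfold ddfEx logDiv
  rw [show r - 2 = (p - 2) - (p - r) by ring, Real.rpow_sub hs (p - 2)]
  have := Real.rpow_pos_of_pos hs (p - 2)
  have := Real.rpow_pos_of_pos hs (p - r)
  field_simp

/-- The powers of s cancel exactly, since 2(p-1) = p + (p-2); what remains tends to p² / (p(p-1)).
-/
lemma tendsto_growthQuotient_fEx (β : ℝ) {p r : ℝ} (hp : 1 < p) (hrp : r < p) :
    Tendsto (growthQuotient (fEx p r β)) atTop (𝓝 (p / (p - 1))) := by
  have hc : 0 < p - r := sub_pos.2 hrp
  have h0 := tendsto_logDiv β hc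
  have h1 := tendsto_logDiv (β - 1) hc
  have h2 := tendsto_logDiv (β - 2) hc
  have hn := ((tendsto_const_nhds (x := p)).add (h0.const_mul r)).add (h1.const_mul β)
  have hd := (((tendsto_const_nhds (x := p * (p - 1))).add (h0.const_mul (r * (r - 1)))).add
    (h1.const_mul ((2 * r - 1) * β))).add (h2.const_mul (β * (β - 1)))
  have hf := (tendsto_const_nhds (x := (1 : ℝ))).add h0
  have hlim := (hn.pow 2).div (hf.mul hd) (by
    have : p * (p - 1) ≠ 0 := mul_ne_zero (by linarith) (by linarith)
    simpa using this)
  have e : (p + r * 0 + β * 0) ^ 2 / ((1 + 0) *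
      (p * (p - 1) + r * (r - 1) * 0 + (2 * r - 1) * β * 0 + β * (β - 1) * 0)) =
      p / (p - 1) := by
    have : p ≠ 0 := by linarith
    have : p - 1 ≠ 0 := by linarith
    simp only [mul_zero, add_zero, one_mul]
    field_simp
  rw [e] at hlim
  refine hlim.congr' ?_
  filter_upwards [eventually_gt_atTop 1] with s hs
  have hs0 : 0 < s := by linarith
  simp only [growthQuotient, Pi.div_apply]
  rw [deriv_fEx p r β hs, deriv_deriv_fEx p r β hs, fEx_eq hs0, dfEx_eq hs0, ddfEx_eq hs0,
    mul_pow, ← Real.rpow_natCast (s ^ (p - 1)), ← Real.rpow_mul hs0.le, mul_mul_mul_comm (s ^ p),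
    ← Real.rpow_add hs0, show p + (p - 2) = (p - 1) * ((2 : ℕ) : ℝ) by push_cast; ring,
    mul_div_mul_left _ _ (Real.rpow_pos_of_pos hs0 _).ne']

lemma qExp_fEx (β : ℝ) {p r : ℝ} (hp : 1 < p) (hrp : r < p) :
    qExp (fEx p r β) = p / (p - 1) :=
  (tendsto_growthQuotient_fEx β hp hrp).limUnder_eq

lemma pExp_fEx (β : ℝ) {p r : ℝ} (hp : 1 < p) (hrp : r < p) : pExp (fEx p r β) = p := by
  have : p - 1 ≠ 0 := by linarith
  rw [pExp, qExp_fEx β hp hrp, Real.conjExponent]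
  field_simp
  ring

lemma hasDerivAt_logDiv (d c : ℝ) {s : ℝ} (hs : 1 < s) :
    HasDerivAt (logDiv d c) (-(c * logDiv d (c + 1) s) + d * logDiv (d - 1) (c + 1) s) s := by
  have h0 : 0 < s := by linarith
  have h := hasDerivAt_rpow_mul_log_rpow (-c) d hs
  have e : logDiv d c =ᶠ[𝓝 s] fun s => s ^ (-c) * (Real.log s) ^ d := by
    filter_upwards [lt_mem_nhds h0] with u hu
    rw [Real.rpow_neg hu.le, logDiv]
    field_simp
  refine (h.congr_of_eventuallyEq e).congr_deriv ?_
  unfold logDiv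
  rw [show -c - 1 = -(c + 1) by ring, Real.rpow_neg h0.le]
  field_simp

lemma bigF_fEx_expansion (β : ℝ) {p r : ℝ} (hp : 1 < p) (hrp : r < p) :
    (fun s => bigF (fEx p r β) s - (1 / (p - 1) * (1 / s ^ (p - 1)) -
      1 / (2 * p - r - 1) * logDiv β (2 * p - r - 1) s))
      =O[atTop] logDiv (β - 1) (2 * p - r - 1) := by
  have hc0 : 0 < p - r := sub_pos.2 hrp
  set c := 2 * p - r - 1 with hc
  have hcpos : 0 < c := by linarith
  -- This is the derivative of F minus its proposed expansion. The first three terms combine to -X²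
  -- s^(-p) / (1 + X).
  set g : ℝ → ℝ := fun s => -(1 / fEx p r β s) + s ^ (-p) - logDiv β (c + 1) s +
    β / c * logDiv (β - 1) (c + 1) s with hg
  have hgO : g =O[atTop] logDiv (β - 1) (c + 1) := by
    refine IsBigO.add ?_ (isBigO_const_mul_self _ _ _)
    have h1 : (fun s => -(1 / fEx p r β s) + s ^ (-p) - logDiv β (c + 1) s) =O[atTop]
        fun s => logDiv β (p - r) s * logDiv β (p - r) s * s ^ (-p) := by
      refine IsBigO.of_bound 1 ?_
      filter_upwards [eventually_gt_atTop 1] with s hs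
      have hs0 : 0 < s := by linarith
      have hX := logDiv_pos (d := β) (c := p - r) hs
      have hsp := Real.rpow_pos_of_pos hs0 p
      rw [show c + 1 = p - r + p by rw [hc]; ring, logDiv_eq_mul hs0, fEx_eq hs0,
        Real.rpow_neg hs0.le]
      set X := logDiv β (p - r) s
      have e : -(1 / (s ^ p * (1 + X))) + (s ^ p)⁻¹ - X * (s ^ p)⁻¹ =
          -(X * X * (s ^ p)⁻¹ / (1 + X)) := by
        field_simp
        ring
      rw [e, norm_neg, Real.norm_of_nonneg (by positivity), Real.norm_of_nonneg (by positivity),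
        one_mul]
      exact div_le_self (by positivity) (by linarith)
    refine h1.trans ?_
    refine ((logDiv_sq_isBigO β hc0).mul (isBigO_refl (fun s : ℝ => s ^ (-p)) atTop)).congr'
      EventuallyEq.rfl ?_
    filter_upwards [eventually_gt_atTop 0] with s hs
    rw [← logDiv_eq_mul hs]
    congr 1
    rw [hc]
    ring
  obtain ⟨C, hC0, hC⟩ := hgO.exists_pos
  -- Differentiating (log s)^(β-1) / s^c gives a main term with factor c and a correction with
  -- factor (β-1)/log s; here the correction is at most half of the main term.
  have hsmall : ∀ᶠ s in atTop, |β - 1| / Real.log s ≤ c / 2 := by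
    have := (Real.tendsto_log_atTop.const_div_atTop (r := |β - 1|))
    exact this.eventually (ge_mem_nhds (by positivity))
  obtain ⟨s₀, hs₀⟩ := eventually_atTop.1 ((hC.bound.and hsmall).and (eventually_gt_atTop 1))
  -- The majorant H = (2C/c) (log s)^(β-1)/s^c loses at most half of its slope to the logarithmic
  -- correction, so -H' still dominates C (log s)^(β-1)/s^(c+1).
  refine IsBigO.of_bound (2 * C / c) ?_
  have key := abs_le_of_abs_deriv_le (s₀ := s₀) (E' := g)
    (E := fun s => bigF (fEx p r β) s - (1 / (p - 1) * s ^ (-(p - 1)) - 1 / c * logDiv β c s))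
    (H := fun s => 2 * C / c * logDiv (β - 1) c s)
    (H' := fun s => 2 * C / c * (-(c * logDiv (β - 1) (c + 1) s) +
      (β - 1) * logDiv (β - 1 - 1) (c + 1) s)) ?_ ?_ ?_ ?_ ?_
  · filter_upwards [eventually_gt_atTop s₀] with s hs
    have hs1 := (hs₀ s hs.le).2
    have hs0 : 0 < s := by linarith
    have := key s hs
    rw [Real.rpow_neg hs0.le, ← one_div] at this
    rw [Real.norm_of_nonneg (logDiv_pos hs1).le, Real.norm_eq_abs]
    exact this
  · intro s hs
    have hs1 := (hs₀ s hs.le).2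
    have hs0 : 0 < s := by linarith
    have hr : HasDerivAt (fun s : ℝ => s ^ (-(p - 1))) (-(p - 1) * s ^ (-(p - 1) - 1)) s :=
      Real.hasDerivAt_rpow_const (Or.inl hs0.ne')
    have h := (hasDerivAt_bigF_fEx r β hp hs1).sub ((hr.const_mul (1 / (p - 1))).sub
      ((hasDerivAt_logDiv β c hs1).const_mul (1 / c)))
    refine h.congr_deriv ?_
    rw [hg, show -(p - 1) - 1 = -p by ring]
    have : p - 1 ≠ 0 := by linarith
    field_simp
    ring
  · intro s hs
    exact (hasDerivAt_logDiv (β - 1) c (hs₀ s hs.le).2).const_mul _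
  · intro s hs
    have hs1 := (hs₀ s hs.le).2
    have hb := (hs₀ s hs.le).1.1
    have hsm := (hs₀ s hs.le).1.2
    have hl : 0 < Real.log s := Real.log_pos hs1
    have hY := logDiv_pos (d := β - 1) (c := c + 1) hs1
    rw [Real.norm_of_nonneg hY.le, Real.norm_eq_abs] at hb
    refine hb.trans ?_
    rw [logDiv_sub_one (d := β - 1) hs1]
    set Y := logDiv (β - 1) (c + 1) s
    have h1 : (β - 1) / Real.log s ≤ c / 2 :=
      (div_le_div_of_nonneg_right (le_abs_self _) hl.le).trans hsm
    have e : -(2 * C / c * (-(c * Y) + (β - 1) * (Y / Real.log s))) =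
        C * Y * (2 / c * (c - (β - 1) / Real.log s)) := by
      field_simp
      ring
    rw [e]
    refine le_mul_of_one_le_right (by positivity) ?_
    calc (1 : ℝ) = 2 / c * (c / 2) := by field_simp
      _ ≤ _ := by gcongr; linarith
  · have := (tendsto_bigF_fEx r β hp).sub (((tendsto_rpow_neg_atTop
      (show 0 < p - 1 by linarith)).const_mul (1 / (p - 1))).sub
        ((tendsto_logDiv β hcpos).const_mul (1 / c)))
    simpa using this
  · simpa using (tendsto_logDiv (β - 1) hcpos).const_mul (2 * C / c)

/-- The normalized integral `s^(p-1) F(s)`. -/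
noncomputable def normF (p r β : ℝ) (s : ℝ) : ℝ := s ^ (p - 1) * bigF (fEx p r β) s

lemma normF_expansion (β : ℝ) {p r : ℝ} (hp : 1 < p) (hrp : r < p) :
    (fun s => normF p r β s - (1 / (p - 1) - 1 / (2 * p - r - 1) * logDiv β (p - r) s))
      =O[atTop] logDiv (β - 1) (p - r) := by
  have h := (isBigO_refl (fun s : ℝ => s ^ (p - 1)) atTop).mul (bigF_fEx_expansion β hp hrp)
  refine h.congr' ?_ ?_
  · filter_upwards [eventually_gt_atTop 0] with s hs
    rw [normF, show 2 * p - r - 1 = p - r + (p - 1) by ring, logDiv_eq_mul hs,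
      Real.rpow_neg hs.le]
    have := Real.rpow_pos_of_pos hs (p - 1)
    field_simp
  · filter_upwards [eventually_gt_atTop 0] with s hs
    rw [show 2 * p - r - 1 = p - r + (p - 1) by ring, logDiv_eq_mul hs, Real.rpow_neg hs.le]
    have := Real.rpow_pos_of_pos hs (p - 1)
    field_simp

lemma deriv_mul_bigF_eq {p r β s : ℝ} (hs : 1 < s) :
    deriv (fEx p r β) s * bigF (fEx p r β) s =
      (p + r * logDiv β (p - r) s + β * logDiv (β - 1) (p - r) s) * normF p r β s := by
  rw [deriv_fEx p r β hs, dfEx_eq (by linarith), normF]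
  ring

lemma mul_bigF_div_eq {p r β s : ℝ} (hs : 0 < s) :
    fEx p r β s * bigF (fEx p r β) s / s = (1 + logDiv β (p - r) s) * normF p r β s := by
  rw [fEx_eq hs, normF, Real.rpow_sub_one hs.ne']
  ring

/-- Product of two first order expansions in `X` with remainders `O(Y)`, where `X² = O(Y)`. -/
lemma isBigO_mul_expansion {α : Type*} {l : Filter α} {u v X Y : α → ℝ} {u₀ u₁ v₀ v₁ : ℝ}
    (hX : X =O[l] fun _ => (1 : ℝ)) (hXX : (fun s => X s * X s) =O[l] Y)
    (hY : Y =O[l] fun _ => (1 : ℝ))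
    (hu : (fun s => u s - (u₀ + u₁ * X s)) =O[l] Y)
    (hv : (fun s => v s - (v₀ + v₁ * X s)) =O[l] Y) :
    (fun s => u s * v s - (u₀ * v₀ + (u₀ * v₁ + u₁ * v₀) * X s)) =O[l] Y := by
  have h1 : (fun s => u₀ + u₁ * X s) =O[l] fun _ => (1 : ℝ) :=
    (isBigO_const_const _ one_ne_zero _).add (hX.const_mul_left _)
  have h2 : v =O[l] fun _ => (1 : ℝ) := by
    have := (hv.trans hY).add (((isBigO_const_const v₀ one_ne_zero _)).add (hX.const_mul_left v₁))
    refine this.congr_left fun s => ?_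
    ring
  have h3 := hu.mul h2
  have h4 := h1.mul hv
  simp only [mul_one, one_mul] at h3 h4
  refine ((h3.add h4).add (hXX.const_mul_left (u₁ * v₁))).congr_left fun s => ?_
  ring

lemma deriv_mul_bigF_expansion (β : ℝ) {p r : ℝ} (hp : 1 < p) (hrp : r < p) :
    (fun s => deriv (fEx p r β) s * bigF (fEx p r β) s - (p / (p - 1) -
      (p - r) * (p - r - 1) / ((p - 1) * (2 * p - r - 1)) * logDiv β (p - r) s))
      =O[atTop] logDiv (β - 1) (p - r) := by
  have hc : 0 < p - r := sub_pos.2 hrp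
  have hu : (fun s => (p + r * logDiv β (p - r) s + β * logDiv (β - 1) (p - r) s) -
      (p + r * logDiv β (p - r) s)) =O[atTop] logDiv (β - 1) (p - r) := by
    refine (isBigO_const_mul_self β (logDiv (β - 1) (p - r)) _).congr_left fun s => ?_
    ring
  have hv : (fun s => normF p r β s - (1 / (p - 1) + -(1 / (2 * p - r - 1)) *
      logDiv β (p - r) s)) =O[atTop] logDiv (β - 1) (p - r) :=
    (normF_expansion β hp hrp).congr_left fun s => by ring
  refine (isBigO_mul_expansion (isBigO_one_logDiv β hc) (logDiv_sq_isBigO β hc)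
    (isBigO_one_logDiv (β - 1) hc) hu hv).congr' ?_ EventuallyEq.rfl
  filter_upwards [eventually_gt_atTop 1] with s hs
  rw [deriv_mul_bigF_eq hs]
  have h1 : p - 1 ≠ 0 := by linarith
  have h2 : 2 * p - r - 1 ≠ 0 := by linarith
  congr 1
  generalize logDiv β (p - r) s = X
  -- Naming the denominator and eliminating r lets `field_simp` treat it as an atom.
  obtain ⟨c, hc'⟩ : ∃ c, c = 2 * p - r - 1 := ⟨_, rfl⟩
  have hr : r = 2 * p - 1 - c := by linarith
  rw [← hc'] at h2 ⊢
  field_simp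
  rw [hr]
  ring

lemma mul_bigF_div_expansion (β : ℝ) {p r : ℝ} (hp : 1 < p) (hrp : r < p) :
    (fun s => fEx p r β s * bigF (fEx p r β) s / s - (1 / (p - 1) +
      (p - r) / ((p - 1) * (2 * p - r - 1)) * logDiv β (p - r) s))
      =O[atTop] logDiv (β - 1) (p - r) := by
  have hc : 0 < p - r := sub_pos.2 hrp
  have hu : (fun s => (1 + logDiv β (p - r) s) - (1 + 1 * logDiv β (p - r) s))
      =O[atTop] logDiv (β - 1) (p - r) :=
    (isBigO_zero _ _).congr_left fun s => by ring
  have hv : (fun s => normF p r β s - (1 / (p - 1) + -(1 / (2 * p - r - 1)) *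
      logDiv β (p - r) s)) =O[atTop] logDiv (β - 1) (p - r) :=
    (normF_expansion β hp hrp).congr_left fun s => by ring
  refine (isBigO_mul_expansion (isBigO_one_logDiv β hc) (logDiv_sq_isBigO β hc)
    (isBigO_one_logDiv (β - 1) hc) hu hv).congr' ?_ EventuallyEq.rfl
  filter_upwards [eventually_gt_atTop 0] with s hs
  rw [mul_bigF_div_eq hs]
  have h1 : p - 1 ≠ 0 := by linarith
  have h2 : 2 * p - r - 1 ≠ 0 := by linarith
  congr 1
  generalize logDiv β (p - r) s = X
  obtain ⟨c, hc'⟩ : ∃ c, c = 2 * p - r - 1 := ⟨_, rfl⟩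
  have hr : r = 2 * p - 1 - c := by linarith
  rw [← hc'] at h2 ⊢
  field_simp
  rw [hr]
  ring

/-! ### The Emden variable -/

lemma tendsto_normF (β : ℝ) {p r : ℝ} (hp : 1 < p) (hrp : r < p) :
    Tendsto (normF p r β) atTop (𝓝 (1 / (p - 1))) := by
  have hc : 0 < p - r := sub_pos.2 hrp
  have h1 := (normF_expansion β hp hrp).trans_tendsto (tendsto_logDiv (β - 1) hc)
  have h2 := (tendsto_const_nhds (x := 1 / (p - 1))).sub
    ((tendsto_logDiv β hc).const_mul (1 / (2 * p - r - 1)))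
  simpa using h1.add h2

/-- The change of variable s ↦ ρ is only accurate to relative order 1/log s; every power correction
is absorbed at that scale. -/
lemma isBigO_logDiv_inv_log (β : ℝ) {c : ℝ} (hc : 0 < c) :
    logDiv β c =O[atTop] fun s => (Real.log s)⁻¹ := by
  refine (isBigO_logDiv_of_lt β (-1) hc).trans_eventuallyEq ?_
  filter_upwards [eventually_gt_atTop 1] with s hs
  rw [logDiv, Real.rpow_neg_one, Real.rpow_zero, div_one]

lemma normF_sub_isBigO (β : ℝ) {p r : ℝ} (hp : 1 < p) (hrp : r < p) :
    (fun s => normF p r β s - 1 / (p - 1)) =O[atTop] fun s => (Real.log s)⁻¹ := by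
  have hc : 0 < p - r := sub_pos.2 hrp
  have h1 := (normF_expansion β hp hrp).trans (isBigO_logDiv_inv_log (β - 1) hc)
  have h2 := (isBigO_logDiv_inv_log β hc).const_mul_left (1 / (2 * p - r - 1))
  refine (h1.sub h2).congr_left fun s => ?_
  ring

lemma rpow_sub_rpow_isBigO {α : Type*} {l : Filter α} {u v : α → ℝ} {u₀ : ℝ} (d : ℝ)
    (hu₀ : 0 < u₀) (hu : Tendsto u l (𝓝 u₀)) (huv : (fun x => u x - u₀) =O[l] v) :
    (fun x => u x ^ d - u₀ ^ d) =O[l] v := by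
  have h : HasDerivAt (fun x : ℝ => x ^ d) (d * u₀ ^ (d - 1)) u₀ :=
    Real.hasDerivAt_rpow_const (Or.inl hu₀.ne')
  exact (h.isBigO_sub.comp_tendsto hu).trans huv

/-- The value of `ρ` for which `φ(ρ) = s`. -/
noncomputable def emdenTime (p r β b s : ℝ) : ℝ := -Real.log (b * bigF (fEx p r β) s) / 2

lemma normF_pos {p r β s : ℝ} (hp : 1 < p) (hs : 1 < s) : 0 < normF p r β s :=
  mul_pos (Real.rpow_pos_of_pos (by linarith) _) (bigF_fEx_pos hp hs)

lemma bigF_eq_normF {p r β s : ℝ} (hs : 0 < s) :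
    bigF (fEx p r β) s = normF p r β s * s ^ (-(p - 1)) := by
  rw [normF, Real.rpow_neg hs.le]
  have := Real.rpow_pos_of_pos hs (p - 1)
  field_simp

/-- Writing F = normF · s^{-(p-1)} turns the logarithm into (p-1) log s plus the logarithm of a
convergent factor. Hence ρ is asymptotic to ((p-1)/2) log s. -/
lemma emdenTime_eq {p r β b s : ℝ} (hp : 1 < p) (hb : 0 < b) (hs : 1 < s) :
    emdenTime p r β b s =
      ((p - 1) / 2 - Real.log (b * normF p r β s) / 2 * (Real.log s)⁻¹) * Real.log s := by
  have h0 : 0 < s := by linarith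
  have hl := Real.log_pos hs
  have hn := normF_pos (r := r) (β := β) hp hs
  rw [emdenTime, bigF_eq_normF h0, ← mul_assoc, Real.log_mul (by positivity)
    (Real.rpow_pos_of_pos h0 _).ne', Real.log_rpow h0]
  field_simp
  ring

/-- The exponential is exactly the power (p-r)/(p-1) of bF, so no asymptotic estimate of ρ has to be
exponentiated, which would lose constants. -/
lemma exp_emdenTime {p r β b s : ℝ} (hp : 1 < p) (hb : 0 < b) (hs : 1 < s) :
    Real.exp (-(2 * (p - r) / (p - 1)) * emdenTime p r β b s) =
      (b * normF p r β s) ^ ((p - r) / (p - 1)) / s ^ (p - r) := by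
  have h0 : 0 < s := by linarith
  have hn := normF_pos (r := r) (β := β) hp hs
  have hF := bigF_fEx_pos (r := r) (β := β) hp hs
  have hp1 : p - 1 ≠ 0 := by linarith
  have e : -(2 * (p - r) / (p - 1)) * emdenTime p r β b s =
      Real.log (b * bigF (fEx p r β) s) * ((p - r) / (p - 1)) := by
    rw [emdenTime]
    field_simp
  rw [e, ← Real.rpow_def_of_pos (by positivity), bigF_eq_normF h0, ← mul_assoc,
    Real.mul_rpow (by positivity) (by positivity), ← Real.rpow_mul h0.le,
    div_eq_mul_inv _ (s ^ (p - r)), ← Real.rpow_neg h0.le]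
  congr 2
  field_simp

lemma emdenTime_div_log_sub_isBigO (β : ℝ) {p r b : ℝ} (hp : 1 < p) (hrp : r < p) (hb : 0 < b) :
    (fun s => emdenTime p r β b s / Real.log s - (p - 1) / 2) =O[atTop]
      fun s => (Real.log s)⁻¹ := by
  have h1 : Tendsto (fun s => Real.log (b * normF p r β s)) atTop
      (𝓝 (Real.log (b * (1 / (p - 1))))) :=
    ((tendsto_normF β hp hrp).const_mul b).log
      (mul_pos hb (one_div_pos.2 (sub_pos.2 hp))).ne'
  have h2 := (h1.isBigO_one ℝ).mul (isBigO_refl (fun s => (Real.log s)⁻¹) atTop)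
  simp only [one_mul] at h2
  refine (h2.const_mul_left (-(1 / 2))).congr' ?_ EventuallyEq.rfl
  filter_upwards [eventually_gt_atTop 1] with s hs
  have hl := Real.log_pos hs
  rw [emdenTime_eq hp hb hs]
  field_simp
  ring

lemma tendsto_inv_log : Tendsto (fun s => (Real.log s)⁻¹) atTop (𝓝 0) :=
  tendsto_inv_atTop_zero.comp Real.tendsto_log_atTop

lemma tendsto_of_sub_isBigO_inv_log {u : ℝ → ℝ} {u₀ : ℝ}
    (h : (fun s => u s - u₀) =O[atTop] fun s => (Real.log s)⁻¹) : Tendsto u atTop (𝓝 u₀) := by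
  simpa using (h.trans_tendsto tendsto_inv_log).add_const u₀

/-- `ρ^d e^{-γρ}` with `γ = 2(p-r)/(p-1)`. -/
noncomputable def expWeight (p r d ρ : ℝ) : ℝ :=
  ρ ^ d * Real.exp (-(2 * (p - r) / (p - 1)) * ρ)

lemma logDiv_sub_expWeight_isBigO (β : ℝ) {p r b : ℝ} (hp : 1 < p) (hrp : r < p) (hb : 0 < b)
    (d : ℝ) :
    ∃ c > 0, (fun s => logDiv d (p - r) s - c * expWeight p r d (emdenTime p r β b s))
      =O[atTop] logDiv (d - 1) (p - r) := by
  have hp1 : 0 < p - 1 := sub_pos.2 hp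
  have hA := emdenTime_div_log_sub_isBigO β hp hrp hb
  have hA' := tendsto_of_sub_isBigO_inv_log hA
  have hB := normF_sub_isBigO β hp hrp
  have hB' := (tendsto_normF β hp hrp).const_mul b
  have hB2 : (fun s => b * normF p r β s - b * (1 / (p - 1))) =O[atTop]
      fun s => (Real.log s)⁻¹ :=
    (hB.const_mul_left b).congr_left fun s => by ring
  have hb1 : 0 < b * (1 / (p - 1)) := by positivity
  have hAd := rpow_sub_rpow_isBigO d (by positivity) hA' hA
  have hBd := rpow_sub_rpow_isBigO ((p - r) / (p - 1)) hb1 hB' hB2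
  set a₀ := ((p - 1) / 2) ^ d with ha₀
  set b₀ := (b * (1 / (p - 1))) ^ ((p - r) / (p - 1)) with hb₀
  have ha₀p : 0 < a₀ := by positivity
  have hb₀p : 0 < b₀ := by positivity
  have h1 := hAd.mul (hBd.trans (tendsto_inv_log.isBigO_one ℝ))
  simp only [mul_one] at h1
  -- With U → a₀ and V → b₀, the three summands add up to UV - a₀b₀, which is therefore O(1/log s).
  have h2 := (h1.add (hAd.const_mul_left b₀)).add (hBd.const_mul_left a₀)
  -- Since ρ^d e^{-γρ} = UV (log s)^d / s^(p-r), the constant relating the two sides is (a₀b₀)⁻¹,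
  -- and multiplying 1/log s by `logDiv d` gives `logDiv (d - 1)`.
  have h3 := (h2.const_mul_left (-(a₀ * b₀)⁻¹)).mul (isBigO_refl (logDiv d (p - r)) atTop)
  refine ⟨(a₀ * b₀)⁻¹, by positivity, h3.congr' ?_ ?_⟩
  · have hpos : ∀ᶠ s in atTop, 0 < emdenTime p r β b s / Real.log s :=
      hA'.eventually (lt_mem_nhds (by positivity))
    filter_upwards [eventually_gt_atTop 1, hpos] with s hs hu
    have h0 : 0 < s := by linarith
    have hl := Real.log_pos hs
    rw [expWeight, exp_emdenTime hp hb hs,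
      show emdenTime p r β b s ^ d = (emdenTime p r β b s / Real.log s) ^ d * Real.log s ^ d by
        rw [← Real.mul_rpow hu.le hl.le, div_mul_cancel₀ _ hl.ne'], logDiv]
    have := Real.rpow_pos_of_pos h0 (p - r)
    generalize (emdenTime p r β b s / Real.log s) ^ d = U
    generalize (b * normF p r β s) ^ ((p - r) / (p - 1)) = V
    field_simp
    ring
  · filter_upwards [eventually_gt_atTop 1] with s hs
    rw [logDiv_sub_one hs]
    ring

lemma logDiv_sub_one_isLittleO (d c : ℝ) : logDiv (d - 1) c =o[atTop] logDiv d c := by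
  have h := ((isLittleO_one_iff ℝ).2 tendsto_inv_log).mul_isBigO (isBigO_refl (logDiv d c) atTop)
  refine h.congr' ?_ ?_
  · filter_upwards [eventually_gt_atTop 1] with s hs
    rw [logDiv_sub_one hs]
    ring
  · simp

lemma logDiv_isTheta_expWeight (β : ℝ) {p r b : ℝ} (hp : 1 < p) (hrp : r < p) (hb : 0 < b)
    (d : ℝ) :
    logDiv d (p - r) =Θ[atTop] fun s => expWeight p r d (emdenTime p r β b s) := by
  obtain ⟨c, hc, h⟩ := logDiv_sub_expWeight_isBigO β hp hrp hb d
  have h1 := (h.trans_isLittleO (logDiv_sub_one_isLittleO d (p - r))).symm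
  have h2 : IsEquivalent atTop (fun s => c * expWeight p r d (emdenTime p r β b s))
      (logDiv d (p - r)) := h1
  exact ((isTheta_const_mul_left hc.ne').1 h2.isTheta).symm

/-- The second factor has no constant term, so the product starts at order X. Its coefficient
carries the factor p-r-1, whose sign is turned by the minus sign in the expansion of f'F; this is
the source of r-(p-1). -/
lemma inhom_expansion (β : ℝ) {p r b : ℝ} (hp : 1 < p) (hrp : r < p) (hb : 0 < b) :
    ∃ c > 0, (fun s => 4 * fEx p r β s * bigF (fEx p r β) s / s *
        (deriv (fEx p r β) s * bigF (fEx p r β) s - p / (p - 1)) -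
        c * (r - (p - 1)) * expWeight p r β (emdenTime p r β b s))
      =O[atTop] fun s => expWeight p r (β - 1) (emdenTime p r β b s) := by
  have hc : 0 < p - r := sub_pos.2 hrp
  have hp1 : 0 < p - 1 := sub_pos.2 hp
  have h2 : 0 < 2 * p - r - 1 := by linarith
  have hu := mul_bigF_div_expansion β hp hrp
  have hv : (fun s => (deriv (fEx p r β) s * bigF (fEx p r β) s - p / (p - 1)) - (0 +
      -((p - r) * (p - r - 1) / ((p - 1) * (2 * p - r - 1))) * logDiv β (p - r) s))
      =O[atTop] logDiv (β - 1) (p - r) :=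
    (deriv_mul_bigF_expansion β hp hrp).congr_left fun s => by ring
  have h := isBigO_mul_expansion (isBigO_one_logDiv β hc) (logDiv_sq_isBigO β hc)
    (isBigO_one_logDiv (β - 1) hc) hu hv
  obtain ⟨c₀, hc₀, hw⟩ := logDiv_sub_expWeight_isBigO β hp hrp hb β
  set k := 4 * (p - r) / ((p - 1) ^ 2 * (2 * p - r - 1)) with hk
  have hkpos : 0 < k := by positivity
  refine ⟨k * c₀, by positivity, ?_⟩
  refine IsBigO.trans ?_ (logDiv_isTheta_expWeight β hp hrp hb (β - 1)).isBigO
  refine ((h.const_mul_left 4).add (hw.const_mul_left (k * (r - (p - 1))))).congr_left fun s => ?_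
  have e : 1 / (p - 1) * -((p - r) * (p - r - 1) / ((p - 1) * (2 * p - r - 1))) * 4 =
      k * (r - (p - 1)) := by
    rw [hk]
    obtain ⟨c, hc'⟩ : ∃ c, c = 2 * p - r - 1 := ⟨_, rfl⟩
    rw [← hc'] at h2 ⊢
    field_simp
    ring
  linear_combination (-logDiv β (p - r) s) * e

/-! ### The function `φ` -/

lemma exists_bigF_eq (r β : ℝ) {p y : ℝ} (hp : 1 < p) (hy : 0 < y)
    (hy3 : y ≤ bigF (fEx p r β) 3) : ∃ s, 2 < s ∧ bigF (fEx p r β) s = y := by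
  have h := (tendsto_bigF_fEx r β hp).eventually (gt_mem_nhds hy)
  -- The intermediate value theorem is applied on [3, t]; starting at 3 rather than at 2 gives the
  -- strict inequality s > 2.
  obtain ⟨t, ht, ht3⟩ := (h.and (eventually_ge_atTop 3)).exists
  have hc : ContinuousOn (bigF (fEx p r β)) (Icc 3 t) := fun s hs =>
    (hasDerivAt_bigF_fEx r β hp (by linarith [hs.1])).continuousAt.continuousWithinAt
  obtain ⟨s, hs, hsy⟩ := intermediate_value_Icc' ht3 hc ⟨ht.le, hy3⟩
  exact ⟨s, by linarith [hs.1], hsy⟩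

lemma eventually_phi_spec {p r β : ℝ} {N : ℕ} (hp : 1 < p)
    (hb : 0 < bCoef N (qExp (fEx p r β))) :
    ∀ᶠ ρ in atTop, 2 < phi (fEx p r β) 2 N ρ ∧
      bigF (fEx p r β) (phi (fEx p r β) 2 N ρ) =
        Real.exp (-2 * ρ) / bCoef N (qExp (fEx p r β)) := by
  have h1 : Tendsto (fun ρ : ℝ => Real.exp (-2 * ρ) / bCoef N (qExp (fEx p r β))) atTop (𝓝 0) := by
    have : Tendsto (fun ρ : ℝ => -2 * ρ) atTop atBot :=
      tendsto_id.const_mul_atTop_of_neg (by norm_num)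
    simpa using (Real.tendsto_exp_atBot.comp this).div_const (bCoef N (qExp (fEx p r β)))
  filter_upwards [h1.eventually (ge_mem_nhds (bigF_fEx_pos (r := r) (β := β) (s := 3) hp
    (by norm_num)))] with ρ hρ
  obtain ⟨s, hs, hsy⟩ := exists_bigF_eq r β hp (div_pos (Real.exp_pos _) hb) hρ
  have hmem : ∃ s ∈ Ioi (2 : ℝ), bigF (fEx p r β) s =
      Real.exp (-2 * ρ) / bCoef N (qExp (fEx p r β)) := ⟨s, hs, hsy⟩
  exact ⟨Function.invFunOn_mem hmem, Function.invFunOn_eq hmem⟩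

lemma tendsto_phi {p r β : ℝ} {N : ℕ} (hp : 1 < p) (hb : 0 < bCoef N (qExp (fEx p r β))) :
    Tendsto (phi (fEx p r β) 2 N) atTop atTop := by
  rw [tendsto_atTop]
  intro M
  have hM : (1 : ℝ) < max M 3 := by
    have := le_max_right M 3
    linarith
  have h1 : Tendsto (fun ρ : ℝ => Real.exp (-2 * ρ) / bCoef N (qExp (fEx p r β))) atTop (𝓝 0) := by
    have : Tendsto (fun ρ : ℝ => -2 * ρ) atTop atBot :=
      tendsto_id.const_mul_atTop_of_neg (by norm_num)
    simpa using (Real.tendsto_exp_atBot.comp this).div_const (bCoef N (qExp (fEx p r β)))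
  filter_upwards [eventually_phi_spec hp hb,
    h1.eventually (gt_mem_nhds (bigF_fEx_pos (r := r) (β := β) hp hM))] with ρ hρ hlt
  rw [← hρ.2] at hlt
  have := ((strictAntiOn_bigF_fEx r β hp).lt_iff_gt
    (show (1 : ℝ) < phi (fEx p r β) 2 N ρ by linarith [hρ.1]) hM).1 hlt
  exact (le_max_left _ _).trans this.le

lemma emdenTime_phi {p r β : ℝ} {N : ℕ} (hp : 1 < p) (hb : 0 < bCoef N (qExp (fEx p r β))) :
    ∀ᶠ ρ in atTop,
      emdenTime p r β (bCoef N (qExp (fEx p r β))) (phi (fEx p r β) 2 N ρ) = ρ := by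
  filter_upwards [eventually_phi_spec hp hb] with ρ hρ
  rw [emdenTime, hρ.2, mul_div_cancel₀ _ hb.ne', Real.log_exp]
  ring

/-- A strictly monotone function whose image contains a neighbourhood of the value is continuous
there; the image is known because `emdenTime` inverts φ explicitly. -/
lemma exists_continuousOn_phi {p r β : ℝ} {N : ℕ} (hp : 1 < p)
    (hb : 0 < bCoef N (qExp (fEx p r β))) :
    ∀ᶠ ρ in atTop, ContinuousAt (phi (fEx p r β) 2 N) ρ := by
  obtain ⟨ρ₁, hρ₁⟩ := eventually_atTop.1 (eventually_phi_spec hp hb)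
  filter_upwards [eventually_gt_atTop ρ₁] with ρ hρ
  have hanti := strictAntiOn_bigF_fEx r β hp
  have hmono : StrictMonoOn (phi (fEx p r β) 2 N) (Ioi ρ₁) := by
    intro x hx y hy hxy
    have h1 := hρ₁ x (le_of_lt hx)
    have h2 := hρ₁ y (le_of_lt hy)
    refine (hanti.lt_iff_gt (show (1 : ℝ) < _ by linarith [h2.1])
      (show (1 : ℝ) < _ by linarith [h1.1])).1 ?_
    rw [h1.2, h2.2]
    exact div_lt_div_of_pos_right (Real.exp_lt_exp.2 (by linarith)) hb
  refine hmono.continuousAt_of_image_mem_nhds (Ioi_mem_nhds hρ) ?_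
  have h0 := hρ₁ ρ₁ le_rfl
  have hlt : phi (fEx p r β) 2 N ρ₁ < phi (fEx p r β) 2 N ρ := by
    have h2 := hρ₁ ρ hρ.le
    refine (hanti.lt_iff_gt (show (1 : ℝ) < _ by linarith [h2.1])
      (show (1 : ℝ) < _ by linarith [h0.1])).1 ?_
    rw [h0.2, h2.2]
    exact div_lt_div_of_pos_right (Real.exp_lt_exp.2 (by linarith)) hb
  -- Every s > φ(ρ₁) is attained, namely at ρ = emdenTime(s) > ρ₁.
  refine mem_of_superset (Ioi_mem_nhds hlt) fun s hs => ?_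
  have hs' : phi (fEx p r β) 2 N ρ₁ < s := hs
  have hs1 : 1 < s := by linarith [h0.1]
  have hF := bigF_fEx_pos (r := r) (β := β) hp hs1
  have hexp : Real.exp (-2 * emdenTime p r β (bCoef N (qExp (fEx p r β))) s) =
      bCoef N (qExp (fEx p r β)) * bigF (fEx p r β) s := by
    rw [emdenTime, show ∀ x : ℝ, -2 * (-x / 2) = x by intro x; ring, Real.exp_log (by positivity)]
  have hgt : ρ₁ < emdenTime p r β (bCoef N (qExp (fEx p r β))) s := by
    have h3 := hanti (show (1 : ℝ) < _ by linarith [h0.1]) hs1 hs'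
    rw [h0.2, lt_div_iff₀ hb, mul_comm, ← hexp, Real.exp_lt_exp] at h3
    linarith
  refine ⟨_, hgt, ?_⟩
  have h4 := hρ₁ _ hgt.le
  refine hanti.injOn (show (1 : ℝ) < _ by linarith [h4.1]) hs1 ?_
  rw [h4.2, hexp, mul_div_cancel_left₀ _ hb.ne']

lemma bCoef_pos {p : ℝ} {N : ℕ} (hp : 1 < p) (hN : 3 ≤ N) (hpN : pCrit N < p) :
    0 < bCoef N (p / (p - 1)) := by
  have hN' : (3 : ℝ) ≤ N := by exact_mod_cast hN
  rw [pCrit, div_lt_iff₀ (by linarith)] at hpN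
  have hp1 : 0 < p - 1 := by linarith
  have e : bCoef N (p / (p - 1)) = 2 * (p * (N - 2) - N) / (p - 1) := by
    unfold bCoef
    field_simp
    ring
  rw [e]
  have : 0 < p * (N - 2) - N := by linarith
  positivity

/-! ### From estimates in s to estimates in ρ -/

section Transfer

variable {p r β : ℝ} {N : ℕ}

lemma isBigO_expWeight_of_isBigO_logDiv {g : ℝ → ℝ} {d : ℝ} (hp : 1 < p) (hrp : r < p)
    (hb : 0 < bCoef N (qExp (fEx p r β))) (hg : g =O[atTop] logDiv d (p - r)) :
    (fun ρ => g (phi (fEx p r β) 2 N ρ)) =O[atTop] expWeight p r d := by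
  refine ((hg.trans (logDiv_isTheta_expWeight β hp hrp hb d).isBigO).comp_tendsto
    (tendsto_phi hp hb)).trans_eventuallyEq ?_
  filter_upwards [emdenTime_phi hp hb] with ρ hρ
  simp only [Function.comp, hρ]

lemma logDiv_phi_isTheta (hp : 1 < p) (hrp : r < p)
    (hb : 0 < bCoef N (qExp (fEx p r β))) (d : ℝ) :
    (fun ρ => logDiv d (p - r) (phi (fEx p r β) 2 N ρ)) =Θ[atTop] expWeight p r d := by
  refine ⟨isBigO_expWeight_of_isBigO_logDiv hp hrp hb (isBigO_refl _ _), ?_⟩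
  refine IsBigO.congr' ((logDiv_isTheta_expWeight β hp hrp hb d).isBigO_symm.comp_tendsto
    (tendsto_phi hp hb)) ?_ EventuallyEq.rfl
  filter_upwards [emdenTime_phi hp hb] with ρ hρ
  simp only [Function.comp, hρ]

lemma inhom_sub_isBigO (hp : 1 < p) (hrp : r < p) (hb : 0 < bCoef N (qExp (fEx p r β))) :
    ∃ c > 0, (fun ρ => inhom (fEx p r β) 2 N ρ - c * (r - (p - 1)) * expWeight p r β ρ)
      =O[atTop] expWeight p r (β - 1) := by
  obtain ⟨c, hc, h⟩ := inhom_expansion β hp hrp hb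
  refine ⟨c, hc, (h.comp_tendsto (tendsto_phi hp hb)).congr' ?_ ?_⟩
  · filter_upwards [emdenTime_phi hp hb] with ρ hρ
    simp only [Function.comp, hρ]
    rw [inhom, qExp_fEx β hp hrp]
  · filter_upwards [emdenTime_phi hp hb] with ρ hρ
    simp only [Function.comp, hρ]

lemma expWeight_pos {d ρ : ℝ} (hρ : 0 < ρ) : 0 < expWeight p r d ρ :=
  mul_pos (Real.rpow_pos_of_pos hρ _) (Real.exp_pos _)

lemma expWeight_sub_one_isLittleO (p r d : ℝ) :
    expWeight p r (d - 1) =o[atTop] expWeight p r d := by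
  have h := ((isLittleO_one_iff ℝ).2 tendsto_inv_atTop_zero).mul_isBigO
    (isBigO_refl (expWeight p r d) atTop)
  refine h.congr' ?_ ?_
  · filter_upwards [eventually_gt_atTop 0] with ρ hρ
    simp only [expWeight]
    rw [Real.rpow_sub_one hρ.ne']
    ring
  · simp

lemma inhom_isBigO (hp : 1 < p) (hrp : r < p) (hb : 0 < bCoef N (qExp (fEx p r β))) :
    inhom (fEx p r β) 2 N =O[atTop] expWeight p r β := by
  obtain ⟨c, hc, h⟩ := inhom_sub_isBigO hp hrp hb
  have h1 := (h.trans (expWeight_sub_one_isLittleO p r β).isBigO).add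
    (isBigO_const_mul_self (c * (r - (p - 1))) (expWeight p r β) atTop)
  exact h1.congr_left fun ρ => by ring

lemma inhom_isEquivalent (hp : 1 < p) (hrp : r < p) (hb : 0 < bCoef N (qExp (fEx p r β)))
    (hr : r ≠ p - 1) :
    ∃ c > 0, IsEquivalent atTop (inhom (fEx p r β) 2 N)
      fun ρ => c * (r - (p - 1)) * expWeight p r β ρ := by
  obtain ⟨c, hc, h⟩ := inhom_sub_isBigO hp hrp hb
  refine ⟨c, hc, ?_⟩
  have h1 := h.trans_isLittleO (expWeight_sub_one_isLittleO p r β)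
  exact h1.trans_isBigO (isBigO_self_const_mul (mul_ne_zero hc.ne' (sub_ne_zero.2 hr)) _ _)

lemma inhom_sign (hp : 1 < p) (hrp : r < p) (hb : 0 < bCoef N (qExp (fEx p r β)))
    (hr : r ≠ p - 1) :
    ∀ᶠ ρ in atTop, 0 < (r - (p - 1)) * inhom (fEx p r β) 2 N ρ := by
  obtain ⟨c, hc, h⟩ := inhom_sub_isBigO hp hrp hb
  have hr' : 0 < |r - (p - 1)| := abs_pos.2 (sub_ne_zero.2 hr)
  -- The error is taken at most half of the main term, so the product of I with r-(p-1) keeps the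
  -- sign of the square.
  have h1 := (h.trans_isLittleO (expWeight_sub_one_isLittleO p r β)).bound
    (show 0 < c * |r - (p - 1)| / 2 by positivity)
  filter_upwards [h1, eventually_gt_atTop 0] with ρ hρ hρ0
  have hw := expWeight_pos (p := p) (r := r) (d := β) hρ0
  rw [Real.norm_of_nonneg hw.le, Real.norm_eq_abs] at hρ
  set I := inhom (fEx p r β) 2 N ρ
  set w := expWeight p r β ρ
  set k := r - (p - 1)
  have h2 : |k * (I - c * k * w)| ≤ |k| * (c * |k| / 2 * w) := by
    rw [abs_mul]
    gcongr
  have h3 := (abs_le.1 h2).1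
  have h4 : |k| * |k| = k * k := abs_mul_abs_self k
  have h5 : 0 < c * w * (|k| * |k|) := by positivity
  have h6 : k * (I - c * k * w) = k * I - c * w * (|k| * |k|) := by
    rw [h4]
    ring
  have h7 : |k| * (c * |k| / 2 * w) = c * w * (|k| * |k|) / 2 := by ring
  rw [h6, h7] at h3
  linarith

lemma coefL2_isBigO (hp : 1 < p) (hrp : r < p) (hb : 0 < bCoef N (qExp (fEx p r β))) :
    coefL2 (fEx p r β) 2 N =O[atTop] expWeight p r β := by
  have h1 : (fun s => fEx p r β s * bigF (fEx p r β) s / s - 1 / (p - 1)) =O[atTop]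
      logDiv β (p - r) := by
    refine (((mul_bigF_div_expansion β hp hrp).trans (isBigO_logDiv_sub_one β (p - r))).add
      (isBigO_const_mul_self ((p - r) / ((p - 1) * (2 * p - r - 1)))
        (logDiv β (p - r)) atTop)).congr_left fun s => ?_
    ring
  have h2 := (isBigO_expWeight_of_isBigO_logDiv hp hrp hb h1).const_mul_left 4
  refine h2.congr_left fun ρ => ?_
  rw [coefL2, pExp_fEx β hp hrp]

lemma coefL1_isBigO (hp : 1 < p) (hrp : r < p) (hb : 0 < bCoef N (qExp (fEx p r β))) :
    coefL1 (fEx p r β) 2 N =O[atTop] expWeight p r β := by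
  have h1 : (fun s => deriv (fEx p r β) s * bigF (fEx p r β) s - p / (p - 1)) =O[atTop]
      logDiv β (p - r) := by
    refine (((deriv_mul_bigF_expansion β hp hrp).trans (isBigO_logDiv_sub_one β (p - r))).sub
      (isBigO_const_mul_self ((p - r) * (p - r - 1) / ((p - 1) * (2 * p - r - 1)))
        (logDiv β (p - r)) atTop)).congr_left fun s => ?_
    ring
  have h2 := isBigO_expWeight_of_isBigO_logDiv hp hrp hb h1
  have h3 := coefL2_isBigO hp hrp hb
  have h4 := ((h2.sub (h3.const_mul_left (1 / 4))).const_mul_left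
    (bCoef N (qExp (fEx p r β)))).add (inhom_isBigO hp hrp hb)
  refine h4.congr_left fun ρ => ?_
  rw [coefL1, coefL2, ← qExp_fEx β hp hrp]
  ring

end Transfer

/-! ### A Volterra equation in a weighted space -/

open scoped BoundedContinuousFunction

/-- Recombining the two integrals makes the kernel at (ρ, τ) a single vector inside one integral, so
that cancellation between the two fundamental solutions survives when norms are taken. -/
lemma integral_smul_add_integral_smul {E : Type*} [NormedAddCommGroup E] [NormedSpace ℝ E]
    [CompleteSpace E] {Q₁ Q₂ g : ℝ → ℝ} (hQ₁ : Continuous Q₁) (hQ₂ : Continuous Q₂)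
    (hg : Continuous g) (x₁ x₂ : E) (c d : ℝ) :
    (∫ τ in c..d, Q₁ τ * g τ) • x₁ + (∫ τ in c..d, Q₂ τ * g τ) • x₂ =
      ∫ τ in c..d, g τ • (Q₁ τ • x₁ + Q₂ τ • x₂) := by
  rw [← intervalIntegral.integral_smul_const, ← intervalIntegral.integral_smul_const,
    ← intervalIntegral.integral_add]
  · refine intervalIntegral.integral_congr fun τ _ => ?_
    simp only [smul_add, smul_smul]
    rw [mul_comm (Q₁ τ), mul_comm (Q₂ τ)]
  · exact ((hQ₁.mul hg).smul continuous_const).intervalIntegrable _ _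
  · exact ((hQ₂.mul hg).smul continuous_const).intervalIntegrable _ _

/-- Existence for `y(ρ) = u(ρ) + Σ (∫_{ρ₀}^ρ Qᵢ G(τ, y(τ)) dτ) Pᵢ(ρ)` in the space weighted
by `w`. -/
theorem exists_volterra_solution {E : Type*} [NormedAddCommGroup E] [NormedSpace ℝ E]
    [CompleteSpace E] {ρ₀ U : ℝ} {w ℓ Q₁ Q₂ : ℝ → ℝ} {u P₁ P₂ : ℝ → E} {G : ℝ → E → ℝ}
    (hw : Continuous w) (hw0 : ∀ ρ, 0 < w ρ) (hℓ : Continuous ℓ)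
    (hℓ0 : ∀ τ, 0 ≤ ℓ τ)    (hQ₁ : Continuous Q₁) (hQ₂ : Continuous Q₂) (hP₁ : Continuous P₁) (hP₂ : Continuous P₂)
    (hu : Continuous u) (hG : Continuous fun x : ℝ × E => G x.1 x.2)
    (hG0 : ∀ τ, G τ 0 = 0) (hGlip : ∀ τ x y, |G τ x - G τ y| ≤ ℓ τ * ‖x - y‖)
    (hU : ∀ ρ ≥ ρ₀, ‖u ρ‖ ≤ U * w ρ)
    (hsmall : ∀ ρ ≥ ρ₀, ∫ τ in ρ₀..ρ, ‖Q₁ τ • P₁ ρ + Q₂ τ • P₂ ρ‖ * (ℓ τ * w τ) ≤ w ρ / 2) :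
    ∃ y : ℝ → E, Continuous y ∧ (∀ ρ ≥ ρ₀, y ρ = u ρ +
      ((∫ τ in ρ₀..ρ, Q₁ τ * G τ (y τ)) • P₁ ρ + (∫ τ in ρ₀..ρ, Q₂ τ * G τ (y τ)) • P₂ ρ)) ∧
      ∀ ρ ≥ ρ₀, ‖y ρ‖ ≤ 2 * U * w ρ := by
  have hgc : ∀ z : ℝ →ᵇ E, Continuous fun τ => G τ (w τ • z τ) := fun z =>
    hG.comp (continuous_id.prodMk (hw.smul z.continuous))
  -- The unknown is y = w z with z bounded and continuous, which turns the weighted norm into the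
  -- sup norm.
  set T : (ℝ →ᵇ E) → ℝ → E := fun z ρ => u ρ +
    ((∫ τ in ρ₀..ρ, Q₁ τ * G τ (w τ • z τ)) • P₁ ρ +
      (∫ τ in ρ₀..ρ, Q₂ τ * G τ (w τ • z τ)) • P₂ ρ) with hT
  have hTc : ∀ z, Continuous (T z) := fun z =>
    hu.add (((intervalIntegral.continuous_primitive
      (fun a b => (hQ₁.mul (hgc z)).intervalIntegrable a b) ρ₀).smul hP₁).add
      ((intervalIntegral.continuous_primitive
      (fun a b => (hQ₂.mul (hgc z)).intervalIntegrable a b) ρ₀).smul hP₂))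
  have hT0 : ∀ ρ, T 0 ρ = u ρ := fun ρ => by simp [hT, hG0]
  have hTlip : ∀ z z' : ℝ →ᵇ E, ∀ ρ ≥ ρ₀, ‖T z ρ - T z' ρ‖ ≤ dist z z' * (w ρ / 2) := by
    intro z z' ρ hρ
    have e : T z ρ - T z' ρ = ∫ τ in ρ₀..ρ, (G τ (w τ • z τ) - G τ (w τ • z' τ)) •
        (Q₁ τ • P₁ ρ + Q₂ τ • P₂ ρ) := by
      simp only [hT]
      rw [integral_smul_add_integral_smul hQ₁ hQ₂ (hgc z),
        integral_smul_add_integral_smul hQ₁ hQ₂ (hgc z'), add_sub_add_left_eq_sub,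
        ← intervalIntegral.integral_sub]
      · simp only [sub_smul]
      · exact ((hgc z).smul ((hQ₁.smul continuous_const).add
          (hQ₂.smul continuous_const))).intervalIntegrable _ _
      · exact ((hgc z').smul ((hQ₁.smul continuous_const).add
          (hQ₂.smul continuous_const))).intervalIntegrable _ _
    rw [e]
    have hk : Continuous fun τ => ‖Q₁ τ • P₁ ρ + Q₂ τ • P₂ ρ‖ * (ℓ τ * w τ) :=
      ((hQ₁.smul continuous_const).add (hQ₂.smul continuous_const)).norm.mul (hℓ.mul hw)
    calc _ ≤ ∫ τ in ρ₀..ρ, dist z z' * (‖Q₁ τ • P₁ ρ + Q₂ τ • P₂ ρ‖ * (ℓ τ * w τ)) := by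
          refine intervalIntegral.norm_integral_le_of_norm_le hρ ?_
            ((continuous_const.mul hk).intervalIntegrable _ _)
          refine Eventually.of_forall fun τ _ => ?_
          rw [norm_smul, Real.norm_eq_abs]
          have h1 := hGlip τ (w τ • z τ) (w τ • z' τ)
          rw [← smul_sub, norm_smul, Real.norm_of_nonneg (hw0 τ).le] at h1
          have h4 : ‖z τ - z' τ‖ ≤ dist z z' := by
            rw [← dist_eq_norm]
            exact BoundedContinuousFunction.dist_coe_le_dist τ
          have h5 : |G τ (w τ • z τ) - G τ (w τ • z' τ)| ≤ ℓ τ * (w τ * dist z z') :=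
            h1.trans (by have := (hw0 τ).le; have := hℓ0 τ; gcongr)
          calc _ ≤ ℓ τ * (w τ * dist z z') * ‖Q₁ τ • P₁ ρ + Q₂ τ • P₂ ρ‖ := by gcongr
            _ = _ := by ring
      _ = dist z z' * ∫ τ in ρ₀..ρ, ‖Q₁ τ • P₁ ρ + Q₂ τ • P₂ ρ‖ * (ℓ τ * w τ) := by
          rw [intervalIntegral.integral_const_mul]
      _ ≤ _ := mul_le_mul_of_nonneg_left (hsmall ρ hρ) dist_nonneg
  -- The equation matters only for ρ ≥ ρ₀; freezing the argument at max ρ ρ₀ gives a self-map of the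
  -- bounded continuous functions on all of ℝ.
  have hSlip : ∀ z z' : ℝ →ᵇ E, ∀ ρ, ‖(w (max ρ ρ₀))⁻¹ • T z (max ρ ρ₀) -
      (w (max ρ ρ₀))⁻¹ • T z' (max ρ ρ₀)‖ ≤ dist z z' / 2 := by
    intro z z' ρ
    have h := hTlip z z' (max ρ ρ₀) (le_max_right _ _)
    have hwp := hw0 (max ρ ρ₀)
    rw [← smul_sub, norm_smul, norm_inv, Real.norm_of_nonneg hwp.le, inv_mul_le_iff₀ hwp]
    linarith
  have hS0 : ∀ ρ, ‖(w (max ρ ρ₀))⁻¹ • T 0 (max ρ ρ₀)‖ ≤ U := by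
    intro ρ
    have hwp := hw0 (max ρ ρ₀)
    rw [hT0, norm_smul, norm_inv, Real.norm_of_nonneg hwp.le, inv_mul_le_iff₀ hwp, mul_comm]
    exact hU _ (le_max_right _ _)
  have hSb : ∀ z : ℝ →ᵇ E, ∀ ρ, ‖(w (max ρ ρ₀))⁻¹ • T z (max ρ ρ₀)‖ ≤ ‖z‖ / 2 + U := by
    intro z ρ
    have h1 := hSlip z 0 ρ
    rw [dist_zero_right] at h1
    have h2 := norm_add_le ((w (max ρ ρ₀))⁻¹ • T z (max ρ ρ₀) -
      (w (max ρ ρ₀))⁻¹ • T 0 (max ρ ρ₀)) ((w (max ρ ρ₀))⁻¹ • T 0 (max ρ ρ₀))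
    rw [sub_add_cancel] at h2
    linarith [hS0 ρ]
  have hmax : Continuous fun ρ : ℝ => max ρ ρ₀ := continuous_id.max continuous_const
  set S : (ℝ →ᵇ E) → (ℝ →ᵇ E) := fun z => BoundedContinuousFunction.ofNormedAddCommGroup
    (fun ρ => (w (max ρ ρ₀))⁻¹ • T z (max ρ ρ₀))
    (((hw.comp hmax).inv₀ fun ρ => (hw0 _).ne').smul ((hTc z).comp hmax)) _ (hSb z) with hS
  have hcon : ContractingWith (1 / 2) S := by
    refine ⟨by rw [← NNReal.coe_lt_coe]; norm_num, LipschitzWith.of_dist_le_mul fun z z' => ?_⟩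
    rw [BoundedContinuousFunction.dist_le (by positivity)]
    intro ρ
    rw [dist_eq_norm]
    refine (hSlip z z' ρ).trans (le_of_eq ?_)
    push_cast
    ring
  set z := ContractingWith.fixedPoint S hcon
  have hz : S z = z := hcon.fixedPoint_isFixedPt
  have hzv : ∀ ρ, (w (max ρ ρ₀))⁻¹ • T z (max ρ ρ₀) = z ρ := fun ρ => by
    conv_rhs => rw [← hz]
    rfl
  have hU0 : 0 ≤ U := (norm_nonneg _).trans (hS0 0)
  have hzn : ‖z‖ ≤ 2 * U := by
    have : ‖z‖ ≤ ‖z‖ / 2 + U := by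
      rw [BoundedContinuousFunction.norm_le (by positivity)]
      intro ρ
      rw [← hzv]
      exact hSb z ρ
    linarith
  refine ⟨fun τ => w τ • z τ, hw.smul z.continuous, fun ρ hρ => ?_, fun ρ _ => ?_⟩
  · change _ = T z ρ
    beta_reduce
    rw [← hzv, max_eq_left hρ, smul_smul, mul_inv_cancel₀ (hw0 ρ).ne', one_smul]
  · rw [norm_smul, Real.norm_of_nonneg (hw0 ρ).le, mul_comm]
    exact mul_le_mul_of_nonneg_right ((z.norm_coe_le_norm ρ).trans hzn) (hw0 ρ).le

/-! ### Second order equations with constant coefficients -/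

/-- A pair of independent solutions of `η'' + a η' + b η = 0`. -/
structure IsFundamentalPair (a b : ℝ) (Φ₁ Φ₂ : ℝ → ℝ) : Prop where
  hasDerivAt₁ : ∀ t, HasDerivAt Φ₁ (deriv Φ₁ t) t
  hasDerivAt₂ : ∀ t, HasDerivAt Φ₂ (deriv Φ₂ t) t
  hasDerivAt_deriv₁ : ∀ t, HasDerivAt (deriv Φ₁) (-a * deriv Φ₁ t - b * Φ₁ t) t
  hasDerivAt_deriv₂ : ∀ t, HasDerivAt (deriv Φ₂) (-a * deriv Φ₂ t - b * Φ₂ t) t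
  wronskian_ne : ∀ t, Φ₁ t * deriv Φ₂ t - deriv Φ₁ t * Φ₂ t ≠ 0

/-- The coefficient of `Φ₁` in the variation of parameters formula. -/
noncomputable def varCoef₁ (Φ₁ Φ₂ : ℝ → ℝ) (t : ℝ) : ℝ :=
  Φ₂ t / (Φ₁ t * deriv Φ₂ t - deriv Φ₁ t * Φ₂ t)

/-- The coefficient of `Φ₂` in the variation of parameters formula. -/
noncomputable def varCoef₂ (Φ₁ Φ₂ : ℝ → ℝ) (t : ℝ) : ℝ :=
  -Φ₁ t / (Φ₁ t * deriv Φ₂ t - deriv Φ₁ t * Φ₂ t)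

/-- The pair formed by a function and its derivative. -/
noncomputable def jet (Φ : ℝ → ℝ) (t : ℝ) : ℝ × ℝ := (Φ t, deriv Φ t)

namespace IsFundamentalPair

variable {a b : ℝ} {Φ₁ Φ₂ : ℝ → ℝ}

lemma continuous₁ (h : IsFundamentalPair a b Φ₁ Φ₂) : Continuous Φ₁ :=
  continuous_iff_continuousAt.2 fun t => (h.hasDerivAt₁ t).continuousAt

lemma continuous₂ (h : IsFundamentalPair a b Φ₁ Φ₂) : Continuous Φ₂ :=
  continuous_iff_continuousAt.2 fun t => (h.hasDerivAt₂ t).continuousAt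

lemma continuous_deriv₁ (h : IsFundamentalPair a b Φ₁ Φ₂) : Continuous (deriv Φ₁) :=
  continuous_iff_continuousAt.2 fun t => (h.hasDerivAt_deriv₁ t).continuousAt

lemma continuous_deriv₂ (h : IsFundamentalPair a b Φ₁ Φ₂) : Continuous (deriv Φ₂) :=
  continuous_iff_continuousAt.2 fun t => (h.hasDerivAt_deriv₂ t).continuousAt

lemma continuous_wronskian (h : IsFundamentalPair a b Φ₁ Φ₂) :
    Continuous fun t => Φ₁ t * deriv Φ₂ t - deriv Φ₁ t * Φ₂ t :=
  (h.continuous₁.mul h.continuous_deriv₂).sub (h.continuous_deriv₁.mul h.continuous₂)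

lemma continuous_varCoef₁ (h : IsFundamentalPair a b Φ₁ Φ₂) : Continuous (varCoef₁ Φ₁ Φ₂) :=
  h.continuous₂.div h.continuous_wronskian h.wronskian_ne

lemma continuous_varCoef₂ (h : IsFundamentalPair a b Φ₁ Φ₂) : Continuous (varCoef₂ Φ₁ Φ₂) :=
  h.continuous₁.neg.div h.continuous_wronskian h.wronskian_ne

/-- Variation of parameters solves the Cauchy problem with data at `ρ₀`. -/
lemma exists_solution (h : IsFundamentalPair a b Φ₁ Φ₂) {g : ℝ → ℝ} (hg : Continuous g)
    (ρ₀ α₁ α₂ : ℝ) {η : ℝ → ℝ}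
    (hη : ∀ ρ, η ρ = (α₁ + ∫ τ in ρ₀..ρ, varCoef₁ Φ₁ Φ₂ τ * g τ) * Φ₁ ρ +
      (α₂ + ∫ τ in ρ₀..ρ, varCoef₂ Φ₁ Φ₂ τ * g τ) * Φ₂ ρ) :
    ContDiff ℝ 2 η ∧
      (∀ ρ, deriv η ρ = (α₁ + ∫ τ in ρ₀..ρ, varCoef₁ Φ₁ Φ₂ τ * g τ) * deriv Φ₁ ρ +
        (α₂ + ∫ τ in ρ₀..ρ, varCoef₂ Φ₁ Φ₂ τ * g τ) * deriv Φ₂ ρ) ∧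
      ∀ ρ, deriv (deriv η) ρ + a * deriv η ρ + b * η ρ + g ρ = 0 := by
  have c₁ : ∀ ρ, HasDerivAt (fun ρ => α₁ + ∫ τ in ρ₀..ρ, varCoef₁ Φ₁ Φ₂ τ * g τ)
      (varCoef₁ Φ₁ Φ₂ ρ * g ρ) ρ := fun ρ =>
    ((h.continuous_varCoef₁.mul hg).integral_hasStrictDerivAt ρ₀ ρ).hasDerivAt.const_add _
  have c₂ : ∀ ρ, HasDerivAt (fun ρ => α₂ + ∫ τ in ρ₀..ρ, varCoef₂ Φ₁ Φ₂ τ * g τ)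
      (varCoef₂ Φ₁ Φ₂ ρ * g ρ) ρ := fun ρ =>
    ((h.continuous_varCoef₂.mul hg).integral_hasStrictDerivAt ρ₀ ρ).hasDerivAt.const_add _
  set C₁ := fun ρ => α₁ + ∫ τ in ρ₀..ρ, varCoef₁ Φ₁ Φ₂ τ * g τ with hC₁
  set C₂ := fun ρ => α₂ + ∫ τ in ρ₀..ρ, varCoef₂ Φ₁ Φ₂ τ * g τ with hC₂
  have hη' : η = fun ρ => C₁ ρ * Φ₁ ρ + C₂ ρ * Φ₂ ρ := funext hη
  have hd : ∀ ρ, HasDerivAt η (C₁ ρ * deriv Φ₁ ρ + C₂ ρ * deriv Φ₂ ρ) ρ := by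
    intro ρ
    rw [hη']
    -- The terms with differentiated coefficients drop out, because Q₁Φ₁ + Q₂Φ₂ = 0. In the second
    -- derivative the corresponding sum Q₁Φ₁' + Q₂Φ₂' is -1 and produces -g.
    refine (((c₁ ρ).mul (h.hasDerivAt₁ ρ)).add ((c₂ ρ).mul (h.hasDerivAt₂ ρ))).congr_deriv ?_
    simp only [varCoef₁, varCoef₂]
    ring
  have hd' : deriv η = fun ρ => C₁ ρ * deriv Φ₁ ρ + C₂ ρ * deriv Φ₂ ρ :=
    funext fun ρ => (hd ρ).deriv
  have hdd : ∀ ρ, HasDerivAt (deriv η) (-a * deriv η ρ - b * η ρ - g ρ) ρ := by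
    intro ρ
    have e := hη ρ
    change η ρ = C₁ ρ * Φ₁ ρ + C₂ ρ * Φ₂ ρ at e
    rw [(hd ρ).deriv, e, hd']
    refine (((c₁ ρ).mul (h.hasDerivAt_deriv₁ ρ)).add
      ((c₂ ρ).mul (h.hasDerivAt_deriv₂ ρ))).congr_deriv ?_
    have hW := h.wronskian_ne ρ
    have e1 : varCoef₁ Φ₁ Φ₂ ρ * g ρ * deriv Φ₁ ρ + varCoef₂ Φ₁ Φ₂ ρ * g ρ * deriv Φ₂ ρ =
        -g ρ := by
      have e2 := div_self hW
      simp only [varCoef₁, varCoef₂]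
      linear_combination (-g ρ) * e2
    linear_combination e1
  have hdη : Differentiable ℝ η := fun ρ => (hd ρ).differentiableAt
  have hddη : Differentiable ℝ (deriv η) := fun ρ => (hdd ρ).differentiableAt
  refine ⟨?_, fun ρ => (hd ρ).deriv, fun ρ => by rw [(hdd ρ).deriv]; ring⟩
  rw [show (2 : WithTop ℕ∞) = 1 + 1 by norm_num, contDiff_succ_iff_deriv]
  refine ⟨hdη, by simp, ?_⟩
  rw [contDiff_one_iff_deriv]
  refine ⟨hddη, ?_⟩
  rw [show deriv (deriv η) = fun ρ => -a * deriv η ρ - b * η ρ - g ρ from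
    funext fun ρ => (hdd ρ).deriv]
  exact ((continuous_const.mul hddη.continuous).sub
    (continuous_const.mul hdη.continuous)).sub hg

lemma continuous_jet₁ (h : IsFundamentalPair a b Φ₁ Φ₂) : Continuous (jet Φ₁) :=
  h.continuous₁.prodMk h.continuous_deriv₁

lemma continuous_jet₂ (h : IsFundamentalPair a b Φ₁ Φ₂) : Continuous (jet Φ₂) :=
  h.continuous₂.prodMk h.continuous_deriv₂

/-- Existence and weighted bounds for the perturbed equation
`η'' + a η' + b η + g(ρ) + G(ρ, η, η') = 0`. -/
theorem exists_perturbed_solution (h : IsFundamentalPair a b Φ₁ Φ₂) {ρ₀ U₁ U₂ α₁ α₂ : ℝ}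
    {w ℓ g : ℝ → ℝ} {G : ℝ → ℝ × ℝ → ℝ}
    (hw : Continuous w) (hw0 : ∀ ρ, 0 < w ρ) (hℓ : Continuous ℓ) (hℓ0 : ∀ τ, 0 ≤ ℓ τ)
    (hg : Continuous g) (hG : Continuous fun x : ℝ × (ℝ × ℝ) => G x.1 x.2)
    (hG0 : ∀ τ, G τ 0 = 0) (hGlip : ∀ τ x y, |G τ x - G τ y| ≤ ℓ τ * ‖x - y‖)
    (hα : ∀ ρ ≥ ρ₀, ‖α₁ • jet Φ₁ ρ + α₂ • jet Φ₂ ρ‖ ≤ U₁ * w ρ)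
    (hgU : ∀ ρ ≥ ρ₀, ‖(∫ τ in ρ₀..ρ, varCoef₁ Φ₁ Φ₂ τ * g τ) • jet Φ₁ ρ +
      (∫ τ in ρ₀..ρ, varCoef₂ Φ₁ Φ₂ τ * g τ) • jet Φ₂ ρ‖ ≤ U₂ * w ρ)
    (hsmall : ∀ ρ ≥ ρ₀, ∫ τ in ρ₀..ρ,
      ‖varCoef₁ Φ₁ Φ₂ τ • jet Φ₁ ρ + varCoef₂ Φ₁ Φ₂ τ • jet Φ₂ ρ‖ * (ℓ τ * w τ) ≤ w ρ / 2) :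
    ∃ η : ℝ → ℝ, ContDiff ℝ 2 η ∧ jet η ρ₀ = α₁ • jet Φ₁ ρ₀ + α₂ • jet Φ₂ ρ₀ ∧
      (∀ ρ ≥ ρ₀, ‖jet η ρ‖ ≤ 2 * (U₁ + U₂) * w ρ) ∧
      (∀ ρ ≥ ρ₀, deriv (deriv η) ρ + a * deriv η ρ + b * η ρ + (g ρ + G ρ (jet η ρ)) = 0) ∧
      ∀ ρ ≥ ρ₀, η ρ = α₁ * Φ₁ ρ + α₂ * Φ₂ ρ +
        ∫ τ in ρ₀..ρ, (varCoef₁ Φ₁ Φ₂ τ * Φ₁ ρ + varCoef₂ Φ₁ Φ₂ τ * Φ₂ ρ) *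
          (g τ + G τ (jet η τ)) := by
  have hQ₁ := h.continuous_varCoef₁
  have hQ₂ := h.continuous_varCoef₂
  have hint : ∀ {Q k : ℝ → ℝ}, Continuous Q → Continuous k → ∀ ρ,
      IntervalIntegrable (fun τ => Q τ * k τ) volume ρ₀ ρ := fun hQ hk ρ =>
    (hQ.mul hk).intervalIntegrable _ _
  obtain ⟨y, hy, hyeq, hyb⟩ := exists_volterra_solution (E := ℝ × ℝ) (U := U₁ + U₂)
    (u := fun ρ => (α₁ • jet Φ₁ ρ + α₂ • jet Φ₂ ρ) +
      ((∫ τ in ρ₀..ρ, varCoef₁ Φ₁ Φ₂ τ * g τ) • jet Φ₁ ρ +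
      (∫ τ in ρ₀..ρ, varCoef₂ Φ₁ Φ₂ τ * g τ) • jet Φ₂ ρ))
    hw hw0 hℓ hℓ0 hQ₁ hQ₂ h.continuous_jet₁ h.continuous_jet₂
    (((h.continuous_jet₁.const_smul α₁).add (h.continuous_jet₂.const_smul α₂)).add
      (((intervalIntegral.continuous_primitive
        (fun c d => (hQ₁.mul hg).intervalIntegrable c d) ρ₀).smul h.continuous_jet₁).add
      ((intervalIntegral.continuous_primitive
        (fun c d => (hQ₂.mul hg).intervalIntegrable c d) ρ₀).smul h.continuous_jet₂)))
    hG hG0 hGlip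
    (fun ρ hρ => by
      refine (norm_add_le _ _).trans ?_
      linarith [hα ρ hρ, hgU ρ hρ]) hsmall
  have hGy : Continuous fun τ => G τ (y τ) := hG.comp (continuous_id.prodMk hy)
  have hF : Continuous fun τ => g τ + G τ (y τ) := hg.add hGy
  set η : ℝ → ℝ := fun ρ =>
    (α₁ + ∫ τ in ρ₀..ρ, varCoef₁ Φ₁ Φ₂ τ * (g τ + G τ (y τ))) * Φ₁ ρ +
      (α₂ + ∫ τ in ρ₀..ρ, varCoef₂ Φ₁ Φ₂ τ * (g τ + G τ (y τ))) * Φ₂ ρ with hη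
  obtain ⟨hη2, hηd, hηode⟩ := h.exists_solution hF ρ₀ α₁ α₂ (η := η) fun ρ => rfl
  have hsplit : ∀ {Q : ℝ → ℝ}, Continuous Q → ∀ ρ, ∫ τ in ρ₀..ρ, Q τ * (g τ + G τ (y τ)) =
      (∫ τ in ρ₀..ρ, Q τ * g τ) + ∫ τ in ρ₀..ρ, Q τ * G τ (y τ) := fun hQ ρ => by
    rw [← intervalIntegral.integral_add (hint hQ hg ρ) (hint hQ hGy ρ)]
    simp only [mul_add]
  -- The fixed point y is an arbitrary pair of functions; here its second component is identified as
  -- the derivative of the first.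
  have hjet : ∀ ρ ≥ ρ₀, jet η ρ = y ρ := by
    intro ρ hρ
    rw [hyeq ρ hρ]
    ext
    · simp only [jet, hη, hsplit hQ₁, hsplit hQ₂, Prod.fst_add, Prod.smul_fst, smul_eq_mul]
      ring
    · simp only [jet, hηd, hsplit hQ₁, hsplit hQ₂, Prod.snd_add, Prod.smul_snd, smul_eq_mul]
      ring
  refine ⟨η, hη2, ?_, fun ρ hρ => by rw [hjet ρ hρ]; exact hyb ρ hρ,
    fun ρ hρ => by rw [hjet ρ hρ]; exact hηode ρ, fun ρ hρ => ?_⟩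
  · rw [hjet ρ₀ le_rfl, hyeq ρ₀ le_rfl]
    simp
  · have e : ∫ τ in ρ₀..ρ, (varCoef₁ Φ₁ Φ₂ τ * Φ₁ ρ + varCoef₂ Φ₁ Φ₂ τ * Φ₂ ρ) *
          (g τ + G τ (jet η τ)) = ∫ τ in ρ₀..ρ, (g τ + G τ (y τ)) •
            (varCoef₁ Φ₁ Φ₂ τ • Φ₁ ρ + varCoef₂ Φ₁ Φ₂ τ • Φ₂ ρ) := by
      refine intervalIntegral.integral_congr fun τ hτ => ?_
      rw [uIcc_of_le hρ] at hτ
      simp only [hjet τ hτ.1, smul_eq_mul]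
      ring
    rw [e, ← integral_smul_add_integral_smul hQ₁ hQ₂ hF]
    simp only [hη, smul_eq_mul]
    ring

end IsFundamentalPair

/-! ### Estimates for the nonlinear term -/

lemma ddfEx_isBigO (β : ℝ) {p r : ℝ} (hrp : r < p) :
    ddfEx p r β =O[atTop] fun s => s ^ (p - 2) := by
  have hc : 0 < p - r := sub_pos.2 hrp
  have h1 : (fun s => p * (p - 1) + r * (r - 1) * logDiv β (p - r) s +
      (2 * r - 1) * β * logDiv (β - 1) (p - r) s +
      β * (β - 1) * logDiv (β - 2) (p - r) s) =O[atTop] fun _ => (1 : ℝ) :=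
    (((isBigO_const_const _ one_ne_zero _).add
      ((isBigO_one_logDiv β hc).const_mul_left _)).add
      ((isBigO_one_logDiv (β - 1) hc).const_mul_left _)).add
      ((isBigO_one_logDiv (β - 2) hc).const_mul_left _)
  refine ((isBigO_refl (fun s : ℝ => s ^ (p - 2)) atTop).mul h1).congr' ?_ ?_
  · filter_upwards [eventually_gt_atTop 0] with s hs
    rw [ddfEx_eq hs]
  · simp

/-- The remainder of the first order Taylor expansion of `f`, normalized. -/
noncomputable def taylorRem (p r β s x : ℝ) : ℝ :=
  bigF (fEx p r β) s / s *
    (fEx p r β (s * (1 + x)) - fEx p r β s - deriv (fEx p r β) s * s * x)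

/-- The derivative in x is F(s) (f'(s(1+x)) - f'(s)), of size F(s) · s^(p-2) · s|x| = O(s^(p-1)F(s)
|x|) by the bound on f''. Since s^(p-1)F(s) is bounded, the Lipschitz constant on |x| ≤ κ is O(κ).
-/
lemma taylorRem_lipschitz (β : ℝ) {p r : ℝ} (hp : 1 < p) (hrp : r < p) :
    ∃ C > 0, ∀ᶠ s in atTop, ∀ κ ≤ 1 / 4, ∀ x y, |x| ≤ κ → |y| ≤ κ →
      |taylorRem p r β s x - taylorRem p r β s y| ≤ C * κ * |x - y| := by
  obtain ⟨C₁, hC₁, h₁⟩ := (ddfEx_isBigO β hrp).exists_pos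
  obtain ⟨T, hT⟩ := eventually_atTop.1 h₁.bound
  have h₃ : ∀ᶠ s in atTop, normF p r β s ≤ 1 / (p - 1) + 1 :=
    (tendsto_normF β hp hrp).eventually (ge_mem_nhds (by linarith))
  have hp1 : 0 < p - 1 := sub_pos.2 hp
  -- For t between 3s/4 and 5s/4, t^p ≤ (5/4)^p s^p and 1/t² ≤ (16/9)/s²; treating them separately
  -- avoids the sign of p-2.
  set C₂ : ℝ := C₁ * ((5 / 4) ^ p * (16 / 9)) with hC₂
  have hC₂pos : 0 < C₂ := by positivity
  refine ⟨C₂ * (1 / (p - 1) + 1), by positivity, ?_⟩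
  -- These thresholds put the whole interval [3s/4, 5s/4] inside (1, ∞) and beyond T.
  filter_upwards [eventually_gt_atTop 4, eventually_ge_atTop (4 / 3 * T), h₃] with s hs hsT hsF
  have hs0 : 0 < s := by linarith
  have hsp := Real.rpow_pos_of_pos hs0 p
  have hdd : ∀ t ∈ Icc (3 / 4 * s) (5 / 4 * s), ‖ddfEx p r β t‖ ≤ C₂ * s ^ (p - 2) := by
    intro t ht
    have ht0 : 0 < t := by linarith [ht.1]
    refine (hT t (by linarith [ht.1])).trans ?_
    rw [Real.norm_of_nonneg (by positivity), hC₂, mul_assoc]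
    refine mul_le_mul_of_nonneg_left ?_ hC₁.le
    rw [Real.rpow_sub ht0, Real.rpow_sub hs0, Real.rpow_two, Real.rpow_two]
    have h1 : t ^ p ≤ (5 / 4) ^ p * s ^ p := by
      rw [← Real.mul_rpow (by norm_num) hs0.le]
      exact Real.rpow_le_rpow ht0.le ht.2 (by linarith)
    have h2 : (3 / 4 * s) ^ 2 ≤ t ^ 2 := pow_le_pow_left₀ (by positivity) ht.1 2
    calc t ^ p / t ^ 2 ≤ (5 / 4) ^ p * s ^ p / (3 / 4 * s) ^ 2 := by gcongr
      _ = _ := by field_simp; ring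
  have hdf : ∀ x, |x| ≤ 1 / 4 →
      ‖dfEx p r β (s * (1 + x)) - dfEx p r β s‖ ≤ C₂ * s ^ (p - 2) * (s * |x|) := by
    intro x hx
    have hx' := abs_le.1 hx
    have h := (convex_Icc (3 / 4 * s) (5 / 4 * s)).norm_image_sub_le_of_norm_hasDerivWithin_le
      (f := dfEx p r β) (f' := ddfEx p r β) (x := s) (y := s * (1 + x))
      (fun t ht => (hasDerivAt_dfEx p r β (by linarith [ht.1])).hasDerivWithinAt) hdd
      ⟨by linarith, by linarith⟩ ⟨by nlinarith, by nlinarith⟩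
    rw [show s * (1 + x) - s = s * x by ring, norm_mul, Real.norm_of_nonneg hs0.le,
      Real.norm_eq_abs x] at h
    exact h
  intro κ hκ x y hx hy
  have hκ0 : 0 ≤ κ := (abs_nonneg x).trans hx
  have h := (convex_Icc (-κ) κ).norm_image_sub_le_of_norm_hasDerivWithin_le
    (f := fun x => fEx p r β (s * (1 + x)) - fEx p r β s - deriv (fEx p r β) s * s * x)
    (f' := fun x => dfEx p r β (s * (1 + x)) * s - dfEx p r β s * s)
    (C := C₂ * s ^ p * κ) (x := y) (y := x) (fun t ht => ?_) (fun t ht => ?_)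
    (abs_le.1 hy) (abs_le.1 hx)
  · rw [taylorRem, taylorRem, ← mul_sub, abs_mul,
      abs_of_nonneg (div_nonneg (bigF_fEx_nonneg (by linarith)) hs0.le)]
    rw [Real.norm_eq_abs, Real.norm_eq_abs] at h
    have hF0 : 0 ≤ bigF (fEx p r β) s / s :=
      div_nonneg (bigF_fEx_nonneg (by linarith)) hs0.le
    calc _ ≤ bigF (fEx p r β) s / s * (C₂ * s ^ p * κ * |x - y|) := by gcongr
      _ = C₂ * normF p r β s * κ * |x - y| := by
        rw [normF, Real.rpow_sub_one hs0.ne']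
        ring
      _ ≤ _ := by gcongr
  · have ht' : |t| ≤ 1 / 4 := (abs_le.2 ht).trans hκ
    have h1 : (1 : ℝ) < s * (1 + t) := by nlinarith [(abs_le.1 ht').1]
    have hin : HasDerivAt (fun x : ℝ => s * (1 + x)) s t := by
      simpa using ((hasDerivAt_id t).const_add 1).const_mul s
    have hlin : HasDerivAt (fun x : ℝ => deriv (fEx p r β) s * s * x) (dfEx p r β s * s) t := by
      have := (hasDerivAt_id t).const_mul (deriv (fEx p r β) s * s)
      rw [mul_one, deriv_fEx p r β (by linarith)] at this
      rw [deriv_fEx p r β (by linarith)]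
      exact this
    exact (((((hasDerivAt_fEx p r β h1).comp t hin).sub_const _)).sub hlin).hasDerivWithinAt
  · have ht' : |t| ≤ κ := abs_le.2 ht
    rw [← sub_mul, norm_mul, Real.norm_of_nonneg hs0.le]
    calc _ ≤ C₂ * s ^ (p - 2) * (s * |t|) * s := by
          gcongr
          exact hdf t (ht'.trans hκ)
      _ = C₂ * s ^ p * |t| := by
          rw [Real.rpow_sub hs0, Real.rpow_two]
          field_simp
      _ ≤ _ := by gcongr

lemma taylorRem_zero (p r β s : ℝ) : taylorRem p r β s 0 = 0 := by
  simp [taylorRem]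

lemma nonlin_eq (p r β : ℝ) (N : ℕ) (η : ℝ → ℝ) (ρ : ℝ) :
    nonlin (fEx p r β) 2 N η ρ =
      bCoef N (qExp (fEx p r β)) * taylorRem p r β (phi (fEx p r β) 2 N ρ) (η ρ) := by
  simp only [nonlin, taylorRem]
  ring

/-- Half of the exponential rate is spent on the polynomial factor. -/
lemma exists_isBigO_exp (β : ℝ) {p r : ℝ} (hp : 1 < p) (hrp : r < p) :
    ∃ μ > 0, expWeight p r β =O[atTop] fun ρ => Real.exp (-μ * ρ) := by
  have hγ : 0 < 2 * (p - r) / (p - 1) :=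
    div_pos (by linarith) (by linarith)
  set γ := 2 * (p - r) / (p - 1) with hγd
  refine ⟨γ / 2, by positivity, ?_⟩
  have h := (isLittleO_rpow_exp_pos_mul_atTop β (half_pos hγ)).isBigO.mul
    (isBigO_refl (fun ρ : ℝ => Real.exp (-γ * ρ)) atTop)
  refine h.congr_right fun ρ => ?_
  rw [← Real.exp_add]
  congr 1
  ring

/-! ### Existence of decaying solutions -/

/-- Conditions on `w` under which solutions of size `O(w)` are constructed. -/
structure IsAdmissibleWeight (Φ₁ Φ₂ g w : ℝ → ℝ) (ρ₁ : ℝ) : Prop where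
  continuousOn : ContinuousOn w (Ici ρ₁)
  pos : ∀ ρ ≥ ρ₁, 0 < w ρ
  exp_decay : ∃ μ > 0, w =O[atTop] fun ρ => Real.exp (-μ * ρ)
  kernel : ∀ ν > 0, ∃ C > 0, ∀ τ ≥ ρ₁, ∀ ρ ≥ τ,
    ‖varCoef₁ Φ₁ Φ₂ τ • jet Φ₁ ρ + varCoef₂ Φ₁ Φ₂ τ • jet Φ₂ ρ‖ * w τ ≤
      C * Real.exp (ν * τ) * w ρ
  jet₁ : ∃ C > 0, ∀ ρ ≥ ρ₁, ‖jet Φ₁ ρ‖ ≤ C * w ρ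
  jet₂ : ∃ C > 0, ∀ ρ ≥ ρ₁, ‖jet Φ₂ ρ‖ ≤ C * w ρ
  source : ∃ C > 0, ∀ ρ₀ ≥ ρ₁, ∀ ρ ≥ ρ₀,
    ‖(∫ τ in ρ₀..ρ, varCoef₁ Φ₁ Φ₂ τ * g τ) • jet Φ₁ ρ +
      (∫ τ in ρ₀..ρ, varCoef₂ Φ₁ Φ₂ τ * g τ) • jet Φ₂ ρ‖ ≤ C * w ρ

lemma integral_exp_neg_le {μ c d : ℝ} (hμ : 0 < μ) :
    ∫ τ in c..d, Real.exp (-μ * τ) ≤ Real.exp (-μ * c) / μ := by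
  have h : ∫ τ in c..d, Real.exp (-μ * τ) =
      Real.exp (-μ * d) / (-μ) - Real.exp (-μ * c) / (-μ) := by
    refine intervalIntegral.integral_eq_sub_of_hasDerivAt
      (f := fun t => Real.exp (-μ * t) / (-μ)) (fun t _ => ?_)
      (by apply Continuous.intervalIntegrable; fun_prop)
    have h1 : HasDerivAt (fun t : ℝ => -μ * t) (-μ) t := by
      simpa using (hasDerivAt_id t).const_mul (-μ)
    exact (h1.exp.div_const (-μ)).congr_deriv (mul_div_cancel_right₀ _ (neg_ne_zero.2 hμ.ne'))
  rw [h, div_neg, div_neg]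
  have : 0 < Real.exp (-μ * d) / μ := by positivity
  linarith

/-- Truncation to `[-κ, κ]`. -/
noncomputable def clamp (κ x : ℝ) : ℝ := max (-κ) (min x κ)

lemma abs_clamp_le {κ : ℝ} (hκ : 0 ≤ κ) (x : ℝ) : |clamp κ x| ≤ κ :=
  abs_le.2 ⟨le_max_left _ _, max_le (by linarith) (min_le_right _ _)⟩

lemma clamp_of_abs_le {κ x : ℝ} (hx : |x| ≤ κ) : clamp κ x = x := by
  rw [clamp, min_eq_left (abs_le.1 hx).2, max_eq_right (abs_le.1 hx).1]

lemma abs_clamp_sub_le (κ x y : ℝ) : |clamp κ x - clamp κ y| ≤ |x - y| := by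
  unfold clamp
  refine (abs_max_sub_max_le_max _ _ _ _).trans ?_
  rw [sub_self, abs_zero]
  refine max_le (abs_nonneg _) ((abs_min_sub_min_le_max _ _ _ _).trans ?_)
  simp

lemma continuousOn_bigF_fEx (r β : ℝ) {p : ℝ} (hp : 1 < p) :
    ContinuousOn (bigF (fEx p r β)) (Ioi 1) :=
  fun _ hs => (hasDerivAt_bigF_fEx r β hp hs).continuousAt.continuousWithinAt

lemma continuousOn_deriv_fEx (p r β : ℝ) : ContinuousOn (deriv (fEx p r β)) (Ioi 1) :=
  (continuousOn_dfEx p r β).congr fun _ hs => deriv_fEx p r β hs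

/-! ### Continuity of the coefficients along φ -/

section Continuity

variable {p r β : ℝ} {N : ℕ} {ψ : ℝ → ℝ}

lemma continuous_inhom_comp (hp : 1 < p) (hψ : Continuous fun τ => phi (fEx p r β) 2 N (ψ τ))
    (h1 : ∀ τ, 1 < phi (fEx p r β) 2 N (ψ τ)) :
    Continuous fun τ => inhom (fEx p r β) 2 N (ψ τ) := by
  have hf := (continuousOn_fEx p r β).comp_continuous hψ h1
  have hF := (continuousOn_bigF_fEx r β hp).comp_continuous hψ h1
  have hd := (continuousOn_deriv_fEx p r β).comp_continuous hψ h1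
  unfold inhom
  exact (((continuous_const.mul hf).mul hF).div hψ fun τ => by linarith [h1 τ]).mul
    ((hd.mul hF).sub continuous_const)

lemma continuous_coefL2_comp (hp : 1 < p) (hψ : Continuous fun τ => phi (fEx p r β) 2 N (ψ τ))
    (h1 : ∀ τ, 1 < phi (fEx p r β) 2 N (ψ τ)) :
    Continuous fun τ => coefL2 (fEx p r β) 2 N (ψ τ) := by
  have hf := (continuousOn_fEx p r β).comp_continuous hψ h1
  have hF := (continuousOn_bigF_fEx r β hp).comp_continuous hψ h1
  unfold coefL2
  exact continuous_const.mul (((hf.mul hF).div hψ fun τ => by linarith [h1 τ]).sub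
    continuous_const)

lemma continuous_coefL1_comp (hp : 1 < p) (hψ : Continuous fun τ => phi (fEx p r β) 2 N (ψ τ))
    (h1 : ∀ τ, 1 < phi (fEx p r β) 2 N (ψ τ)) :
    Continuous fun τ => coefL1 (fEx p r β) 2 N (ψ τ) := by
  have hf := (continuousOn_fEx p r β).comp_continuous hψ h1
  have hF := (continuousOn_bigF_fEx r β hp).comp_continuous hψ h1
  have hd := (continuousOn_deriv_fEx p r β).comp_continuous hψ h1
  unfold coefL1
  exact (continuous_const.mul (((hd.mul hF).sub continuous_const).sub
    (((hf.mul hF).div hψ fun τ => by linarith [h1 τ]).sub continuous_const))).add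
    (continuous_inhom_comp hp hψ h1)

lemma continuous_taylorRem_comp {X : Type*} [TopologicalSpace X] {s x : X → ℝ} (hp : 1 < p)
    (hs : Continuous s) (hx : Continuous x) (h1 : ∀ t, 1 < s t)
    (h2 : ∀ t, 1 < s t * (1 + x t)) : Continuous fun t => taylorRem p r β (s t) (x t) := by
  have hf := (continuousOn_fEx p r β).comp_continuous hs h1
  have hF := (continuousOn_bigF_fEx r β hp).comp_continuous hs h1
  have hd := (continuousOn_deriv_fEx p r β).comp_continuous hs h1
  have hf2 := (continuousOn_fEx p r β).comp_continuous
    (hs.mul (continuous_const.add hx)) h2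
  unfold taylorRem
  exact (hF.div hs fun t => by linarith [h1 t]).mul ((hf2.sub hf).sub ((hd.mul hs).mul hx))

end Continuity

-- The kernel may lose e^{νt} on the weight for any ν > 0, and this is affordable because the
-- Lipschitz constant of the perturbation is O(e^{-μτ}). The source bound is uniform in ρ₀, so the
-- radius R can be fixed first and ρ₀ chosen afterwards.
set_option maxHeartbeats 1000000 in
theorem exists_etaSolution {p r β : ℝ} {N : ℕ} (hp : 1 < p) (hrp : r < p)
    (hb : 0 < bCoef N (qExp (fEx p r β)))
    (hΦ : IsFundamentalPair (aCoef N p) (bCoef N (qExp (fEx p r β))) (fundOne N p) (fundTwo N p))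
    {w : ℝ → ℝ} {ρ₁ : ℝ}
    (hw : IsAdmissibleWeight (fundOne N p) (fundTwo N p) (inhom (fEx p r β) 2 N) w ρ₁) :
    ∃ ρ₀ > 0, ∃ ε > 0,
      (∀ ρ ≥ ρ₀, 2 < phi (fEx p r β) 2 N ρ ∧ bigF (fEx p r β) (phi (fEx p r β) 2 N ρ) =
        Real.exp (-2 * ρ) / bCoef N (qExp (fEx p r β))) ∧
      ∀ A B : ℝ, 0 < A → 0 < B → A + B < ε →
        ∃ η : ℝ → ℝ, IsEtaSolution (fEx p r β) 2 N ρ₀ A B η ∧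
          (fun ρ => |η ρ| + |deriv η ρ|) =O[atTop] w := by
  obtain ⟨μ₁, hμ₁, hwexp⟩ := hw.exp_decay
  obtain ⟨μ₂, hμ₂, hvexp⟩ := exists_isBigO_exp β hp hrp
  obtain ⟨Ct, hCt, htaylor⟩ := taylorRem_lipschitz β hp hrp
  obtain ⟨Cj₁, hCj₁, hj₁⟩ := hw.jet₁
  obtain ⟨Cj₂, hCj₂, hj₂⟩ := hw.jet₂
  obtain ⟨U₂, hU₂, hsrc⟩ := hw.source
  set b := bCoef N (qExp (fEx p r β)) with hbdef
  set μ := min μ₁ μ₂ with hμdef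
  have hμ : 0 < μ := lt_min hμ₁ hμ₂
  have hexp_le : ∀ μ', μ ≤ μ' → (fun ρ : ℝ => Real.exp (-μ' * ρ)) =O[atTop]
      fun ρ => Real.exp (-μ * ρ) := by
    intro μ' hμ'
    refine IsBigO.of_bound 1 ?_
    filter_upwards [eventually_ge_atTop 0] with ρ hρ
    rw [Real.norm_of_nonneg (Real.exp_pos _).le, Real.norm_of_nonneg (Real.exp_pos _).le, one_mul,
      Real.exp_le_exp]
    nlinarith
  obtain ⟨Cw, hCw, hwb⟩ := (hwexp.trans (hexp_le μ₁ (min_le_left _ _))).exists_pos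
  obtain ⟨C₁, hC₁, hL₁⟩ := ((coefL1_isBigO hp hrp hb).trans
    (hvexp.trans (hexp_le μ₂ (min_le_right _ _)))).exists_pos
  obtain ⟨C₂, hC₂, hL₂⟩ := ((coefL2_isBigO hp hrp hb).trans
    (hvexp.trans (hexp_le μ₂ (min_le_right _ _)))).exists_pos
  -- With ν = μ/2 the integrand retains the decay e^{-μτ/2}, whose integral from ρ₀ is small for
  -- large ρ₀.
  obtain ⟨Ck, hCk, hker⟩ := hw.kernel (μ / 2) (half_pos hμ)
  -- The contraction doubles the size of the free term: 1 for the homogeneous part, once A + B is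
  -- small, and U₂ for the source.
  set R := 2 * (1 + U₂) with hR
  have hRpos : 0 < R := by positivity
  set Cℓ := C₁ + C₂ + b * (Ct * (R * Cw)) with hCℓ
  have hCℓpos : 0 < Cℓ := by positivity
  have hexp0 : ∀ ν > 0, Tendsto (fun ρ : ℝ => Real.exp (-ν * ρ)) atTop (𝓝 0) := fun ν hν =>
    Real.tendsto_exp_atBot.comp (tendsto_id.const_mul_atTop_of_neg (neg_neg_of_pos hν))
  have hw0 : Tendsto w atTop (𝓝 0) := hwexp.trans_tendsto (hexp0 μ₁ hμ₁)
  have hsm1 : ∀ᶠ ρ in atTop, R * w ρ ≤ 1 / 4 := by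
    have := hw0.const_mul R
    rw [mul_zero] at this
    exact this.eventually (ge_mem_nhds (by norm_num))
  have hsm2 : ∀ᶠ ρ in atTop, Ck * Cℓ * (Real.exp (-(μ / 2) * ρ) / (μ / 2)) ≤ 1 / 2 := by
    have := ((hexp0 (μ / 2) (half_pos hμ)).div_const (μ / 2)).const_mul (Ck * Cℓ)
    rw [zero_div, mul_zero] at this
    exact this.eventually (ge_mem_nhds (by norm_num))
  -- From φ > 4 and R w ≤ 1/4 follows φ(1+η) ≥ 3 whenever |η| ≤ R w, hence the domain condition.
  obtain ⟨ρ₀, hρ₀⟩ := eventually_atTop.1 (((((((eventually_phi_spec hp hb).and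
    ((tendsto_phi hp hb).eventually_gt_atTop 4)).and (exists_continuousOn_phi hp hb)).and
    ((hwb.bound.and hL₁.bound).and hL₂.bound)).and
    ((tendsto_phi hp hb).eventually htaylor)).and (hsm1.and hsm2)).and
    ((eventually_ge_atTop ρ₁).and (eventually_gt_atTop 0)))
  have hspec := fun ρ hρ => (hρ₀ ρ hρ).1.1.1.1.1.1
  have hphi4 := fun ρ hρ => (hρ₀ ρ hρ).1.1.1.1.1.2
  have hphic := fun ρ hρ => (hρ₀ ρ hρ).1.1.1.1.2
  have hbw := fun ρ hρ => (hρ₀ ρ hρ).1.1.1.2.1.1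
  have hbL₁ := fun ρ hρ => (hρ₀ ρ hρ).1.1.1.2.1.2
  have hbL₂ := fun ρ hρ => (hρ₀ ρ hρ).1.1.1.2.2
  have hRw := fun ρ hρ => (hρ₀ ρ hρ).1.2.1
  have hsm := (hρ₀ ρ₀ le_rfl).1.2.2
  have hge := fun ρ hρ => (hρ₀ ρ hρ).2.1
  have hρ₀pos := (hρ₀ ρ₀ le_rfl).2.2
  have htay := fun ρ hρ => (hρ₀ ρ hρ).1.1.2
  clear hρ₀
  have hm : ∀ τ, ρ₀ ≤ max τ ρ₀ := fun τ => le_max_right _ _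
  have hmc : Continuous fun τ : ℝ => max τ ρ₀ := continuous_id.max continuous_const
  have hφc : Continuous fun τ => phi (fEx p r β) 2 N (max τ ρ₀) :=
    continuous_iff_continuousAt.2 fun τ =>
      ContinuousAt.comp (f := fun τ : ℝ => max τ ρ₀) (hphic _ (hm τ)) hmc.continuousAt
  have hφ1 : ∀ τ, 1 < phi (fEx p r β) 2 N (max τ ρ₀) := fun τ => by
    linarith [hphi4 _ (hm τ)]
  have hwpos : ∀ ρ ≥ ρ₀, 0 < w ρ := fun ρ hρ => hw.pos ρ (hge ρ hρ)
  have hwc : Continuous fun τ => w (max τ ρ₀) :=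
    hw.continuousOn.comp_continuous hmc fun τ => hge _ (hm τ)
  have hIc := continuous_inhom_comp hp hφc hφ1
  have hL₁c := continuous_coefL1_comp hp hφc hφ1
  have hL₂c := continuous_coefL2_comp hp hφc hφ1
  set ℓ : ℝ → ℝ := fun τ => |coefL1 (fEx p r β) 2 N (max τ ρ₀)| +
    |coefL2 (fEx p r β) 2 N (max τ ρ₀)| + b * (Ct * (R * w (max τ ρ₀))) with hℓ
  -- Truncating η at R w makes the perturbation globally Lipschitz in the pair, as the contraction
  -- argument needs; L₁ and L₂ are linear and are left alone.
  set G : ℝ → ℝ × ℝ → ℝ := fun τ z => coefL1 (fEx p r β) 2 N (max τ ρ₀) * z.1 +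
    coefL2 (fEx p r β) 2 N (max τ ρ₀) * z.2 +
    b * taylorRem p r β (phi (fEx p r β) 2 N (max τ ρ₀)) (clamp (R * w (max τ ρ₀)) z.1) with hG
  have hRw0 : ∀ τ, 0 ≤ R * w (max τ ρ₀) := fun τ => mul_nonneg hRpos.le (hwpos _ (hm τ)).le
  have hclamp : ∀ τ x, |clamp (R * w (max τ ρ₀)) x| ≤ 1 / 4 := fun τ x =>
    (abs_clamp_le (hRw0 τ) x).trans (hRw _ (hm τ))
  have hGc : Continuous fun x : ℝ × (ℝ × ℝ) => G x.1 x.2 := by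
    have hRwc : Continuous fun x : ℝ × (ℝ × ℝ) => R * w (max x.1 ρ₀) :=
      continuous_const.mul (hwc.comp continuous_fst)
    have hcl : Continuous fun x : ℝ × (ℝ × ℝ) => clamp (R * w (max x.1 ρ₀)) x.2.1 :=
      hRwc.neg.max ((continuous_fst.comp continuous_snd).min hRwc)
    refine (((hL₁c.comp continuous_fst).mul (continuous_fst.comp continuous_snd)).add
      ((hL₂c.comp continuous_fst).mul (continuous_snd.comp continuous_snd))).add
      (continuous_const.mul (continuous_taylorRem_comp hp (hφc.comp continuous_fst) hcl
        (fun t => hφ1 _) fun t => ?_))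
    have h1 := (abs_le.1 (hclamp t.1 t.2.1)).1
    have h2 := hphi4 _ (hm t.1)
    have h3 : phi (fEx p r β) 2 N (max t.1 ρ₀) * (3 / 4) ≤ phi (fEx p r β) 2 N (max t.1 ρ₀) *
        (1 + clamp (R * w (max t.1 ρ₀)) t.2.1) :=
      mul_le_mul_of_nonneg_left (by linarith) (by linarith)
    exact lt_of_lt_of_le (by linarith) h3
  have hGlip : ∀ τ x y, |G τ x - G τ y| ≤ ℓ τ * ‖x - y‖ := by
    intro τ x y
    have hx1 : |x.1 - y.1| ≤ ‖x - y‖ := norm_fst_le (x - y)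
    have hx2 : |x.2 - y.2| ≤ ‖x - y‖ := norm_snd_le (x - y)
    have h3 := htay _ (hm τ) _ (hRw _ (hm τ)) _ _ (abs_clamp_le (hRw0 τ) x.1)
      (abs_clamp_le (hRw0 τ) y.1)
    have h4 := abs_clamp_sub_le (R * w (max τ ρ₀)) x.1 y.1
    have e : G τ x - G τ y = coefL1 (fEx p r β) 2 N (max τ ρ₀) * (x.1 - y.1) +
        coefL2 (fEx p r β) 2 N (max τ ρ₀) * (x.2 - y.2) +
        b * (taylorRem p r β (phi (fEx p r β) 2 N (max τ ρ₀)) (clamp (R * w (max τ ρ₀)) x.1) -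
          taylorRem p r β (phi (fEx p r β) 2 N (max τ ρ₀)) (clamp (R * w (max τ ρ₀)) y.1)) := by
      simp only [hG]
      ring
    rw [e]
    refine (abs_add_three _ _ _).trans ?_
    rw [abs_mul, abs_mul, abs_mul, abs_of_pos hb]
    have h5 := hRw0 τ
    calc _ ≤ |coefL1 (fEx p r β) 2 N (max τ ρ₀)| * ‖x - y‖ +
          |coefL2 (fEx p r β) 2 N (max τ ρ₀)| * ‖x - y‖ +
          b * (Ct * (R * w (max τ ρ₀)) * ‖x - y‖) := by
          gcongr
          exact h3.trans (by gcongr; exact h4.trans hx1)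
      _ = _ := by
          simp only [hℓ]
          ring
  have hG0 : ∀ τ, G τ 0 = 0 := by
    intro τ
    have : clamp (R * w (max τ ρ₀)) 0 = 0 := clamp_of_abs_le (by simpa using hRw0 τ)
    simp [hG, this, taylorRem_zero]
  have hℓc : Continuous ℓ :=
    (hL₁c.abs.add hL₂c.abs).add (continuous_const.mul (continuous_const.mul
      (continuous_const.mul hwc)))
  have hℓ0 : ∀ τ, 0 ≤ ℓ τ := fun τ => by
    have := hRw0 τ
    simp only [hℓ]
    positivity
  have hℓle : ∀ τ ≥ ρ₀, ℓ τ ≤ Cℓ * Real.exp (-μ * τ) := by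
    intro τ hτ
    have h1 := hbw τ hτ
    have h2 := hbL₁ τ hτ
    have h3 := hbL₂ τ hτ
    rw [Real.norm_of_nonneg (Real.exp_pos _).le, Real.norm_eq_abs] at h1 h2 h3
    have h4 := (le_abs_self _).trans h1
    simp only [hℓ, max_eq_left hτ]
    calc _ ≤ C₁ * Real.exp (-μ * τ) + C₂ * Real.exp (-μ * τ) +
          b * (Ct * (R * (Cw * Real.exp (-μ * τ)))) := by gcongr
      _ = _ := by
          rw [hCℓ]
          ring
  have hQc : ∀ ρ, Continuous fun τ => ‖varCoef₁ (fundOne N p) (fundTwo N p) τ •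
      jet (fundOne N p) ρ + varCoef₂ (fundOne N p) (fundTwo N p) τ • jet (fundTwo N p) ρ‖ :=
    fun ρ => ((hΦ.continuous_varCoef₁.smul continuous_const).add
      (hΦ.continuous_varCoef₂.smul continuous_const)).norm
  have hsmall : ∀ ρ ≥ ρ₀, ∫ τ in ρ₀..ρ, ‖varCoef₁ (fundOne N p) (fundTwo N p) τ •
      jet (fundOne N p) ρ + varCoef₂ (fundOne N p) (fundTwo N p) τ • jet (fundTwo N p) ρ‖ *
      (ℓ τ * w (max τ ρ₀)) ≤ w (max ρ ρ₀) / 2 := by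
    intro ρ hρ
    have hwρ := hwpos ρ hρ
    rw [max_eq_left hρ]
    calc _ ≤ ∫ τ in ρ₀..ρ, Ck * Cℓ * w ρ * Real.exp (-(μ / 2) * τ) := by
          refine intervalIntegral.integral_mono_on hρ
            (((hQc ρ).mul (hℓc.mul hwc)).intervalIntegrable _ _)
            (by apply Continuous.intervalIntegrable; fun_prop) fun τ hτ => ?_
          rw [max_eq_left hτ.1]
          have h1 := hker τ (hge τ hτ.1) ρ hτ.2
          have h2 := hℓle τ hτ.1
          calc _ = ‖varCoef₁ (fundOne N p) (fundTwo N p) τ • jet (fundOne N p) ρ +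
                varCoef₂ (fundOne N p) (fundTwo N p) τ • jet (fundTwo N p) ρ‖ * w τ * ℓ τ := by
                ring
            _ ≤ Ck * Real.exp (μ / 2 * τ) * w ρ * (Cℓ * Real.exp (-μ * τ)) :=
                mul_le_mul h1 h2 (hℓ0 τ) (by positivity)
            _ = Ck * Cℓ * w ρ * (Real.exp (μ / 2 * τ) * Real.exp (-μ * τ)) := by ring
            _ = _ := by
                rw [← Real.exp_add]
                congr 2
                ring
      _ = Ck * Cℓ * w ρ * ∫ τ in ρ₀..ρ, Real.exp (-(μ / 2) * τ) := by
          rw [intervalIntegral.integral_const_mul]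
      _ ≤ Ck * Cℓ * w ρ * (Real.exp (-(μ / 2) * ρ₀) / (μ / 2)) := by
          gcongr
          exact integral_exp_neg_le (half_pos hμ)
      _ ≤ w ρ / 2 := by nlinarith
  set W := fundOne N p ρ₀ * deriv (fundTwo N p) ρ₀ - deriv (fundOne N p) ρ₀ * fundTwo N p ρ₀
    with hW
  have hWne : W ≠ 0 := hΦ.wronskian_ne ρ₀
  set M := (|fundOne N p ρ₀| + |deriv (fundOne N p) ρ₀| + |fundTwo N p ρ₀| +
    |deriv (fundTwo N p) ρ₀|) / |W| with hM
  have hM0 : 0 ≤ M := by positivity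
  -- Both coefficients of the homogeneous part are at most M(A+B), so this ε makes that part at most
  -- w; the added 1 keeps the denominator positive.
  refine ⟨ρ₀, hρ₀pos, 1 / (M * (Cj₁ + Cj₂) + 1), by positivity, fun ρ hρ => hspec ρ hρ, ?_⟩
  intro A B hA hB hAB
  -- Cramer's rule for the initial data (A, B); all integrals vanish at ρ₀.
  set α₁ := (A * deriv (fundTwo N p) ρ₀ - B * fundTwo N p ρ₀) / W with hα₁
  set α₂ := (B * fundOne N p ρ₀ - A * deriv (fundOne N p) ρ₀) / W with hα₂
  have hcomb : ∀ x y : ℝ, |x| + |y| ≤ M * |W| → |A * x - B * y| / |W| ≤ M * (A + B) := by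
    intro x y hxy
    rw [div_le_iff₀ (abs_pos.2 hWne)]
    have h1 : |A * x - B * y| ≤ A * |x| + B * |y| := by
      refine (abs_sub _ _).trans (le_of_eq ?_)
      rw [abs_mul, abs_mul, abs_of_pos hA, abs_of_pos hB]
    nlinarith [abs_nonneg x, abs_nonneg y]
  have hMW : M * |W| = |fundOne N p ρ₀| + |deriv (fundOne N p) ρ₀| + |fundTwo N p ρ₀| +
      |deriv (fundTwo N p) ρ₀| := div_mul_cancel₀ _ (abs_pos.2 hWne).ne'
  have hα₁b : |α₁| ≤ M * (A + B) := by
    rw [hα₁, abs_div]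
    refine hcomb _ _ ?_
    rw [hMW]
    linarith [abs_nonneg (fundOne N p ρ₀), abs_nonneg (deriv (fundOne N p) ρ₀)]
  have hα₂b : |α₂| ≤ M * (A + B) := by
    rw [hα₂, abs_div, abs_sub_comm]
    refine hcomb _ _ ?_
    rw [hMW]
    linarith [abs_nonneg (fundTwo N p ρ₀), abs_nonneg (deriv (fundTwo N p) ρ₀)]
  have hABM : M * (A + B) * (Cj₁ + Cj₂) ≤ 1 := by
    rw [lt_div_iff₀ (by positivity)] at hAB
    nlinarith
  have hhom : ∀ ρ ≥ ρ₀, ‖α₁ • jet (fundOne N p) ρ + α₂ • jet (fundTwo N p) ρ‖ ≤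
      1 * w (max ρ ρ₀) := by
    intro ρ hρ
    simp only [max_eq_left hρ]
    have hwρ := hwpos ρ hρ
    refine (norm_add_le _ _).trans ?_
    rw [norm_smul, norm_smul, Real.norm_eq_abs, Real.norm_eq_abs]
    calc _ ≤ M * (A + B) * (Cj₁ * w ρ) + M * (A + B) * (Cj₂ * w ρ) := by
          gcongr
          · exact hj₁ ρ (hge ρ hρ)
          · exact hj₂ ρ (hge ρ hρ)
      _ = M * (A + B) * (Cj₁ + Cj₂) * w ρ := by ring
      _ ≤ _ := by gcongr
  have hsource : ∀ ρ ≥ ρ₀, ‖(∫ τ in ρ₀..ρ, varCoef₁ (fundOne N p) (fundTwo N p) τ *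
      inhom (fEx p r β) 2 N (max τ ρ₀)) • jet (fundOne N p) ρ +
      (∫ τ in ρ₀..ρ, varCoef₂ (fundOne N p) (fundTwo N p) τ *
      inhom (fEx p r β) 2 N (max τ ρ₀)) • jet (fundTwo N p) ρ‖ ≤ U₂ * w (max ρ ρ₀) := by
    intro ρ hρ
    have h1 := hsrc ρ₀ (hge ρ₀ le_rfl) ρ hρ
    have h2 : ∀ Q : ℝ → ℝ, ∫ τ in ρ₀..ρ, Q τ * inhom (fEx p r β) 2 N (max τ ρ₀) =
        ∫ τ in ρ₀..ρ, Q τ * inhom (fEx p r β) 2 N τ := by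
      intro Q
      refine intervalIntegral.integral_congr fun τ hτ => ?_
      rw [uIcc_of_le hρ] at hτ
      simp only [max_eq_left hτ.1]
    simp only [max_eq_left hρ, h2]
    exact h1
  obtain ⟨η, hη2, hη0, hηb, hηode, hηint⟩ := hΦ.exists_perturbed_solution (ρ₀ := ρ₀) (U₁ := 1)
    (U₂ := U₂) (α₁ := α₁) (α₂ := α₂) (w := fun τ => w (max τ ρ₀))
    (g := fun τ => inhom (fEx p r β) 2 N (max τ ρ₀)) (G := G) hwc (fun τ => hwpos _ (hm τ))
    hℓc hℓ0 hIc hGc hG0 hGlip hhom hsource hsmall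
  have hηx : ∀ ρ ≥ ρ₀, |η ρ| ≤ R * w ρ := fun ρ hρ => by
    have h1 := hηb ρ hρ
    simp only [max_eq_left hρ] at h1
    exact (norm_fst_le (jet η ρ)).trans h1
  have hηy : ∀ ρ ≥ ρ₀, |deriv η ρ| ≤ R * w ρ := fun ρ hρ => by
    have h1 := hηb ρ hρ
    simp only [max_eq_left hρ] at h1
    exact (norm_snd_le (jet η ρ)).trans h1
  -- The a priori bound |η| ≤ R w makes the truncation inactive, so the original forcing is
  -- recovered.
  have hforce : ∀ ρ ≥ ρ₀, inhom (fEx p r β) 2 N (max ρ ρ₀) + G ρ (jet η ρ) =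
      forcing (fEx p r β) 2 N η ρ := by
    intro ρ hρ
    simp only [hG, max_eq_left hρ, jet, clamp_of_abs_le (hηx ρ hρ), forcing, nonlin_eq]
    ring
  have hinit : jet η ρ₀ = (A, B) := by
    rw [hη0]
    ext
    · simp only [jet, hα₁, hα₂, Prod.fst_add, Prod.smul_fst, smul_eq_mul]
      rw [div_mul_eq_mul_div, div_mul_eq_mul_div, ← add_div, div_eq_iff hWne, hW]
      ring
    · simp only [jet, hα₁, hα₂, Prod.snd_add, Prod.smul_snd, smul_eq_mul]
      rw [div_mul_eq_mul_div, div_mul_eq_mul_div, ← add_div, div_eq_iff hWne, hW]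
      ring
  refine ⟨η, ⟨hη2.contDiffOn, (hη2.of_le (by norm_num)).contDiffOn, congrArg Prod.fst hinit,
    ?_, ?_, ?_, ⟨α₁, α₂, ?_⟩⟩, ?_⟩
  · have hd : DifferentiableAt ℝ η ρ₀ := (hη2.differentiable (by norm_num)).differentiableAt
    rw [hd.derivWithin (uniqueDiffOn_Ici ρ₀ ρ₀ self_mem_Ici)]
    exact congrArg Prod.snd hinit
  · intro ρ hρ
    have h1 := (abs_le.1 ((hηx ρ hρ).trans (hRw ρ hρ))).1
    have h2 := hphi4 ρ hρ
    have h3 : phi (fEx p r β) 2 N ρ * (3 / 4) ≤ phi (fEx p r β) 2 N ρ * (1 + η ρ) :=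
      mul_le_mul_of_nonneg_left (by linarith) (by linarith)
    linarith
  · intro ρ hρ
    rw [pExp_fEx β hp hrp, ← hforce ρ hρ.le]
    exact hηode ρ hρ.le
  · intro ρ hρ
    rw [pExp_fEx β hp hrp, hηint ρ hρ, sub_eq_add_neg, ← intervalIntegral.integral_neg]
    congr 1
    refine intervalIntegral.integral_congr fun τ hτ => ?_
    rw [uIcc_of_le hρ] at hτ
    simp only [hforce τ hτ.1, varCoef₁, varCoef₂, kernelK, wronskian]
    ring
  · refine IsBigO.of_bound (2 * R) ?_
    filter_upwards [eventually_ge_atTop ρ₀] with ρ hρ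
    rw [Real.norm_of_nonneg (by positivity), Real.norm_of_nonneg (hwpos ρ hρ).le]
    linarith [hηx ρ hρ, hηy ρ hρ]

/-! ### Fundamental pairs and bounds for their kernels -/

/-- Decay of a fundamental pair and of the associated kernel. -/
structure HasKernelBound (Φ₁ Φ₂ : ℝ → ℝ) (j : ℕ) (Λ : ℝ) : Prop where
  pos : 0 < Λ
  jet₁ : ∃ M > 0, ∀ ρ ≥ 1, ‖jet Φ₁ ρ‖ ≤ M * (ρ ^ j * Real.exp (-Λ * ρ))
  jet₂ : ∃ M > 0, ∀ ρ ≥ 1, ‖jet Φ₂ ρ‖ ≤ M * (ρ ^ j * Real.exp (-Λ * ρ))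
  kernel : ∃ M > 0, ∀ τ, ∀ ρ ≥ τ,
    ‖varCoef₁ Φ₁ Φ₂ τ • jet Φ₁ ρ + varCoef₂ Φ₁ Φ₂ τ • jet Φ₂ ρ‖ ≤
      M * ((1 + (ρ - τ)) ^ j * Real.exp (-Λ * (ρ - τ)))

lemma hasDerivAt_exp_mul (x t : ℝ) :
    HasDerivAt (fun t => Real.exp (-x * t)) (-x * Real.exp (-x * t)) t := by
  have h1 : HasDerivAt (fun t : ℝ => -x * t) (-x) t := by
    simpa using (hasDerivAt_id t).const_mul (-x)
  exact h1.exp.congr_deriv (mul_comm _ _)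

lemma deriv_exp_mul (x : ℝ) :
    deriv (fun t => Real.exp (-x * t)) = fun t => -x * Real.exp (-x * t) :=
  funext fun t => (hasDerivAt_exp_mul x t).deriv

lemma exp_neg_mul_exp (x τ ρ : ℝ) :
    Real.exp (x * τ) * Real.exp (-x * ρ) = Real.exp (-x * (ρ - τ)) := by
  rw [← Real.exp_add]
  congr 1
  ring

/-! ### Two distinct real roots -/

section Real

variable {x y : ℝ}

lemma wronskian_exp (x y t : ℝ) :
    Real.exp (-x * t) * (-y * Real.exp (-y * t)) - -x * Real.exp (-x * t) * Real.exp (-y * t) =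
      (x - y) * (Real.exp (-x * t) * Real.exp (-y * t)) := by
  ring

lemma isFundamentalPair_exp (hxy : x ≠ y) :
    IsFundamentalPair (x + y) (x * y) (fun t => Real.exp (-x * t))
      (fun t => Real.exp (-y * t)) where
  hasDerivAt₁ t := by
    rw [deriv_exp_mul]
    exact hasDerivAt_exp_mul x t
  hasDerivAt₂ t := by
    rw [deriv_exp_mul]
    exact hasDerivAt_exp_mul y t
  hasDerivAt_deriv₁ t := by
    rw [deriv_exp_mul]
    refine ((hasDerivAt_exp_mul x t).const_mul (-x)).congr_deriv ?_
    ring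
  hasDerivAt_deriv₂ t := by
    rw [deriv_exp_mul]
    refine ((hasDerivAt_exp_mul y t).const_mul (-y)).congr_deriv ?_
    ring
  wronskian_ne t := by
    rw [deriv_exp_mul, deriv_exp_mul, wronskian_exp]
    exact mul_ne_zero (sub_ne_zero.2 hxy) (by positivity)

lemma norm_jet_exp_le (x t : ℝ) :
    ‖jet (fun t => Real.exp (-x * t)) t‖ ≤ (1 + |x|) * Real.exp (-x * t) := by
  have h := Real.exp_pos (-x * t)
  rw [jet, deriv_exp_mul, Prod.norm_def, Real.norm_of_nonneg h.le, norm_mul, norm_neg,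
    Real.norm_of_nonneg h.le, Real.norm_eq_abs]
  have := abs_nonneg x
  refine max_le ?_ ?_ <;> nlinarith

lemma varCoef₁_exp (x y t : ℝ) :
    varCoef₁ (fun t => Real.exp (-x * t)) (fun t => Real.exp (-y * t)) t =
      (x - y)⁻¹ * Real.exp (x * t) := by
  rw [varCoef₁, deriv_exp_mul, deriv_exp_mul]
  beta_reduce
  rw [wronskian_exp, neg_mul x t, Real.exp_neg (x * t)]
  have := Real.exp_pos (-y * t)
  have := Real.exp_pos (x * t)
  field_simp

lemma varCoef₂_exp (x y t : ℝ) :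
    varCoef₂ (fun t => Real.exp (-x * t)) (fun t => Real.exp (-y * t)) t =
      -(x - y)⁻¹ * Real.exp (y * t) := by
  rw [varCoef₂, deriv_exp_mul, deriv_exp_mul]
  beta_reduce
  rw [wronskian_exp, neg_mul y t, Real.exp_neg (y * t)]
  have := Real.exp_pos (-x * t)
  have := Real.exp_pos (y * t)
  field_simp

lemma hasKernelBound_exp (hx : 0 < x) (hxy : x < y) :
    HasKernelBound (fun t => Real.exp (-x * t)) (fun t => Real.exp (-y * t)) 0 x where
  pos := hx
  jet₁ := ⟨1 + |x|, by positivity, fun ρ _ => by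
    rw [pow_zero, one_mul]
    exact norm_jet_exp_le x ρ⟩
  jet₂ := ⟨1 + |y|, by positivity, fun ρ hρ => by
    rw [pow_zero, one_mul]
    refine (norm_jet_exp_le y ρ).trans ?_
    gcongr⟩
  kernel := by
    have hd : 0 < |x - y| := abs_pos.2 (sub_ne_zero.2 hxy.ne)
    refine ⟨|x - y|⁻¹ * (1 + |x|) + |x - y|⁻¹ * (1 + |y|), by positivity, fun τ ρ hρ => ?_⟩
    rw [pow_zero, one_mul, varCoef₁_exp, varCoef₂_exp]
    refine (norm_add_le _ _).trans ?_
    rw [norm_smul, norm_smul, norm_mul, norm_mul, norm_neg, norm_inv,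
      Real.norm_of_nonneg (Real.exp_pos _).le, Real.norm_of_nonneg (Real.exp_pos _).le,
      Real.norm_eq_abs]
    calc _ ≤ |x - y|⁻¹ * Real.exp (x * τ) * ((1 + |x|) * Real.exp (-x * ρ)) +
          |x - y|⁻¹ * Real.exp (y * τ) * ((1 + |y|) * Real.exp (-y * ρ)) := by
          gcongr
          · exact norm_jet_exp_le x ρ
          · exact norm_jet_exp_le y ρ
      _ = |x - y|⁻¹ * (1 + |x|) * (Real.exp (x * τ) * Real.exp (-x * ρ)) +
          |x - y|⁻¹ * (1 + |y|) * (Real.exp (y * τ) * Real.exp (-y * ρ)) := by ring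
      -- Since ρ ≥ τ, the faster exponential is dominated by the slower one.
      _ ≤ |x - y|⁻¹ * (1 + |x|) * Real.exp (-x * (ρ - τ)) +
          |x - y|⁻¹ * (1 + |y|) * Real.exp (-x * (ρ - τ)) := by
          rw [exp_neg_mul_exp, exp_neg_mul_exp]
          gcongr
      _ = _ := by ring

end Real

/-! ### A double root -/

section Double

lemma hasDerivAt_mul_exp (x t : ℝ) :
    HasDerivAt (fun t => t * Real.exp (-x * t)) ((1 - x * t) * Real.exp (-x * t)) t := by
  refine ((hasDerivAt_id t).mul (hasDerivAt_exp_mul x t)).congr_deriv ?_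
  simp only [id]
  ring

lemma deriv_mul_exp (x : ℝ) :
    deriv (fun t => t * Real.exp (-x * t)) = fun t => (1 - x * t) * Real.exp (-x * t) :=
  funext fun t => (hasDerivAt_mul_exp x t).deriv

lemma wronskian_double (x t : ℝ) :
    Real.exp (-x * t) * ((1 - x * t) * Real.exp (-x * t)) -
      -x * Real.exp (-x * t) * (t * Real.exp (-x * t)) =
      Real.exp (-x * t) * Real.exp (-x * t) := by
  ring

lemma isFundamentalPair_double (x : ℝ) :
    IsFundamentalPair (x + x) (x * x) (fun t => Real.exp (-x * t))
      (fun t => t * Real.exp (-x * t)) where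
  hasDerivAt₁ t := by
    rw [deriv_exp_mul]
    exact hasDerivAt_exp_mul x t
  hasDerivAt₂ t := by
    rw [deriv_mul_exp]
    exact hasDerivAt_mul_exp x t
  hasDerivAt_deriv₁ t := by
    rw [deriv_exp_mul]
    refine ((hasDerivAt_exp_mul x t).const_mul (-x)).congr_deriv ?_
    ring
  hasDerivAt_deriv₂ t := by
    rw [deriv_mul_exp]
    have h1 : HasDerivAt (fun t : ℝ => 1 - x * t) (-x) t := by
      simpa using ((hasDerivAt_id t).const_mul x).const_sub 1
    refine (h1.mul (hasDerivAt_exp_mul x t)).congr_deriv ?_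
    ring
  wronskian_ne t := by
    rw [deriv_exp_mul, deriv_mul_exp, wronskian_double]
    positivity

lemma varCoef₁_double (x t : ℝ) :
    varCoef₁ (fun t => Real.exp (-x * t)) (fun t => t * Real.exp (-x * t)) t =
      t * Real.exp (x * t) := by
  rw [varCoef₁, deriv_exp_mul, deriv_mul_exp]
  beta_reduce
  rw [wronskian_double, neg_mul x t, Real.exp_neg (x * t)]
  have := Real.exp_pos (x * t)
  field_simp

lemma varCoef₂_double (x t : ℝ) :
    varCoef₂ (fun t => Real.exp (-x * t)) (fun t => t * Real.exp (-x * t)) t =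
      -Real.exp (x * t) := by
  rw [varCoef₂, deriv_exp_mul, deriv_mul_exp]
  beta_reduce
  rw [wronskian_double, neg_mul x t, Real.exp_neg (x * t)]
  have := Real.exp_pos (x * t)
  field_simp

lemma hasKernelBound_double {x : ℝ} (hx : 0 < x) :
    HasKernelBound (fun t => Real.exp (-x * t)) (fun t => t * Real.exp (-x * t)) 1 x where
  pos := hx
  jet₁ := ⟨1 + |x|, by positivity, fun ρ hρ => by
    refine (norm_jet_exp_le x ρ).trans ?_
    rw [pow_one]
    gcongr
    exact le_mul_of_one_le_left (Real.exp_pos _).le hρ⟩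
  jet₂ := ⟨1 + x, by positivity, fun ρ hρ => by
    have h := Real.exp_pos (-x * ρ)
    have hρ0 : 0 < ρ := by linarith
    rw [jet, deriv_mul_exp, pow_one, Prod.norm_def, norm_mul, norm_mul, Real.norm_of_nonneg h.le,
      Real.norm_of_nonneg hρ0.le, Real.norm_eq_abs, ← mul_assoc]
    have h1 : |1 - x * ρ| ≤ (1 + x) * ρ := by
      rw [abs_le]
      constructor <;> nlinarith
    refine max_le ?_ ?_
    · gcongr
      nlinarith
    · gcongr⟩
  kernel := by
    refine ⟨1 + x, by positivity, fun τ ρ hρ => ?_⟩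
    -- The terms in τ and ρ combine into ρ-τ; bounding the two products separately would leave a
    -- factor growing with τ even at ρ = τ.
    have e : varCoef₁ (fun t => Real.exp (-x * t)) (fun t => t * Real.exp (-x * t)) τ •
        jet (fun t => Real.exp (-x * t)) ρ +
        varCoef₂ (fun t => Real.exp (-x * t)) (fun t => t * Real.exp (-x * t)) τ •
        jet (fun t => t * Real.exp (-x * t)) ρ =
        (-(ρ - τ) * Real.exp (-x * (ρ - τ)), (x * (ρ - τ) - 1) * Real.exp (-x * (ρ - τ))) := by
      rw [varCoef₁_double, varCoef₂_double, jet, jet, deriv_exp_mul, deriv_mul_exp,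
        ← exp_neg_mul_exp]
      ext
      · simp only [Prod.fst_add, Prod.smul_fst, smul_eq_mul]
        ring
      · simp only [Prod.snd_add, Prod.smul_snd, smul_eq_mul]
        ring
    have h := Real.exp_pos (-x * (ρ - τ))
    have ht : 0 ≤ ρ - τ := sub_nonneg.2 hρ
    rw [e, pow_one, Prod.norm_def, norm_mul, norm_mul, Real.norm_of_nonneg h.le, norm_neg,
      Real.norm_of_nonneg ht, Real.norm_eq_abs, ← mul_assoc]
    have h1 : |x * (ρ - τ) - 1| ≤ (1 + x) * (1 + (ρ - τ)) := by
      rw [abs_le]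
      constructor <;> nlinarith
    refine max_le ?_ ?_
    · gcongr
      nlinarith
    · gcongr

end Double

/-! ### Complex conjugate roots -/

section Complex

lemma hasDerivAt_exp_cos (c k t : ℝ) :
    HasDerivAt (fun t => Real.exp (-c * t) * Real.cos (k * t))
      (-c * (Real.exp (-c * t) * Real.cos (k * t)) -
        k * (Real.exp (-c * t) * Real.sin (k * t))) t := by
  have h1 : HasDerivAt (fun t : ℝ => k * t) k t := by
    simpa using (hasDerivAt_id t).const_mul k
  refine ((hasDerivAt_exp_mul c t).mul h1.cos).congr_deriv ?_
  ring

lemma hasDerivAt_exp_sin (c k t : ℝ) :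
    HasDerivAt (fun t => Real.exp (-c * t) * Real.sin (k * t))
      (-c * (Real.exp (-c * t) * Real.sin (k * t)) +
        k * (Real.exp (-c * t) * Real.cos (k * t))) t := by
  have h1 : HasDerivAt (fun t : ℝ => k * t) k t := by
    simpa using (hasDerivAt_id t).const_mul k
  refine ((hasDerivAt_exp_mul c t).mul h1.sin).congr_deriv ?_
  ring

lemma deriv_exp_cos (c k : ℝ) :
    deriv (fun t => Real.exp (-c * t) * Real.cos (k * t)) = fun t =>
      -c * (Real.exp (-c * t) * Real.cos (k * t)) -
        k * (Real.exp (-c * t) * Real.sin (k * t)) :=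
  funext fun t => (hasDerivAt_exp_cos c k t).deriv

lemma deriv_exp_sin (c k : ℝ) :
    deriv (fun t => Real.exp (-c * t) * Real.sin (k * t)) = fun t =>
      -c * (Real.exp (-c * t) * Real.sin (k * t)) +
        k * (Real.exp (-c * t) * Real.cos (k * t)) :=
  funext fun t => (hasDerivAt_exp_sin c k t).deriv

lemma wronskian_complex (c k t : ℝ) :
    Real.exp (-c * t) * Real.cos (k * t) *
      (-c * (Real.exp (-c * t) * Real.sin (k * t)) +
        k * (Real.exp (-c * t) * Real.cos (k * t))) -
      (-c * (Real.exp (-c * t) * Real.cos (k * t)) -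
        k * (Real.exp (-c * t) * Real.sin (k * t))) * (Real.exp (-c * t) * Real.sin (k * t)) =
      k * (Real.exp (-c * t) * Real.exp (-c * t)) := by
  linear_combination k * (Real.exp (-c * t) * Real.exp (-c * t)) * Real.sin_sq_add_cos_sq (k * t)

lemma isFundamentalPair_complex (c : ℝ) {k : ℝ} (hk : k ≠ 0) :
    IsFundamentalPair (c + c) (c * c + k * k) (fun t => Real.exp (-c * t) * Real.cos (k * t))
      (fun t => Real.exp (-c * t) * Real.sin (k * t)) where
  hasDerivAt₁ t := by
    rw [deriv_exp_cos]
    exact hasDerivAt_exp_cos c k t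
  hasDerivAt₂ t := by
    rw [deriv_exp_sin]
    exact hasDerivAt_exp_sin c k t
  hasDerivAt_deriv₁ t := by
    rw [deriv_exp_cos]
    refine (((hasDerivAt_exp_cos c k t).const_mul (-c)).sub
      ((hasDerivAt_exp_sin c k t).const_mul k)).congr_deriv ?_
    ring
  hasDerivAt_deriv₂ t := by
    rw [deriv_exp_sin]
    refine (((hasDerivAt_exp_sin c k t).const_mul (-c)).add
      ((hasDerivAt_exp_cos c k t).const_mul k)).congr_deriv ?_
    ring
  wronskian_ne t := by
    rw [deriv_exp_cos, deriv_exp_sin, wronskian_complex]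
    exact mul_ne_zero hk (by positivity)

lemma norm_jet_exp_cos_le (c k t : ℝ) :
    ‖jet (fun t => Real.exp (-c * t) * Real.cos (k * t)) t‖ ≤
      (1 + |c| + |k|) * Real.exp (-c * t) := by
  have h := Real.exp_pos (-c * t)
  have hc := Real.abs_cos_le_one (k * t)
  have hs := Real.abs_sin_le_one (k * t)
  rw [jet, deriv_exp_cos, Prod.norm_def, Real.norm_eq_abs, Real.norm_eq_abs]
  refine max_le ?_ ((abs_sub _ _).trans ?_)
  · rw [abs_mul, abs_of_pos h, mul_comm]
    gcongr
    linarith [abs_nonneg c, abs_nonneg k]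
  · rw [abs_mul, abs_mul, abs_mul, abs_mul, abs_neg, abs_of_pos h]
    calc _ ≤ |c| * (Real.exp (-c * t) * 1) + |k| * (Real.exp (-c * t) * 1) := by gcongr
      _ ≤ _ := by nlinarith

lemma norm_jet_exp_sin_le (c k t : ℝ) :
    ‖jet (fun t => Real.exp (-c * t) * Real.sin (k * t)) t‖ ≤
      (1 + |c| + |k|) * Real.exp (-c * t) := by
  have h := Real.exp_pos (-c * t)
  have hc := Real.abs_cos_le_one (k * t)
  have hs := Real.abs_sin_le_one (k * t)
  rw [jet, deriv_exp_sin, Prod.norm_def, Real.norm_eq_abs, Real.norm_eq_abs]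
  refine max_le ?_ ((abs_add_le _ _).trans ?_)
  · rw [abs_mul, abs_of_pos h, mul_comm]
    gcongr
    linarith [abs_nonneg c, abs_nonneg k]
  · rw [abs_mul, abs_mul, abs_mul, abs_mul, abs_neg, abs_of_pos h]
    calc _ ≤ |c| * (Real.exp (-c * t) * 1) + |k| * (Real.exp (-c * t) * 1) := by gcongr
      _ ≤ _ := by nlinarith

lemma varCoef₁_complex (c k t : ℝ) :
    varCoef₁ (fun t => Real.exp (-c * t) * Real.cos (k * t))
      (fun t => Real.exp (-c * t) * Real.sin (k * t)) t =
      k⁻¹ * Real.sin (k * t) * Real.exp (c * t) := by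
  rw [varCoef₁, deriv_exp_cos, deriv_exp_sin]
  beta_reduce
  rw [wronskian_complex, neg_mul c t, Real.exp_neg (c * t)]
  have := Real.exp_pos (c * t)
  field_simp

lemma varCoef₂_complex (c k t : ℝ) :
    varCoef₂ (fun t => Real.exp (-c * t) * Real.cos (k * t))
      (fun t => Real.exp (-c * t) * Real.sin (k * t)) t =
      -k⁻¹ * Real.cos (k * t) * Real.exp (c * t) := by
  rw [varCoef₂, deriv_exp_cos, deriv_exp_sin]
  beta_reduce
  rw [wronskian_complex, neg_mul c t, Real.exp_neg (c * t)]
  have := Real.exp_pos (c * t)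
  field_simp

lemma hasKernelBound_complex {c k : ℝ} (hc : 0 < c) (hk : 0 < k) :
    HasKernelBound (fun t => Real.exp (-c * t) * Real.cos (k * t))
      (fun t => Real.exp (-c * t) * Real.sin (k * t)) 0 c where
  pos := hc
  jet₁ := ⟨1 + |c| + |k|, by positivity, fun ρ _ => by
    rw [pow_zero, one_mul]
    exact norm_jet_exp_cos_le c k ρ⟩
  jet₂ := ⟨1 + |c| + |k|, by positivity, fun ρ _ => by
    rw [pow_zero, one_mul]
    exact norm_jet_exp_sin_le c k ρ⟩
  kernel := by
    refine ⟨2 * k⁻¹ * (1 + |c| + |k|), by positivity, fun τ ρ hρ => ?_⟩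
    rw [pow_zero, one_mul, varCoef₁_complex, varCoef₂_complex, ← exp_neg_mul_exp]
    refine (norm_add_le _ _).trans ?_
    have h1 := Real.abs_cos_le_one (k * τ)
    have h2 := Real.abs_sin_le_one (k * τ)
    rw [norm_smul, norm_smul, norm_mul, norm_mul, norm_mul, norm_mul, norm_neg, norm_inv,
      Real.norm_of_nonneg (Real.exp_pos _).le, Real.norm_of_nonneg hk.le, Real.norm_eq_abs,
      Real.norm_eq_abs]
    calc _ ≤ k⁻¹ * 1 * Real.exp (c * τ) * ((1 + |c| + |k|) * Real.exp (-c * ρ)) +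
          k⁻¹ * 1 * Real.exp (c * τ) * ((1 + |c| + |k|) * Real.exp (-c * ρ)) := by
          gcongr
          · exact norm_jet_exp_cos_le c k ρ
          · exact norm_jet_exp_sin_le c k ρ
      _ = _ := by ring

end Complex

/-! ### The position of `p` relative to the critical exponents -/

section Exponents

variable {N : ℕ} {p : ℝ}

lemma aCoef_pos (hN : 3 ≤ N) (hp : 1 < p) (hpS : p < pSob N) : 0 < aCoef N p := by
  have hN' : (3 : ℝ) ≤ N := by exact_mod_cast hN
  rw [pSob, lt_div_iff₀ (by linarith)] at hpS
  have hp1 : 0 < p - 1 := by linarith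
  have e : aCoef N p = ((N + 2) - p * (N - 2)) / (p - 1) := by
    unfold aCoef
    field_simp
    ring
  rw [e]
  exact div_pos (by linarith) hp1

lemma discr_eq (hp : 1 < p) : discr N p = aCoef N p ^ 2 - 4 * bCoef N (p / (p - 1)) := by
  have hp1 : p - 1 ≠ 0 := by linarith
  unfold discr aCoef bCoef
  field_simp
  ring

/-- The value `2 / (p_* - 1)`. -/
noncomputable def mStar (N : ℕ) : ℝ := ((N : ℝ) - 4 + 2 * √((N : ℝ) - 1)) / 2

lemma sqrt_sub_one_gt_one (hN : 3 ≤ N) : 1 < √((N : ℝ) - 1) := by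
  have hN' : (3 : ℝ) ≤ N := by exact_mod_cast hN
  rw [Real.lt_sqrt (by norm_num)]
  linarith

lemma mStar_pos (hN : 3 ≤ N) : 0 < mStar N := by
  have hN' : (3 : ℝ) ≤ N := by exact_mod_cast hN
  have := sqrt_sub_one_gt_one hN
  unfold mStar
  linarith

lemma pStar_eq : pStar N = 1 + 2 / mStar N := by
  unfold pStar mStar
  rw [div_div_eq_mul_div]
  norm_num

lemma lt_pStar_iff (hN : 3 ≤ N) (hp : 1 < p) : p < pStar N ↔ mStar N < 2 / (p - 1) := by
  have hm := mStar_pos hN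
  have hp1 : 0 < p - 1 := by linarith
  rw [pStar_eq, ← sub_lt_iff_lt_add', lt_div_iff₀ hm, lt_div_iff₀ hp1, mul_comm]

lemma pStar_lt_iff (hN : 3 ≤ N) (hp : 1 < p) : pStar N < p ↔ 2 / (p - 1) < mStar N := by
  have hm := mStar_pos hN
  have hp1 : 0 < p - 1 := by linarith
  rw [pStar_eq, ← lt_sub_iff_add_lt', div_lt_iff₀ hm, div_lt_iff₀ hp1, mul_comm]

/-- As a polynomial in m = 2/(p-1), the discriminant has roots (N-4)/2 ± √(N-1), and the larger one
corresponds to p_*. -/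
lemma discr_factor (hN : 3 ≤ N) (p : ℝ) :
    discr N p = 4 * ((2 / (p - 1) - mStar N) *
      (2 / (p - 1) - ((N : ℝ) - 4 - 2 * √((N : ℝ) - 1)) / 2)) := by
  have hN' : (3 : ℝ) ≤ N := by exact_mod_cast hN
  have hs : √((N : ℝ) - 1) ^ 2 = N - 1 := Real.sq_sqrt (by linarith)
  unfold discr mStar
  linear_combination 4 * hs

/-- Below p_S one has a > 0, that is m > (N-2)/2, which already exceeds the smaller root. So only
the position relative to p_* decides the sign of the discriminant. -/
lemma other_root_lt (hN : 3 ≤ N) (hp : 1 < p) (hpS : p < pSob N) :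
    0 < 2 / (p - 1) - ((N : ℝ) - 4 - 2 * √((N : ℝ) - 1)) / 2 := by
  have h1 := aCoef_pos hN hp hpS
  have h2 := sqrt_sub_one_gt_one hN
  unfold aCoef at h1
  have e : 4 / (p - 1) = 2 * (2 / (p - 1)) := by ring
  rw [e] at h1
  linarith

lemma discr_pos (hN : 3 ≤ N) (hp : 1 < p) (hpS : p < pSob N) (h : p < pStar N) :
    0 < discr N p := by
  rw [discr_factor hN]
  have h1 := other_root_lt hN hp hpS
  have h2 := sub_pos.2 ((lt_pStar_iff hN hp).1 h)
  positivity

lemma discr_neg (hN : 3 ≤ N) (hp : 1 < p) (hpS : p < pSob N) (h : pStar N < p) :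
    discr N p < 0 := by
  rw [discr_factor hN]
  have h1 := other_root_lt hN hp hpS
  have h2 := sub_neg.2 ((pStar_lt_iff hN hp).1 h)
  have := mul_neg_of_neg_of_pos h2 h1
  linarith

lemma discr_pStar (hN : 3 ≤ N) : discr N (pStar N) = 0 := by
  have hm := (mStar_pos hN).ne'
  rw [discr_factor hN, pStar_eq, add_sub_cancel_left, div_div_cancel₀ (by norm_num)]
  ring

lemma lambdaOne_eq : lambdaOne N p = (aCoef N p - √(discr N p)) / 2 := by
  unfold lambdaOne aCoef
  ring

lemma lambdaTwo_eq : lambdaTwo N p = (aCoef N p + √(discr N p)) / 2 := by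
  unfold lambdaTwo aCoef
  ring

lemma lambdaStar_eq : lambdaStar N = aCoef N (pStar N) / 2 := by
  unfold lambdaStar aCoef
  ring

/-- The exponent of the polynomial factor due to a double root. -/
noncomputable def resExp (N : ℕ) (p : ℝ) : ℕ := open Classical in if p = pStar N then 1 else 0

lemma isFundamentalPair_and_hasKernelBound (hN : 3 ≤ N) (hp : 1 < p) (hpc : pCrit N < p)
    (hpS : p < pSob N) :
    IsFundamentalPair (aCoef N p) (bCoef N (p / (p - 1))) (fundOne N p) (fundTwo N p) ∧
      HasKernelBound (fundOne N p) (fundTwo N p) (resExp N p) (bigLambda N p) := by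
  have ha := aCoef_pos hN hp hpS
  have hb := bCoef_pos hp hN hpc
  have hD := discr_eq (N := N) hp
  rcases lt_trichotomy p (pStar N) with h | h | h
  · have e₁ : fundOne N p = fun t => Real.exp (-lambdaOne N p * t) :=
      funext fun t => by simp [fundOne, h]
    have e₂ : fundTwo N p = fun t => Real.exp (-lambdaTwo N p * t) :=
      funext fun t => by simp [fundTwo, h]
    have e₃ : bigLambda N p = lambdaOne N p := by simp [bigLambda, h]
    have e₄ : resExp N p = 0 := by simp [resExp, h.ne]
    have hD0 := discr_pos hN hp hpS h
    have hs := Real.sqrt_pos.2 hD0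
    have hs2 := Real.sq_sqrt hD0.le
    have hlt : lambdaOne N p < lambdaTwo N p := by
      rw [lambdaOne_eq, lambdaTwo_eq]
      linarith
    have hpos : 0 < lambdaOne N p := by
      rw [lambdaOne_eq]
      -- This is b > 0, that is p > p_c, because the discriminant is a² - 4b.
      have : √(discr N p) < aCoef N p := by
        rw [Real.sqrt_lt' ha]
        linarith
      linarith
    have hsum : aCoef N p = lambdaOne N p + lambdaTwo N p := by
      rw [lambdaOne_eq, lambdaTwo_eq]
      ring
    have hprod : bCoef N (p / (p - 1)) = lambdaOne N p * lambdaTwo N p := by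
      rw [lambdaOne_eq, lambdaTwo_eq]
      linear_combination (1 / 4) * hs2 + (1 / 4) * hD
    rw [e₁, e₂, e₃, e₄, hsum, hprod]
    exact ⟨isFundamentalPair_exp hlt.ne, hasKernelBound_exp hpos hlt⟩
  · have e₁ : fundOne N p = fun t => Real.exp (-lambdaStar N * t) :=
      funext fun t => by simp [fundOne, h]
    have e₂ : fundTwo N p = fun t => t * Real.exp (-lambdaStar N * t) :=
      funext fun t => by simp [fundTwo, h]
    have e₃ : bigLambda N p = lambdaStar N := by simp [bigLambda, h]
    have e₄ : resExp N p = 1 := by simp [resExp, h]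
    have hD0 : discr N p = 0 := by
      rw [h]
      exact discr_pStar hN
    have hl : lambdaStar N = aCoef N p / 2 := by rw [lambdaStar_eq, ← h]
    have hsum : aCoef N p = lambdaStar N + lambdaStar N := by
      rw [hl]
      ring
    have hprod : bCoef N (p / (p - 1)) = lambdaStar N * lambdaStar N := by
      rw [hl]
      linear_combination (1 / 4) * hD - (1 / 4) * hD0
    rw [e₁, e₂, e₃, e₄, hprod, hsum]
    exact ⟨isFundamentalPair_double _, hasKernelBound_double (by rw [hl]; positivity)⟩
  · have e₁ : fundOne N p = fun t => Real.exp (-(aCoef N p / 2) * t) * Real.cos (freq N p * t) :=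
      funext fun t => by simp [fundOne, h.ne', h.not_gt]
    have e₂ : fundTwo N p = fun t => Real.exp (-(aCoef N p / 2) * t) * Real.sin (freq N p * t) :=
      funext fun t => by simp [fundTwo, h.ne', h.not_gt]
    have e₃ : bigLambda N p = aCoef N p / 2 := by simp [bigLambda, h.ne', h.not_gt]
    have e₄ : resExp N p = 0 := by simp [resExp, h.ne']
    have hD0 := discr_neg hN hp hpS h
    have hk : 0 < freq N p := by
      have := Real.sqrt_pos.2 (neg_pos.2 hD0)
      unfold freq
      positivity
    have hs2 := Real.sq_sqrt (neg_pos.2 hD0).le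
    have hprod : bCoef N (p / (p - 1)) =
        aCoef N p / 2 * (aCoef N p / 2) + freq N p * freq N p := by
      unfold freq
      linear_combination (1 / 4) * hD - (1 / 4) * hs2
    refine ⟨?_, ?_⟩
    · rw [e₁, e₂, hprod]
      have := isFundamentalPair_complex (aCoef N p / 2) hk.ne'
      rwa [add_halves] at this
    · rw [e₁, e₂, e₃, e₄]
      exact hasKernelBound_complex (by positivity) hk

end Exponents

/-! ### Admissible weights -/

lemma exists_rpow_le_exp (d : ℝ) {δ : ℝ} (hδ : 0 < δ) :
    ∃ C > 0, ∀ x ≥ 1, x ^ d ≤ C * Real.exp (δ * x) := by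
  set n := ⌈d⌉₊
  refine ⟨n.factorial / δ ^ n, by positivity, fun x hx => ?_⟩
  have h0 : 0 < x := by linarith
  have h1 : x ^ d ≤ x ^ n := by
    rw [← Real.rpow_natCast]
    exact Real.rpow_le_rpow_of_exponent_le hx (Nat.le_ceil d)
  have h2 := Real.pow_div_factorial_le_exp (δ * x) (by positivity) n
  refine h1.trans ?_
  rw [mul_pow, div_le_iff₀ (by positivity)] at h2
  rw [div_mul_eq_mul_div, le_div_iff₀ (by positivity)]
  linarith

/-- For β < 0 it reduces to ρ/τ ≤ 1 + (ρ-τ), whose defect times τ is (τ-1)(ρ-τ) ≥ 0. It lets a power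
weight be moved from τ to ρ at the cost of a power of the distance. -/
lemma rpow_le_rpow_mul {β τ ρ : ℝ} (hτ : 1 ≤ τ) (hρ : τ ≤ ρ) :
    τ ^ β ≤ (1 + (ρ - τ)) ^ |β| * ρ ^ β := by
  have hτ0 : 0 < τ := by linarith
  have hρ0 : 0 < ρ := by linarith
  have ht : 1 ≤ 1 + (ρ - τ) := by linarith
  rcases le_total 0 β with h | h
  · have h1 : τ ^ β ≤ ρ ^ β := Real.rpow_le_rpow hτ0.le hρ h
    exact h1.trans (le_mul_of_one_le_left (by positivity)
      (Real.one_le_rpow ht (abs_nonneg β)))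
  · rw [abs_of_nonpos h]
    have h1 : (ρ / τ) ^ (-β) ≤ (1 + (ρ - τ)) ^ (-β) := by
      refine Real.rpow_le_rpow (by positivity) ?_ (by linarith)
      rw [div_le_iff₀ hτ0]
      nlinarith
    rw [Real.div_rpow hρ0.le hτ0.le, Real.rpow_neg hρ0.le, Real.rpow_neg hτ0.le] at h1
    have h2 := Real.rpow_pos_of_pos hρ0 β
    have h3 := Real.rpow_pos_of_pos hτ0 β
    calc τ ^ β = (ρ ^ β)⁻¹ / (τ ^ β)⁻¹ * ρ ^ β := by field_simp
      _ ≤ _ := by gcongr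

section Source

variable {a b : ℝ} {Φ₁ Φ₂ g : ℝ → ℝ}

/-- Only continuity on a half-line is known for g, so g is frozen to the left of ρ₀ before the two
integrals are merged. -/
lemma norm_source_le (hΦ : IsFundamentalPair a b Φ₁ Φ₂) {k : ℝ → ℝ} {ρ₀ ρ : ℝ}
    (hg : ContinuousOn g (Ici ρ₀)) (hρ : ρ₀ ≤ ρ) (hk : Continuous k)
    (hle : ∀ τ ∈ Icc ρ₀ ρ,
      ‖varCoef₁ Φ₁ Φ₂ τ • jet Φ₁ ρ + varCoef₂ Φ₁ Φ₂ τ • jet Φ₂ ρ‖ * |g τ| ≤ k τ) :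
    ‖(∫ τ in ρ₀..ρ, varCoef₁ Φ₁ Φ₂ τ * g τ) • jet Φ₁ ρ +
      (∫ τ in ρ₀..ρ, varCoef₂ Φ₁ Φ₂ τ * g τ) • jet Φ₂ ρ‖ ≤ ∫ τ in ρ₀..ρ, k τ := by
  have hmc : Continuous fun τ : ℝ => max τ ρ₀ := continuous_id.max continuous_const
  have hgc : Continuous fun τ => g (max τ ρ₀) :=
    hg.comp_continuous hmc fun τ => mem_Ici.2 (le_max_right _ _)
  have h2 : ∀ Q : ℝ → ℝ, ∫ τ in ρ₀..ρ, Q τ * g τ = ∫ τ in ρ₀..ρ, Q τ * g (max τ ρ₀) := by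
    intro Q
    refine intervalIntegral.integral_congr fun τ hτ => ?_
    rw [uIcc_of_le hρ] at hτ
    simp only [max_eq_left hτ.1]
  rw [h2, h2, integral_smul_add_integral_smul hΦ.continuous_varCoef₁ hΦ.continuous_varCoef₂ hgc]
  refine intervalIntegral.norm_integral_le_of_norm_le hρ ?_ (hk.intervalIntegrable _ _)
  refine Eventually.of_forall fun τ hτ => ?_
  rw [max_eq_left hτ.1.le, norm_smul, mul_comm, Real.norm_eq_abs]
  exact hle τ ⟨hτ.1.le, hτ.2⟩

end Source

section Weights

variable {a b Λ : ℝ} {j : ℕ} {Φ₁ Φ₂ g : ℝ → ℝ}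

/-- Weights `ρ^j v(ρ) e^{-Λρ}` at or below the decay rate of the linear equation. -/
lemma isAdmissibleWeight_of_monotone (hK : HasKernelBound Φ₁ Φ₂ j Λ) {v : ℝ → ℝ} {ρ₁ d : ℝ}
    (hρ₁ : 1 ≤ ρ₁) (hvc : ContinuousOn v (Ici ρ₁)) (hvm : MonotoneOn v (Ici ρ₁))
    (hv1 : ∀ ρ ≥ ρ₁, 1 ≤ v ρ) (hvd : v =O[atTop] fun ρ => ρ ^ d)
    (hsrc : ∃ C > 0, ∀ ρ₀ ≥ ρ₁, ∀ ρ ≥ ρ₀,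
      ‖(∫ τ in ρ₀..ρ, varCoef₁ Φ₁ Φ₂ τ * g τ) • jet Φ₁ ρ +
        (∫ τ in ρ₀..ρ, varCoef₂ Φ₁ Φ₂ τ * g τ) • jet Φ₂ ρ‖ ≤
        C * (ρ ^ j * v ρ * Real.exp (-Λ * ρ))) :
    IsAdmissibleWeight Φ₁ Φ₂ g (fun ρ => ρ ^ j * v ρ * Real.exp (-Λ * ρ)) ρ₁ := by
  have hjet : ∀ Φ : ℝ → ℝ, (∃ M > 0, ∀ ρ ≥ 1, ‖jet Φ ρ‖ ≤ M * (ρ ^ j * Real.exp (-Λ * ρ))) →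
      ∃ C > 0, ∀ ρ ≥ ρ₁, ‖jet Φ ρ‖ ≤ C * (ρ ^ j * v ρ * Real.exp (-Λ * ρ)) := by
    rintro Φ ⟨M, hM, h⟩
    refine ⟨M, hM, fun ρ hρ => (h ρ (hρ₁.trans hρ)).trans ?_⟩
    have h0 : 0 < ρ := by linarith
    gcongr
    exact le_mul_of_one_le_right (by positivity) (hv1 ρ hρ)
  refine ⟨?_, ?_, ?_, ?_, hjet Φ₁ hK.jet₁, hjet Φ₂ hK.jet₂, hsrc⟩
  · exact ((continuous_pow j).continuousOn.mul hvc).mul (by fun_prop)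
  · intro ρ hρ
    have h0 : 0 < ρ := by linarith
    have := hv1 ρ hρ
    positivity
  · have hΛ := hK.pos
    refine ⟨Λ / 2, half_pos hΛ, ?_⟩
    have h1 : (fun ρ : ℝ => ρ ^ j * v ρ) =O[atTop] fun ρ => ρ ^ ((j : ℝ) + d) := by
      refine ((isBigO_refl (fun ρ : ℝ => ρ ^ j) atTop).mul hvd).trans_eventuallyEq ?_
      filter_upwards [eventually_gt_atTop 0] with ρ hρ
      rw [Real.rpow_add hρ, Real.rpow_natCast]
    have h2 := (h1.trans (isLittleO_rpow_exp_pos_mul_atTop _ (half_pos hΛ)).isBigO).mul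
      (isBigO_refl (fun ρ : ℝ => Real.exp (-Λ * ρ)) atTop)
    refine h2.congr_right fun ρ => ?_
    rw [← Real.exp_add]
    congr 1
    ring
  · intro ν hν
    obtain ⟨M, hM, hker⟩ := hK.kernel
    obtain ⟨C, hC, hpow⟩ := exists_rpow_le_exp (j : ℝ) hν
    refine ⟨M * C, by positivity, fun τ hτ ρ hρ => ?_⟩
    have hτ1 : 1 ≤ τ := hρ₁.trans hτ
    have hp := hpow τ hτ1
    rw [Real.rpow_natCast] at hp
    have hv := hvm hτ (show ρ ∈ Ici ρ₁ from le_trans hτ hρ) hρ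
    have hvτ := hv1 τ hτ
    have hρ1 : 1 ≤ ρ := hτ1.trans hρ
    have ht : 0 ≤ ρ - τ := sub_nonneg.2 hρ
    calc _ ≤ M * ((1 + (ρ - τ)) ^ j * Real.exp (-Λ * (ρ - τ))) *
          (τ ^ j * v τ * Real.exp (-Λ * τ)) := by
          gcongr
          exact hker τ ρ hρ
      _ = M * (1 + (ρ - τ)) ^ j * τ ^ j * v τ *
          (Real.exp (-Λ * (ρ - τ)) * Real.exp (-Λ * τ)) := by ring
      _ = M * (1 + (ρ - τ)) ^ j * τ ^ j * v τ * Real.exp (-Λ * ρ) := by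
          rw [← Real.exp_add]
          congr 2
          ring
      -- Three losses are paid here: 1 + (ρ-τ) ≤ ρ because τ ≥ 1, v(τ) ≤ v(ρ) by monotonicity, and
      -- τ^j goes into e^{ντ}.
      _ ≤ M * ρ ^ j * (C * Real.exp (ν * τ)) * v ρ * Real.exp (-Λ * ρ) := by
          gcongr
          linarith
      _ = _ := by ring

/-- The source condition for a source of size `O(τ^β e^{-γτ})` with `γ ≥ Λ`. -/
lemma source_of_integral_le (hΦ : IsFundamentalPair a b Φ₁ Φ₂) (hK : HasKernelBound Φ₁ Φ₂ j Λ)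
    {v : ℝ → ℝ} {ρ₁ β γ Cg C : ℝ} (hρ₁ : 1 ≤ ρ₁) (hgc : ContinuousOn g (Ici ρ₁)) (hCg : 0 < Cg)
    (hg : ∀ τ ≥ ρ₁, |g τ| ≤ Cg * (τ ^ β * Real.exp (-γ * τ))) (hC : 0 < C)
    (hint : ∀ ρ₀ ≥ ρ₁, ∀ ρ ≥ ρ₀,
      ∫ τ in ρ₀..ρ, (max τ 1) ^ β * Real.exp (-(γ - Λ) * τ) ≤ C * v ρ) :
    ∃ C > 0, ∀ ρ₀ ≥ ρ₁, ∀ ρ ≥ ρ₀,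
      ‖(∫ τ in ρ₀..ρ, varCoef₁ Φ₁ Φ₂ τ * g τ) • jet Φ₁ ρ +
        (∫ τ in ρ₀..ρ, varCoef₂ Φ₁ Φ₂ τ * g τ) • jet Φ₂ ρ‖ ≤
        C * (ρ ^ j * v ρ * Real.exp (-Λ * ρ)) := by
  obtain ⟨M, hM, hker⟩ := hK.kernel
  refine ⟨M * Cg * C, by positivity, fun ρ₀ hρ₀ ρ hρ => ?_⟩
  have hρ1 : 1 ≤ ρ := by linarith
  -- Replacing τ by max τ 1 changes nothing on the interval of integration and makes the integrand
  -- continuous on all of ℝ, also for negative β.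
  have hc : Continuous fun τ : ℝ => (max τ 1) ^ β * Real.exp (-(γ - Λ) * τ) := by
    refine Continuous.mul ?_ (by fun_prop)
    exact (continuous_id.max continuous_const).rpow_const fun τ =>
      Or.inl (by have := le_max_right τ 1; simp only [id]; linarith)
  refine (norm_source_le hΦ (hgc.mono (Ici_subset_Ici.2 hρ₀)) hρ (k := fun τ =>
    M * Cg * ρ ^ j * Real.exp (-Λ * ρ) * ((max τ 1) ^ β * Real.exp (-(γ - Λ) * τ)))
    (continuous_const.mul hc) fun τ hτ => ?_).trans ?_
  · have hτ1 : 1 ≤ τ := by linarith [hτ.1]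
    have ht : 0 ≤ ρ - τ := sub_nonneg.2 hτ.2
    rw [max_eq_left hτ1]
    calc _ ≤ M * ((1 + (ρ - τ)) ^ j * Real.exp (-Λ * (ρ - τ))) *
          (Cg * (τ ^ β * Real.exp (-γ * τ))) := by
          gcongr
          · exact hker τ ρ hτ.2
          · exact hg τ (hρ₀.trans hτ.1)
      _ ≤ M * (ρ ^ j * Real.exp (-Λ * (ρ - τ))) * (Cg * (τ ^ β * Real.exp (-γ * τ))) := by
          gcongr
          linarith
      _ = M * Cg * ρ ^ j * τ ^ β * (Real.exp (-Λ * (ρ - τ)) * Real.exp (-γ * τ)) := by ring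
      _ = M * Cg * ρ ^ j * τ ^ β * (Real.exp (-Λ * ρ) * Real.exp (-(γ - Λ) * τ)) := by
          rw [← Real.exp_add, ← Real.exp_add]
          congr 2
          ring
      _ = _ := by ring
  · rw [intervalIntegral.integral_const_mul]
    calc _ ≤ M * Cg * ρ ^ j * Real.exp (-Λ * ρ) * (C * v ρ) := by
          gcongr
          exact hint ρ₀ hρ₀ ρ hρ
      _ = _ := by ring

lemma integral_rpow_mul_exp_le (β : ℝ) {δ : ℝ} (hδ : 0 < δ) :
    ∃ C > 0, ∀ ρ₀ ≥ 1, ∀ ρ ≥ ρ₀,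
      ∫ τ in ρ₀..ρ, (max τ 1) ^ β * Real.exp (-δ * τ) ≤ C * 1 := by
  obtain ⟨C, hC, h⟩ := exists_rpow_le_exp β (half_pos hδ)
  refine ⟨C * (1 / (δ / 2)), by positivity, fun ρ₀ hρ₀ ρ hρ => ?_⟩
  have hc : Continuous fun τ : ℝ => (max τ 1) ^ β * Real.exp (-δ * τ) := by
    refine Continuous.mul ?_ (by fun_prop)
    exact (continuous_id.max continuous_const).rpow_const fun τ =>
      Or.inl (by have := le_max_right τ 1; simp only [id]; linarith)
  calc _ ≤ ∫ τ in ρ₀..ρ, C * Real.exp (-(δ / 2) * τ) := by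
        refine intervalIntegral.integral_mono_on hρ (hc.intervalIntegrable _ _)
          (by apply Continuous.intervalIntegrable; fun_prop) fun τ hτ => ?_
        have hτ1 : 1 ≤ τ := by linarith [hτ.1]
        rw [max_eq_left hτ1]
        calc _ ≤ C * Real.exp (δ / 2 * τ) * Real.exp (-δ * τ) := by
              gcongr
              exact h τ hτ1
          _ = _ := by
              rw [mul_assoc, ← Real.exp_add]
              congr 2
              ring
    _ = C * ∫ τ in ρ₀..ρ, Real.exp (-(δ / 2) * τ) := intervalIntegral.integral_const_mul _ _
    _ ≤ C * (Real.exp (-(δ / 2) * ρ₀) / (δ / 2)) := by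
        gcongr
        exact integral_exp_neg_le (half_pos hδ)
    _ ≤ C * (1 / (δ / 2)) := by
        gcongr
        rw [Real.exp_le_one_iff]
        nlinarith
    _ = _ := (mul_one _).symm

lemma integral_max_rpow {β ρ₀ ρ : ℝ} (hρ₀ : 1 ≤ ρ₀) (hρ : ρ₀ ≤ ρ) :
    ∫ τ in ρ₀..ρ, (max τ 1) ^ β * Real.exp (-0 * τ) = ∫ τ in ρ₀..ρ, τ ^ β := by
  refine intervalIntegral.integral_congr fun τ hτ => ?_
  rw [uIcc_of_le hρ] at hτ
  have hτ1 : 1 ≤ τ := hρ₀.trans hτ.1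
  simp [max_eq_left hτ1]

lemma integral_rpow_le {β ρ₀ ρ : ℝ} (hβ : -1 < β) (hρ₀ : 1 ≤ ρ₀) (hρ : ρ₀ ≤ ρ) :
    ∫ τ in ρ₀..ρ, (max τ 1) ^ β * Real.exp (-0 * τ) ≤ 1 / (β + 1) * ρ ^ (β + 1) := by
  have h1 : 0 < β + 1 := by linarith
  have h2 : 0 < ρ₀ := by linarith
  rw [integral_max_rpow hρ₀ hρ, integral_rpow (Or.inl hβ), one_div_mul_eq_div]
  have : 0 < ρ₀ ^ (β + 1) := by positivity
  gcongr
  linarith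

lemma integral_rpow_neg_one_le {ρ₀ ρ : ℝ} (hρ₀ : 1 ≤ ρ₀) (hρ : ρ₀ ≤ ρ) :
    ∫ τ in ρ₀..ρ, (max τ 1) ^ (-1 : ℝ) * Real.exp (-0 * τ) ≤ 1 * Real.log ρ := by
  have h2 : 0 < ρ₀ := by linarith
  rw [integral_max_rpow hρ₀ hρ]
  simp only [Real.rpow_neg_one]
  rw [integral_inv_of_pos h2 (by linarith), Real.log_div (by linarith) h2.ne', one_mul]
  linarith [Real.log_nonneg hρ₀]

lemma integral_rpow_le_const {β ρ₀ ρ : ℝ} (hβ : β < -1) (hρ₀ : 1 ≤ ρ₀) (hρ : ρ₀ ≤ ρ) :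
    ∫ τ in ρ₀..ρ, (max τ 1) ^ β * Real.exp (-0 * τ) ≤ 1 / (-(β + 1)) * 1 := by
  have h1 : 0 < -(β + 1) := by linarith
  have h2 : 0 < ρ₀ := by linarith
  have h3 : 0 < ρ := by linarith
  have hn : (0 : ℝ) ∉ uIcc ρ₀ ρ := by
    rw [uIcc_of_le hρ]
    exact fun h => absurd h.1 (not_le.2 h2)
  rw [integral_max_rpow hρ₀ hρ, integral_rpow (Or.inr ⟨hβ.ne, hn⟩), mul_one,
    ← neg_div_neg_eq]
  have h4 : 0 < ρ ^ (β + 1) := by positivity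
  have h5 : ρ₀ ^ (β + 1) ≤ 1 := Real.rpow_le_one_of_one_le_of_nonpos hρ₀ (by linarith)
  gcongr
  linarith

/-- Weights `ρ^β e^{-γρ}` decaying slower than the linear equation. -/
lemma isAdmissibleWeight_of_lt (hΦ : IsFundamentalPair a b Φ₁ Φ₂) (hK : HasKernelBound Φ₁ Φ₂ j Λ)
    {ρ₁ β γ Cg : ℝ} (hρ₁ : 1 ≤ ρ₁) (hγ : 0 < γ) (hγΛ : γ < Λ) (hgc : ContinuousOn g (Ici ρ₁))
    (hCg : 0 < Cg) (hg : ∀ τ ≥ ρ₁, |g τ| ≤ Cg * (τ ^ β * Real.exp (-γ * τ))) :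
    IsAdmissibleWeight Φ₁ Φ₂ g (fun ρ => ρ ^ β * Real.exp (-γ * ρ)) ρ₁ := by
  set δ := Λ - γ with hδd
  have hδ : 0 < δ := sub_pos.2 hγΛ
  -- Half of the gap δ = Λ - γ absorbs (1 + ρ-τ)^(j+|β|); the other half keeps the kernel integrable
  -- in ρ-τ.
  obtain ⟨C₀, hC₀, hpow⟩ := exists_rpow_le_exp ((j : ℝ) + |β|) (half_pos hδ)
  obtain ⟨M, hM, hker⟩ := hK.kernel
  set C := M * (C₀ * Real.exp (δ / 2)) with hCd
  have hC : 0 < C := by positivity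
  have key : ∀ τ ≥ ρ₁, ∀ ρ ≥ τ,
      ‖varCoef₁ Φ₁ Φ₂ τ • jet Φ₁ ρ + varCoef₂ Φ₁ Φ₂ τ • jet Φ₂ ρ‖ *
        (τ ^ β * Real.exp (-γ * τ)) ≤
        C * Real.exp (-(δ / 2) * (ρ - τ)) * (ρ ^ β * Real.exp (-γ * ρ)) := by
    intro τ hτ ρ hρ
    have hτ1 : 1 ≤ τ := hρ₁.trans hτ
    have hρ0 : 0 < ρ := by linarith
    have ht : 0 ≤ ρ - τ := sub_nonneg.2 hρ
    have h1 := hpow (1 + (ρ - τ)) (by linarith)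
    rw [Real.rpow_add (by linarith), Real.rpow_natCast] at h1
    calc _ ≤ M * ((1 + (ρ - τ)) ^ j * Real.exp (-Λ * (ρ - τ))) *
          ((1 + (ρ - τ)) ^ |β| * ρ ^ β * Real.exp (-γ * τ)) := by
          gcongr
          · exact hker τ ρ hρ
          · exact rpow_le_rpow_mul hτ1 hρ
      _ = M * ((1 + (ρ - τ)) ^ j * (1 + (ρ - τ)) ^ |β|) * ρ ^ β *
          (Real.exp (-Λ * (ρ - τ)) * Real.exp (-γ * τ)) := by ring
      _ ≤ M * (C₀ * Real.exp (δ / 2 * (1 + (ρ - τ)))) * ρ ^ β *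
          (Real.exp (-Λ * (ρ - τ)) * Real.exp (-γ * τ)) := by gcongr
      _ = M * C₀ * ρ ^ β * (Real.exp (δ / 2 * (1 + (ρ - τ))) *
          (Real.exp (-Λ * (ρ - τ)) * Real.exp (-γ * τ))) := by ring
      _ = M * C₀ * ρ ^ β * (Real.exp (δ / 2) *
          (Real.exp (-(δ / 2) * (ρ - τ)) * Real.exp (-γ * ρ))) := by
          rw [← Real.exp_add, ← Real.exp_add, ← Real.exp_add, ← Real.exp_add]
          congr 2
          rw [hδd]
          ring
      _ = _ := by
          rw [hCd]
          ring
  obtain ⟨C₁, hC₁, hpow₁⟩ := exists_rpow_le_exp ((j : ℝ) - β) hδ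
  have hjet : ∀ Φ : ℝ → ℝ, (∃ M > 0, ∀ ρ ≥ 1, ‖jet Φ ρ‖ ≤ M * (ρ ^ j * Real.exp (-Λ * ρ))) →
      ∃ C > 0, ∀ ρ ≥ ρ₁, ‖jet Φ ρ‖ ≤ C * (ρ ^ β * Real.exp (-γ * ρ)) := by
    rintro Φ ⟨M, hM, h⟩
    refine ⟨M * C₁, by positivity, fun ρ hρ => (h ρ (hρ₁.trans hρ)).trans ?_⟩
    have hρ1 : 1 ≤ ρ := hρ₁.trans hρ
    have h0 : 0 < ρ := by linarith
    have h1 := hpow₁ ρ hρ1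
    rw [Real.rpow_sub h0, Real.rpow_natCast, div_le_iff₀ (by positivity)] at h1
    calc _ ≤ M * (C₁ * Real.exp (δ * ρ) * ρ ^ β * Real.exp (-Λ * ρ)) := by gcongr
      _ = M * C₁ * (ρ ^ β * (Real.exp (δ * ρ) * Real.exp (-Λ * ρ))) := by ring
      _ = _ := by
          rw [← Real.exp_add]
          congr 3
          rw [hδd]
          ring
  refine ⟨?_, ?_, ?_, ?_, hjet Φ₁ hK.jet₁, hjet Φ₂ hK.jet₂, ?_⟩
  · refine ContinuousOn.mul ?_ (by fun_prop)
    exact continuousOn_id.rpow_const fun τ hτ => Or.inl (by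
      have : ρ₁ ≤ τ := hτ
      simp only [id]
      linarith)
  · intro ρ hρ
    have : 0 < ρ := by linarith
    positivity
  · refine ⟨γ / 2, half_pos hγ, ?_⟩
    refine ((isLittleO_rpow_exp_pos_mul_atTop β (half_pos hγ)).isBigO.mul
      (isBigO_refl (fun ρ : ℝ => Real.exp (-γ * ρ)) atTop)).congr_right fun ρ => ?_
    rw [← Real.exp_add]
    congr 1
    ring
  · intro ν hν
    refine ⟨C, hC, fun τ hτ ρ hρ => (key τ hτ ρ hρ).trans ?_⟩
    have hρ0 : 0 < ρ := by linarith
    have ht : 0 ≤ ρ - τ := sub_nonneg.2 hρ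
    have h1 : 0 ≤ δ / 2 * (ρ - τ) := by positivity
    have h2 : 0 ≤ ν * τ := mul_nonneg hν.le (by linarith)
    have h3 : Real.exp (-(δ / 2) * (ρ - τ)) ≤ Real.exp (ν * τ) :=
      Real.exp_le_exp.2 (by linarith)
    gcongr
  · refine ⟨Cg * C * (1 / (δ / 2)), by positivity, fun ρ₀ hρ₀ ρ hρ => ?_⟩
    have hρ0 : 0 < ρ := by linarith
    refine (norm_source_le hΦ (hgc.mono (Ici_subset_Ici.2 hρ₀)) hρ (k := fun τ =>
      Cg * C * (ρ ^ β * Real.exp (-γ * ρ)) * Real.exp (-(δ / 2) * (ρ - τ))) (by fun_prop)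
      fun τ hτ => ?_).trans ?_
    · have h1 := key τ (hρ₀.trans hτ.1) ρ hτ.2
      calc _ ≤ ‖varCoef₁ Φ₁ Φ₂ τ • jet Φ₁ ρ + varCoef₂ Φ₁ Φ₂ τ • jet Φ₂ ρ‖ *
            (Cg * (τ ^ β * Real.exp (-γ * τ))) := by
            gcongr
            exact hg τ (hρ₀.trans hτ.1)
        _ = Cg * (‖varCoef₁ Φ₁ Φ₂ τ • jet Φ₁ ρ + varCoef₂ Φ₁ Φ₂ τ • jet Φ₂ ρ‖ *
            (τ ^ β * Real.exp (-γ * τ))) := by ring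
        _ ≤ Cg * (C * Real.exp (-(δ / 2) * (ρ - τ)) * (ρ ^ β * Real.exp (-γ * ρ))) := by gcongr
        _ = _ := by ring
    · rw [intervalIntegral.integral_const_mul,
        intervalIntegral.integral_comp_sub_left (fun t => Real.exp (-(δ / 2) * t)) ρ, sub_self]
      have h1 := integral_exp_neg_le (c := 0) (d := ρ - ρ₀) (half_pos hδ)
      rw [mul_zero, Real.exp_zero] at h1
      calc _ ≤ Cg * C * (ρ ^ β * Real.exp (-γ * ρ)) * (1 / (δ / 2)) := by gcongr
        _ = _ := by ring

end Weights

/-! ### Oscillation at resonance -/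

/-- Integration by parts: the boundary terms contribute at most 2B, and ∫ |H| τ⁻² at most B, since
ρ₀ ≥ 1. -/
lemma abs_integral_div_le {h H : ℝ → ℝ} {B ρ₀ ρ : ℝ} (hc : Continuous h)
    (hH : ∀ t, HasDerivAt H (h t) t) (hB : ∀ t, |H t| ≤ B) (hρ₀ : 1 ≤ ρ₀) (hρ : ρ₀ ≤ ρ) :
    |∫ τ in ρ₀..ρ, h τ * τ⁻¹| ≤ 3 * B := by
  have hB0 : 0 ≤ B := (abs_nonneg _).trans (hB 0)
  have hHc : Continuous H := continuous_iff_continuousAt.2 fun t => (hH t).continuousAt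
  have hne : ∀ τ ∈ uIcc ρ₀ ρ, τ ≠ 0 := fun τ hτ => by
    rw [uIcc_of_le hρ] at hτ
    linarith [hτ.1]
  have hinv : ContinuousOn (fun τ : ℝ => τ⁻¹) (uIcc ρ₀ ρ) :=
    continuousOn_inv₀.mono hne
  have i1 : IntervalIntegrable (fun τ => h τ * τ⁻¹) volume ρ₀ ρ :=
    (hc.continuousOn.mul hinv).intervalIntegrable
  have i2 : IntervalIntegrable (fun τ => H τ * (-(τ ^ 2)⁻¹)) volume ρ₀ ρ := by
    refine (hHc.continuousOn.mul ?_).intervalIntegrable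
    exact ((continuous_pow 2).continuousOn.inv₀ fun τ hτ => pow_ne_zero 2 (hne τ hτ)).neg
  have h1 : ∫ τ in ρ₀..ρ, (h τ * τ⁻¹ + H τ * (-(τ ^ 2)⁻¹)) = H ρ * ρ⁻¹ - H ρ₀ * ρ₀⁻¹ :=
    intervalIntegral.integral_eq_sub_of_hasDerivAt (f := fun τ => H τ * τ⁻¹)
      (fun τ hτ => (hH τ).mul (hasDerivAt_inv (hne τ hτ))) (i1.add i2)
  rw [intervalIntegral.integral_add i1 i2] at h1
  have hb : ∀ t ≥ (1 : ℝ), |H t * t⁻¹| ≤ B := fun t ht => by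
    rw [abs_mul, abs_inv, abs_of_pos (show 0 < t by linarith)]
    have h2 : t⁻¹ ≤ 1 := inv_le_one_of_one_le₀ ht
    calc _ ≤ B * 1 := by
          gcongr
          exact hB t
      _ = B := mul_one B
  have h2 : |∫ τ in ρ₀..ρ, H τ * (-(τ ^ 2)⁻¹)| ≤ B := by
    have h3 : ∫ τ in ρ₀..ρ, B * (τ ^ 2)⁻¹ = B * (ρ₀⁻¹ - ρ⁻¹) := by
      have h4 : ∫ τ in ρ₀..ρ, B * (τ ^ 2)⁻¹ = B * (-ρ⁻¹) - B * (-ρ₀⁻¹) := by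
        refine intervalIntegral.integral_eq_sub_of_hasDerivAt (f := fun τ => B * (-τ⁻¹))
          (fun τ hτ => ?_) ?_
        · simpa using ((hasDerivAt_inv (hne τ hτ)).neg.const_mul B)
        · refine (continuousOn_const.mul ?_).intervalIntegrable
          exact (continuous_pow 2).continuousOn.inv₀ fun τ hτ => pow_ne_zero 2 (hne τ hτ)
      rw [h4]
      ring
    have h5 : ‖∫ τ in ρ₀..ρ, H τ * (-(τ ^ 2)⁻¹)‖ ≤ ∫ τ in ρ₀..ρ, B * (τ ^ 2)⁻¹ := by
      refine intervalIntegral.norm_integral_le_of_norm_le hρ ?_ ?_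
      · refine Eventually.of_forall fun τ hτ => ?_
        rw [norm_mul, norm_neg, norm_inv, norm_pow, Real.norm_eq_abs, Real.norm_eq_abs, sq_abs]
        gcongr
        exact hB τ
      · refine (continuousOn_const.mul ?_).intervalIntegrable
        exact (continuous_pow 2).continuousOn.inv₀ fun τ hτ => pow_ne_zero 2 (hne τ hτ)
    rw [h3, Real.norm_eq_abs] at h5
    refine h5.trans ?_
    have h6 : ρ₀⁻¹ ≤ 1 := inv_le_one_of_one_le₀ hρ₀
    have h7 : 0 < ρ⁻¹ := inv_pos.2 (by linarith)
    calc B * (ρ₀⁻¹ - ρ⁻¹) ≤ B * 1 := by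
          gcongr
          linarith
      _ = B := mul_one B
  have h8 := abs_le.1 (hb ρ (hρ₀.trans hρ))
  have h9 := abs_le.1 (hb ρ₀ hρ₀)
  have h10 := abs_le.1 h2
  rw [abs_le]
  constructor <;> linarith [h8.1, h8.2, h9.1, h9.2, h10.1, h10.2]

/-- A bounded oscillating factor against `c τ⁻¹ + O(τ⁻²)` has bounded integrals. -/
lemma abs_integral_mul_le {h H g : ℝ → ℝ} {B c C ρ₀ ρ : ℝ} (hc : Continuous h)
    (hH : ∀ t, HasDerivAt H (h t) t) (hB : ∀ t, |H t| ≤ B) (hB' : ∀ t, |h t| ≤ B)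
    (hC : 0 ≤ C) (hρ₀ : 1 ≤ ρ₀) (hρ : ρ₀ ≤ ρ) (hg : ContinuousOn g (Ici ρ₀))
    (hgle : ∀ τ ≥ ρ₀, |g τ - c * τ⁻¹| ≤ C * τ ^ (-2 : ℝ)) :
    |∫ τ in ρ₀..ρ, h τ * g τ| ≤ B * C + |c| * (3 * B) := by
  have hB0 : 0 ≤ B := (abs_nonneg _).trans (hB 0)
  have hsub : uIcc ρ₀ ρ ⊆ Ici ρ₀ := by
    rw [uIcc_of_le hρ]
    exact Icc_subset_Ici_self
  have hinv : ContinuousOn (fun τ : ℝ => τ⁻¹) (Ici ρ₀) :=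
    continuousOn_inv₀.mono fun τ hτ => by
      have : ρ₀ ≤ τ := hτ
      exact (show (0 : ℝ) < τ by linarith).ne'
  have i1 : IntervalIntegrable (fun τ => h τ * (g τ - c * τ⁻¹)) volume ρ₀ ρ :=
    (hc.continuousOn.mul ((hg.sub (continuousOn_const.mul hinv)).mono hsub)).intervalIntegrable
  have i2 : IntervalIntegrable (fun τ => c * (h τ * τ⁻¹)) volume ρ₀ ρ :=
    (continuousOn_const.mul (hc.continuousOn.mul (hinv.mono hsub))).intervalIntegrable
  have e : ∫ τ in ρ₀..ρ, h τ * g τ =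
      (∫ τ in ρ₀..ρ, h τ * (g τ - c * τ⁻¹)) + c * ∫ τ in ρ₀..ρ, h τ * τ⁻¹ := by
    rw [← intervalIntegral.integral_const_mul, ← intervalIntegral.integral_add i1 i2]
    refine intervalIntegral.integral_congr fun τ _ => ?_
    ring
  have hcont : Continuous fun τ : ℝ => (max τ 1) ^ (-2 : ℝ) * Real.exp (-0 * τ) := by
    refine Continuous.mul ?_ (by fun_prop)
    exact (continuous_id.max continuous_const).rpow_const fun τ =>
      Or.inl (by have := le_max_right τ 1; simp only [id]; linarith)
  have h1 : ‖∫ τ in ρ₀..ρ, h τ * (g τ - c * τ⁻¹)‖ ≤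
      ∫ τ in ρ₀..ρ, B * C * ((max τ 1) ^ (-2 : ℝ) * Real.exp (-0 * τ)) := by
    refine intervalIntegral.norm_integral_le_of_norm_le hρ ?_
      ((continuous_const.mul hcont).intervalIntegrable _ _)
    refine Eventually.of_forall fun τ hτ => ?_
    rw [norm_mul, Real.norm_eq_abs, Real.norm_eq_abs, max_eq_left (hρ₀.trans hτ.1.le), neg_zero,
      zero_mul, Real.exp_zero, mul_one, mul_assoc]
    gcongr
    · exact hB' τ
    · exact hgle τ hτ.1.le
  have h2 := integral_rpow_le_const (β := -2) (by norm_num) hρ₀ hρ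
  rw [intervalIntegral.integral_const_mul, Real.norm_eq_abs] at h1
  have h3 := abs_integral_div_le hc hH hB hρ₀ hρ
  rw [e]
  refine (abs_add_le _ _).trans (add_le_add (h1.trans ?_) ?_)
  · calc _ ≤ B * C * 1 := by
          gcongr
          refine h2.trans (le_of_eq ?_)
          norm_num
      _ = B * C := mul_one _
  · rw [abs_mul]
    gcongr

/-- The source condition at resonance with complex roots for a source
`e^{-cτ} (c₀ τ⁻¹ + O(τ⁻²))`. -/
lemma source_complex {c k c₀ C ρ₁ : ℝ} {g : ℝ → ℝ} (hk : 0 < k) (hρ₁ : 1 ≤ ρ₁) (hC : 0 ≤ C)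
    (hg : ContinuousOn g (Ici ρ₁))
    (hgle : ∀ τ ≥ ρ₁, |Real.exp (c * τ) * g τ - c₀ * τ⁻¹| ≤ C * τ ^ (-2 : ℝ)) :
    ∃ C > 0, ∀ ρ₀ ≥ ρ₁, ∀ ρ ≥ ρ₀,
      ‖(∫ τ in ρ₀..ρ, varCoef₁ (fun t => Real.exp (-c * t) * Real.cos (k * t))
          (fun t => Real.exp (-c * t) * Real.sin (k * t)) τ * g τ) •
          jet (fun t => Real.exp (-c * t) * Real.cos (k * t)) ρ +
        (∫ τ in ρ₀..ρ, varCoef₂ (fun t => Real.exp (-c * t) * Real.cos (k * t))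
          (fun t => Real.exp (-c * t) * Real.sin (k * t)) τ * g τ) •
          jet (fun t => Real.exp (-c * t) * Real.sin (k * t)) ρ‖ ≤ C * Real.exp (-c * ρ) := by
  -- One constant for both the oscillating factor, bounded by 1/k, and its primitive, bounded by
  -- 1/k².
  set B := k⁻¹ + k⁻¹ * k⁻¹ with hB
  have hBpos : 0 < B := by positivity
  have hk1 : k⁻¹ ≤ B := by
    rw [hB]
    have : 0 < k⁻¹ * k⁻¹ := by positivity
    linarith
  have hk2 : k⁻¹ * k⁻¹ ≤ B := by
    rw [hB]
    have : 0 < k⁻¹ := by positivity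
    linarith
  set D := B * C + |c₀| * (3 * B) with hD
  have hD0 : 0 ≤ D := by positivity
  have hlin : ∀ t : ℝ, HasDerivAt (fun t : ℝ => k * t) k t := fun t => by
    simpa using (hasDerivAt_id t).const_mul k
  refine ⟨2 * D * (1 + |c| + |k|) + 1, by positivity, fun ρ₀ hρ₀ ρ hρ => ?_⟩
  have hG : ContinuousOn (fun τ => Real.exp (c * τ) * g τ) (Ici ρ₀) :=
    (by fun_prop : Continuous fun τ : ℝ => Real.exp (c * τ)).continuousOn.mul
      (hg.mono (Ici_subset_Ici.2 hρ₀))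
  have bnd : ∀ x : ℝ, |x| ≤ 1 → |k⁻¹ * x| ≤ B := fun x hx => by
    rw [abs_mul, abs_of_pos (inv_pos.2 hk)]
    exact (mul_le_of_le_one_right (by positivity) hx).trans hk1
  have bnd2 : ∀ x : ℝ, |x| ≤ 1 → |k⁻¹ * k⁻¹ * x| ≤ B := fun x hx => by
    rw [abs_mul, abs_of_pos (by positivity : 0 < k⁻¹ * k⁻¹)]
    exact (mul_le_of_le_one_right (by positivity) hx).trans hk2
  have h1 := abs_integral_mul_le (h := fun t => k⁻¹ * Real.sin (k * t))
    (H := fun t => k⁻¹ * k⁻¹ * -Real.cos (k * t)) (B := B) (by fun_prop)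
    (fun t => by
      refine ((hlin t).cos.neg.const_mul (k⁻¹ * k⁻¹)).congr_deriv ?_
      field_simp)
    (fun t => bnd2 _ (by rw [abs_neg]; exact Real.abs_cos_le_one _))
    (fun t => bnd _ (Real.abs_sin_le_one _)) hC (hρ₁.trans hρ₀) hρ hG
    fun τ hτ => hgle τ (le_trans hρ₀ hτ)
  have h2 := abs_integral_mul_le (h := fun t => k⁻¹ * -Real.cos (k * t))
    (H := fun t => k⁻¹ * k⁻¹ * -Real.sin (k * t)) (B := B) (by fun_prop)
    (fun t => by
      refine ((hlin t).sin.neg.const_mul (k⁻¹ * k⁻¹)).congr_deriv ?_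
      field_simp)
    (fun t => bnd2 _ (by rw [abs_neg]; exact Real.abs_sin_le_one _))
    (fun t => bnd _ (by rw [abs_neg]; exact Real.abs_cos_le_one _)) hC (hρ₁.trans hρ₀) hρ hG
    fun τ hτ => hgle τ (le_trans hρ₀ hτ)
  have e1 : ∫ τ in ρ₀..ρ, varCoef₁ (fun t => Real.exp (-c * t) * Real.cos (k * t))
      (fun t => Real.exp (-c * t) * Real.sin (k * t)) τ * g τ =
      ∫ τ in ρ₀..ρ, k⁻¹ * Real.sin (k * τ) * (Real.exp (c * τ) * g τ) := by
    simp only [varCoef₁_complex, mul_assoc]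
  have e2 : ∫ τ in ρ₀..ρ, varCoef₂ (fun t => Real.exp (-c * t) * Real.cos (k * t))
      (fun t => Real.exp (-c * t) * Real.sin (k * t)) τ * g τ =
      ∫ τ in ρ₀..ρ, k⁻¹ * -Real.cos (k * τ) * (Real.exp (c * τ) * g τ) := by
    refine intervalIntegral.integral_congr fun τ _ => ?_
    simp only [varCoef₂_complex]
    ring
  rw [e1, e2]
  refine (norm_add_le _ _).trans ?_
  rw [norm_smul, norm_smul, Real.norm_eq_abs, Real.norm_eq_abs]
  calc _ ≤ D * ((1 + |c| + |k|) * Real.exp (-c * ρ)) +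
        D * ((1 + |c| + |k|) * Real.exp (-c * ρ)) := by
        gcongr
        · exact norm_jet_exp_cos_le c k ρ
        · exact norm_jet_exp_sin_le c k ρ
    _ = 2 * D * (1 + |c| + |k|) * Real.exp (-c * ρ) := by ring
    _ ≤ _ := by
        gcongr
        linarith

/-! ### The table of decay rates -/

section Table

variable {N : ℕ} {p r β : ℝ}

lemma lt_rStar_iff (hp : 1 < p) : r < rStar N p ↔ bigLambda N p < 2 * (p - r) / (p - 1) := by
  have hp1 : 0 < p - 1 := sub_pos.2 hp
  rw [rStar, lt_div_iff₀ hp1]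
  constructor <;> intro h <;> linarith

lemma eq_rStar_iff (hp : 1 < p) : r = rStar N p ↔ 2 * (p - r) / (p - 1) = bigLambda N p := by
  have hp1 : 0 < p - 1 := sub_pos.2 hp
  rw [rStar, div_eq_iff hp1.ne']
  constructor <;> intro h <;> linarith

lemma decayTable_of_lt (h : r < rStar N p) :
    decayTable N p r β = fun ρ => ρ ^ resExp N p * 1 * Real.exp (-bigLambda N p * ρ) := by
  funext ρ
  rcases lt_trichotomy p (pStar N) with hp | hp | hp
  · simp [decayTable, h, resExp, bigLambda, hp, hp.ne]
  · simp [decayTable, resExp, bigLambda, hp, show r < rStar N (pStar N) from hp ▸ h]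
  · simp [decayTable, h, resExp, bigLambda, hp.ne', hp.not_gt]

lemma decayTable_of_gt (h : rStar N p < r) :
    decayTable N p r β = fun ρ => ρ ^ β * Real.exp (-(2 * (p - r) / (p - 1)) * ρ) := by
  funext ρ
  simp [decayTable, h.not_gt, h.ne']

lemma decayTable_of_eq_of_neg_one_lt (h : r = rStar N p) (hβ : -1 < β) :
    decayTable N p r β =ᶠ[atTop]
      fun ρ => ρ ^ resExp N p * ρ ^ (β + 1) * Real.exp (-bigLambda N p * ρ) := by
  filter_upwards [eventually_gt_atTop 0] with ρ hρ
  rcases lt_trichotomy p (pStar N) with hp | hp | hp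
  · simp [decayTable, h, resExp, bigLambda, hp, hp.ne, hβ]
  · have e : ρ ^ (β + 2) = ρ * ρ ^ (β + 1) := by
      rw [show β + 2 = 1 + (β + 1) by ring, Real.rpow_add hρ, Real.rpow_one]
    subst h
    simp only [decayTable, resExp, bigLambda, lt_irrefl, if_false, if_true, hβ]
    rw [if_neg hp.not_lt, if_pos hp, if_neg hp.not_lt, if_pos hp, if_pos hp, e, pow_one]
  · simp [decayTable, h, resExp, bigLambda, hp.ne', hp.not_gt, hβ.le]

lemma decayTable_of_eq_neg_one (h : r = rStar N p) (hp : p ≤ pStar N) :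
    decayTable N p r (-1) =
      fun ρ => ρ ^ resExp N p * Real.log ρ * Real.exp (-bigLambda N p * ρ) := by
  funext ρ
  subst h
  rcases hp.lt_or_eq with hp | hp
  · simp [decayTable, resExp, bigLambda, hp, hp.ne]
  · simp only [decayTable, resExp, bigLambda, lt_irrefl, if_false, if_true]
    rw [if_neg hp.not_lt, if_pos hp, if_neg hp.not_lt, if_pos hp, if_pos hp, pow_one]

/-- The table includes β = -1 in the branch ρ^(β+1) for complex roots, and there this factor is 1.
-/
lemma decayTable_of_eq_neg_one_of_gt (h : r = rStar N p) (hp : pStar N < p) :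
    decayTable N p r (-1) =
      fun ρ => ρ ^ resExp N p * 1 * Real.exp (-bigLambda N p * ρ) := by
  funext ρ
  subst h
  simp [decayTable, resExp, bigLambda, hp.ne', hp.not_gt]

lemma decayTable_of_eq_of_lt_neg_one (h : r = rStar N p) (hβ : β < -1) :
    decayTable N p r β = fun ρ => ρ ^ resExp N p * 1 * Real.exp (-bigLambda N p * ρ) := by
  funext ρ
  subst h
  rcases lt_trichotomy p (pStar N) with hp | hp | hp
  · simp [decayTable, resExp, bigLambda, hp, hp.ne, hβ.not_gt, hβ.ne]
  · simp only [decayTable, resExp, bigLambda, lt_irrefl, if_false, if_true, hβ.not_gt, hβ.ne]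
    rw [if_neg hp.not_lt, if_pos hp, if_neg hp.not_lt, if_pos hp, if_pos hp, pow_one, mul_one]
  · simp [decayTable, resExp, bigLambda, hp.ne', hp.not_gt, hβ.not_ge]

lemma exists_inhom_bounds (hp : 1 < p) (hrp : r < p) (hb : 0 < bCoef N (qExp (fEx p r β))) :
    ∃ C > 0, ∀ᶠ ρ₁ in atTop, ContinuousOn (inhom (fEx p r β) 2 N) (Ici ρ₁) ∧
      ∀ τ ≥ ρ₁, |inhom (fEx p r β) 2 N τ| ≤
        C * (τ ^ β * Real.exp (-(2 * (p - r) / (p - 1)) * τ)) := by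
  obtain ⟨C, hC, h⟩ := (inhom_isBigO hp hrp hb).exists_pos
  obtain ⟨ρ₂, hρ₂⟩ := eventually_atTop.1 (((eventually_phi_spec hp hb).and
    (exists_continuousOn_phi hp hb)).and h.bound)
  refine ⟨C, hC, ?_⟩
  filter_upwards [eventually_ge_atTop ρ₂, eventually_gt_atTop 0] with ρ₁ hρ₁ hρ₁0
  constructor
  · have hmc : Continuous fun τ : ℝ => max τ ρ₁ := continuous_id.max continuous_const
    have hm : ∀ τ, ρ₂ ≤ max τ ρ₁ := fun τ => hρ₁.trans (le_max_right _ _)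
    have hφc : Continuous fun τ => phi (fEx p r β) 2 N (max τ ρ₁) :=
      continuous_iff_continuousAt.2 fun τ =>
        ContinuousAt.comp (f := fun τ : ℝ => max τ ρ₁) (hρ₂ _ (hm τ)).1.2 hmc.continuousAt
    refine (continuous_inhom_comp hp hφc fun τ => ?_).continuousOn.congr fun τ hτ => ?_
    · linarith [(hρ₂ _ (hm τ)).1.1.1]
    · beta_reduce
      rw [max_eq_left (mem_Ici.1 hτ)]
  · intro τ hτ
    have h1 := (hρ₂ τ (hρ₁.trans hτ)).2
    have hw := expWeight_pos (p := p) (r := r) (d := β) (show 0 < τ by linarith)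
    rw [Real.norm_of_nonneg hw.le] at h1
    exact h1

/-- The size of I alone would give a logarithm after integration. Keeping the exact coefficient of
τ⁻¹ with an integrable O(τ⁻²) error is what allows oscillation to be exploited. -/
lemma exists_inhom_resonant (hp : 1 < p) (hrp : r < p)
    (hb : 0 < bCoef N (qExp (fEx p r (-1)))) :
    ∃ c₀, ∃ C ≥ 0, ∀ᶠ ρ₁ in atTop, ∀ τ ≥ ρ₁,
      |Real.exp (2 * (p - r) / (p - 1) * τ) * inhom (fEx p r (-1)) 2 N τ - c₀ * τ⁻¹| ≤
        C * τ ^ (-2 : ℝ) := by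
  obtain ⟨c, -, h⟩ := inhom_sub_isBigO (β := -1) hp hrp hb
  obtain ⟨C, hC, h⟩ := h.exists_pos
  refine ⟨c * (r - (p - 1)), C, hC.le, ?_⟩
  filter_upwards [eventually_forall_ge_atTop.2 h.bound, eventually_gt_atTop 0] with ρ₁ hρ₁ h0 τ hτ
  have hτ0 : 0 < τ := by linarith
  have h1 := hρ₁ τ hτ
  rw [Real.norm_of_nonneg (expWeight_pos hτ0).le, Real.norm_eq_abs, expWeight, expWeight,
    Real.rpow_neg_one, show (-1 - 1 : ℝ) = -2 by norm_num] at h1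
  set E := Real.exp (2 * (p - r) / (p - 1) * τ) with hE
  have hE' : Real.exp (-(2 * (p - r) / (p - 1)) * τ) = E⁻¹ := by
    rw [hE, ← Real.exp_neg, neg_mul]
  rw [hE'] at h1
  have hEpos : 0 < E := Real.exp_pos _
  have e : E * inhom (fEx p r (-1)) 2 N τ - c * (r - (p - 1)) * τ⁻¹ =
      E * (inhom (fEx p r (-1)) 2 N τ - c * (r - (p - 1)) * (τ⁻¹ * E⁻¹)) := by
    field_simp
  rw [e, abs_mul, abs_of_pos hEpos]
  calc _ ≤ E * (C * (τ ^ (-2 : ℝ) * E⁻¹)) := by gcongr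
    _ = _ := by field_simp

theorem exists_admissibleWeight (hN : 3 ≤ N) (hp : 1 < p) (hrp : r < p) (hpc : pCrit N < p)
    (hpS : p < pSob N) :
    ∃ w ρ₁, IsAdmissibleWeight (fundOne N p) (fundTwo N p) (inhom (fEx p r β) 2 N) w ρ₁ ∧
      w =O[atTop] decayTable N p r β := by
  have hb : 0 < bCoef N (qExp (fEx p r β)) := by
    rw [qExp_fEx β hp hrp]
    exact bCoef_pos hp hN hpc
  obtain ⟨hΦ, hK⟩ := isFundamentalPair_and_hasKernelBound hN hp hpc hpS
  obtain ⟨Cg, hCg, hev⟩ := exists_inhom_bounds hp hrp hb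
  have hγpos : 0 < 2 * (p - r) / (p - 1) := div_pos (by linarith) (by linarith)
  -- Since e < 3, starting beyond 3 makes log ρ ≥ 1, as required of the weight factor in the
  -- logarithmic case.
  obtain ⟨ρ₁, ⟨hgc, hgb⟩, hρ₁3⟩ := (hev.and (eventually_ge_atTop 3)).exists
  have hρ₁ : 1 ≤ ρ₁ := by linarith
  have hone : (fun _ : ℝ => (1 : ℝ)) =O[atTop] fun ρ : ℝ => ρ ^ (0 : ℝ) := by
    simpa using isBigO_refl (fun _ : ℝ => (1 : ℝ)) atTop
  rcases lt_trichotomy r (rStar N p) with hr | hr | hr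
  · have hlt := (lt_rStar_iff hp).1 hr
    obtain ⟨C, hC, hint⟩ := integral_rpow_mul_exp_le β (sub_pos.2 hlt)
    rw [decayTable_of_lt hr]
    exact ⟨_, ρ₁, isAdmissibleWeight_of_monotone hK (v := fun _ => 1) hρ₁ continuousOn_const
      monotoneOn_const (fun _ _ => le_rfl) hone
      (source_of_integral_le hΦ hK hρ₁ hgc hCg hgb hC
        fun ρ₀ hρ₀ ρ hρ => hint ρ₀ (hρ₁.trans hρ₀) ρ hρ), isBigO_refl _ _⟩
  · have heq := (eq_rStar_iff hp).1 hr
    rw [heq] at hgb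
    rcases lt_trichotomy β (-1) with hβ | hβ | hβ
    · rw [decayTable_of_eq_of_lt_neg_one hr hβ]
      refine ⟨_, ρ₁, isAdmissibleWeight_of_monotone hK (v := fun _ => 1) hρ₁ continuousOn_const
        monotoneOn_const (fun _ _ => le_rfl) hone
        (source_of_integral_le hΦ hK hρ₁ hgc hCg hgb
          (one_div_pos.2 (by linarith : 0 < -(β + 1))) fun ρ₀ hρ₀ ρ hρ => ?_), isBigO_refl _ _⟩
      rw [sub_self]
      exact integral_rpow_le_const hβ (hρ₁.trans hρ₀) hρ
    · subst hβ
      rcases le_or_gt p (pStar N) with hps | hps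
      · rw [decayTable_of_eq_neg_one hr hps]
        refine ⟨_, ρ₁, isAdmissibleWeight_of_monotone hK (v := Real.log) (d := 1) hρ₁ ?_ ?_ ?_ ?_
          (source_of_integral_le hΦ hK hρ₁ hgc hCg hgb one_pos fun ρ₀ hρ₀ ρ hρ => ?_),
          isBigO_refl _ _⟩
        · refine Real.continuousOn_log.mono fun τ hτ => ?_
          have : ρ₁ ≤ τ := hτ
          exact (show (0 : ℝ) < τ by linarith).ne'
        · refine Real.strictMonoOn_log.monotoneOn.mono fun τ hτ => ?_
          have : ρ₁ ≤ τ := hτ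
          exact show (0 : ℝ) < τ by linarith
        · intro ρ hρ
          rw [Real.le_log_iff_exp_le (by linarith)]
          linarith [Real.exp_one_lt_three]
        · exact (isLittleO_log_rpow_atTop one_pos).isBigO
        · rw [sub_self]
          exact integral_rpow_neg_one_le (hρ₁.trans hρ₀) hρ
      -- This is the one cell where absolute values under the integral are too lossy: the claimed
      -- rate has no logarithm.
      · obtain ⟨c₀, C, hC, hres⟩ := exists_inhom_resonant hp hrp hb
        obtain ⟨ρ₂, hres₂, hρ₂⟩ := (hres.and (eventually_ge_atTop ρ₁)).exists
        rw [decayTable_of_eq_neg_one_of_gt hr hps]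
        refine ⟨_, ρ₂, isAdmissibleWeight_of_monotone hK (v := fun _ => 1) (hρ₁.trans hρ₂)
          continuousOn_const monotoneOn_const (fun _ _ => le_rfl) hone ?_, isBigO_refl _ _⟩
        have e₁ : fundOne N p =
            fun t => Real.exp (-(aCoef N p / 2) * t) * Real.cos (freq N p * t) :=
          funext fun t => by simp [fundOne, hps.ne', hps.not_gt]
        have e₂ : fundTwo N p =
            fun t => Real.exp (-(aCoef N p / 2) * t) * Real.sin (freq N p * t) :=
          funext fun t => by simp [fundTwo, hps.ne', hps.not_gt]
        have e₃ : bigLambda N p = aCoef N p / 2 := by simp [bigLambda, hps.ne', hps.not_gt]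
        have e₄ : resExp N p = 0 := by simp [resExp, hps.ne']
        have hk : 0 < freq N p := by
          have := Real.sqrt_pos.2 (neg_pos.2 (discr_neg hN hp hpS hps))
          unfold freq
          positivity
        rw [heq, e₃] at hres₂
        obtain ⟨C', hC', h⟩ := source_complex hk (hρ₁.trans hρ₂) hC
          (hgc.mono (Ici_subset_Ici.2 hρ₂)) hres₂
        refine ⟨C', hC', fun ρ₀ hρ₀ ρ hρ => ?_⟩
        rw [e₁, e₂, e₃, e₄, pow_zero, one_mul, one_mul]
        exact h ρ₀ hρ₀ ρ hρ
    · refine ⟨_, ρ₁, isAdmissibleWeight_of_monotone hK (v := fun ρ => ρ ^ (β + 1)) (d := β + 1)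
        hρ₁ ?_ ?_ ?_ (isBigO_refl _ _)
        (source_of_integral_le hΦ hK hρ₁ hgc hCg hgb
          (one_div_pos.2 (by linarith : 0 < β + 1)) fun ρ₀ hρ₀ ρ hρ => ?_),
        (decayTable_of_eq_of_neg_one_lt hr hβ).symm.isBigO⟩
      · exact continuousOn_id.rpow_const fun τ _ => Or.inr (by linarith)
      · intro x hx y _ hxy
        have : ρ₁ ≤ x := hx
        exact Real.rpow_le_rpow (by linarith) hxy (by linarith)
      · intro ρ hρ
        exact Real.one_le_rpow (hρ₁.trans hρ) (by linarith)
      · rw [sub_self]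
        exact integral_rpow_le hβ (hρ₁.trans hρ₀) hρ
  · have hlt : 2 * (p - r) / (p - 1) < bigLambda N p := by
      refine lt_of_le_of_ne (not_lt.1 fun h => hr.not_gt ((lt_rStar_iff hp).2 h)) fun h => ?_
      exact hr.ne' ((eq_rStar_iff hp).2 h)
    rw [decayTable_of_gt hr]
    exact ⟨_, ρ₁, isAdmissibleWeight_of_lt hΦ hK hρ₁ hγpos hlt hgc hCg hgb, isBigO_refl _ _⟩

end Table

end SingularElliptic

/-! ### Assembly of the three parts -/

theorem mainTheorem6 (p r β : ℝ) (hp : 1 < p) (hr : 0 < r) (hrp : r < p) :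
    -- the limit `q_f` exists and `p_f = p`
    (Tendsto (growthQuotient (fEx p r β)) atTop (𝓝 (qExp (fEx p r β))) ∧
      pExp (fEx p r β) = p) ∧
    -- formula for `f'`, well-posedness of `F`, and expansions of `F`, `f' F` and `f F / s`
    (∀ s : ℝ, 2 < s → HasDerivAt (fEx p r β)
      (p * s ^ (p - 1) + r * s ^ (r - 1) * (Real.log s) ^ β +
        β * s ^ (r - 1) * (Real.log s) ^ (β - 1)) s) ∧
    (∀ s : ℝ, 2 < s → IntegrableOn (fun u => 1 / fEx p r β u) (Ioi s)) ∧
    ((fun s => bigF (fEx p r β) s -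
        (1 / (p - 1) * (1 / s ^ (p - 1)) -
          1 / (2 * p - r - 1) * ((Real.log s) ^ β / s ^ (2 * p - r - 1))))
      =O[atTop] fun s => (Real.log s) ^ (β - 1) / s ^ (2 * p - r - 1)) ∧
    ((fun s => deriv (fEx p r β) s * bigF (fEx p r β) s -
        (p / (p - 1) - (p - r) * (p - r - 1) / ((p - 1) * (2 * p - r - 1)) *
          ((Real.log s) ^ β / s ^ (p - r))))
      =O[atTop] fun s => (Real.log s) ^ (β - 1) / s ^ (p - r)) ∧
    ((fun s => fEx p r β s * bigF (fEx p r β) s / s -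
        (1 / (p - 1) + (p - r) / ((p - 1) * (2 * p - r - 1)) *
          ((Real.log s) ^ β / s ^ (p - r))))
      =O[atTop] fun s => (Real.log s) ^ (β - 1) / s ^ (p - r)) ∧
    -- size of the inhomogeneous term `I`
    (∀ N : ℕ, 3 ≤ N → pCrit N < p →
      (∀ᶠ ρ in atTop, 2 < phi (fEx p r β) 2 N ρ ∧
        bigF (fEx p r β) (phi (fEx p r β) 2 N ρ) =
          Real.exp (-2 * ρ) / (2 * (N : ℝ) - 4 * (p / (p - 1)))) ∧
      ((fun ρ => (Real.log (phi (fEx p r β) 2 N ρ)) ^ β / (phi (fEx p r β) 2 N ρ) ^ (p - r))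
        =Θ[atTop] fun ρ => ρ ^ β * Real.exp (-(2 * (p - r) / (p - 1)) * ρ)) ∧
      (inhom (fEx p r β) 2 N
        =O[atTop] fun ρ => ρ ^ β * Real.exp (-(2 * (p - r) / (p - 1)) * ρ)) ∧
      (r ≠ p - 1 →
        inhom (fEx p r β) 2 N
          =Θ[atTop] fun ρ => ρ ^ β * Real.exp (-(2 * (p - r) / (p - 1)) * ρ)) ∧
      (p - 1 < r → ∀ᶠ ρ in atTop, 0 < inhom (fEx p r β) 2 N ρ) ∧
      (r < p - 1 → ∀ᶠ ρ in atTop, inhom (fEx p r β) 2 N ρ < 0)) ∧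
    -- existence of the two-parameter family `η`, with the decay bounds of the table
    (∀ N : ℕ, 3 ≤ N → pCrit N < p → p < pSob N →
      ∃ ρ₀ > 0, ∃ ε > 0,
        (∀ ρ ≥ ρ₀, 2 < phi (fEx p r β) 2 N ρ ∧
          bigF (fEx p r β) (phi (fEx p r β) 2 N ρ) =
            Real.exp (-2 * ρ) / (2 * (N : ℝ) - 4 * (p / (p - 1)))) ∧
        ∀ A B : ℝ, 0 < A → 0 < B → A + B < ε →
          ∃ η : ℝ → ℝ, IsEtaSolution (fEx p r β) 2 N ρ₀ A B η ∧
            (fun ρ => |η ρ| + |deriv η ρ|) =O[atTop] decayTable N p r β) := by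

  have hqb : ∀ N : ℕ, bCoef N (qExp (fEx p r β)) = 2 * (N : ℝ) - 4 * (p / (p - 1)) := fun N => by
    rw [qExp_fEx β hp hrp, bCoef]
  have hbpos : ∀ N : ℕ, 3 ≤ N → pCrit N < p → 0 < bCoef N (qExp (fEx p r β)) :=
    fun N hN hpc => by
      rw [qExp_fEx β hp hrp]
      exact bCoef_pos hp hN hpc
  refine ⟨⟨?_, pExp_fEx β hp hrp⟩, fun s hs => hasDerivAt_fEx p r β (by linarith),
    fun s hs => integrableOn_inv_fEx hp (by linarith), bigF_fEx_expansion β hp hrp,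
    deriv_mul_bigF_expansion β hp hrp, mul_bigF_div_expansion β hp hrp, ?_, ?_⟩
  · rw [qExp_fEx β hp hrp]
    exact tendsto_growthQuotient_fEx β hp hrp
  · intro N hN hpc
    have hb := hbpos N hN hpc
    refine ⟨?_, logDiv_phi_isTheta hp hrp hb β, inhom_isBigO hp hrp hb, fun hr' => ?_,
      fun hr' => ?_, fun hr' => ?_⟩
    · rw [← hqb]
      exact eventually_phi_spec hp hb
    · obtain ⟨c, hc, h⟩ := inhom_isEquivalent hp hrp hb hr'
      exact h.isTheta.trans ((isTheta_const_mul_left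
        (mul_ne_zero hc.ne' (sub_ne_zero.2 hr'))).2 (isTheta_refl (expWeight p r β) atTop))
    · filter_upwards [inhom_sign hp hrp hb hr'.ne'] with ρ hρ
      exact (pos_iff_pos_of_mul_pos hρ).1 (sub_pos.2 hr')
    · filter_upwards [inhom_sign hp hrp hb hr'.ne] with ρ hρ
      exact (neg_iff_neg_of_mul_pos hρ).1 (sub_neg.2 hr')
  · intro N hN hpc hpS
    have hb := hbpos N hN hpc
    obtain ⟨w, ρ₁, hw, hwT⟩ := exists_admissibleWeight (β := β) hN hp hrp hpc hpS
    have hΦ := (isFundamentalPair_and_hasKernelBound hN hp hpc hpS).1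
    rw [← qExp_fEx β hp hrp] at hΦ
    obtain ⟨ρ₀, hρ₀, ε, hε, hspec, hη⟩ := exists_etaSolution hp hrp hb hΦ hw
    refine ⟨ρ₀, hρ₀, ε, hε, ?_, fun A B hA hB hAB => ?_⟩
    · rw [← hqb]
      exact hspec
    · obtain ⟨η, h1, h2⟩ := hη A B hA hB hAB
      exact ⟨η, h1, h2.trans hwT⟩
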